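/- Let $r\ge 1$ and let $(R_{\alpha,n})_{0\le\alpha\le r+1,\,n\in\mathbb Z}$ be a solution, with nonzero entries in a field, of the $A_r$ $Q$-system $$R_{\alpha,n+1}R_{\alpha,n-1}=R_{\alpha,n}^2+R_{\alpha+1,n}R_{\alpha-1,n}\quad(1\le\alpha\le r),\qquad R_{0,n}=R_{r+1,n}=1 .$$ A Motzkin path is $\mathbf m=(m_1,\dots,m_r)\in\mathbb Z^r$ with $|m_\alpha-m_{\alpha+1}|\le 1$; its seed is $\mathbf x_{\mathbf m}=(R_{\alpha,m_\alpha},R_{\alpha,m_\alpha+1})_{1\le\alpha\le r}$, and $\mathcal M_r$ is the set of Motzkin paths with $\min_\alpha m_\alpha=0$. The weighted graph $\Gamma_{\mathbf m}$. Put $f(\alpha)=\alpha+\#\{1\le\beta<\alpha: m_{\beta+1}=m_\beta+1\}$. The vertices are $0,1,\dots,f(r)+2$, with root $0$, and some further vertices $i'$. There are $2r+1$ skeleton edges, each oriented both ways: edge $1$ joins $1$ and $0$; edge $2\alpha$ ($1\le\alpha\le r$) joins $f(\alpha)+1$ and $f(\alpha)$; edge $2\alpha-1$ ($2\le\alpha\le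 r$) joins $f(\alpha)$ and $f(\alpha)-1$ if $m_\alpha=m_{\alpha-1}+1$, and joins $f(\alpha)'$ and $f(\alpha)$ otherwise; edge $2r+1$ joins $f(r)+2$ and $f(r)+1$. In addition there is a down-pointing edge $f(\gamma)+1\to f(\beta)$ whenever $\beta<\gamma$ and $m_{\delta+1}=m_\delta-1$ for all $\beta\le\delta<\gamma$. Edges pointing away from the root have weight $1$. With $\lambda_{\alpha,n}=R_{\alpha,n+1}/R_{\alpha,n}$ and $\mu_{\alpha,n}=R_{\alpha,n}/R_{\alpha-1,n}$, skeleton edge $\beta$, oriented towards the root ($i+1\to i$ or $i'\to i$), has weight $y_\beta$, where $$y_{2\alpha-1}=\frac{\lambda_{\alpha,m_\alpha}}{\lambda_{\alpha-1,m_{\alpha-1}}},\qquad y_{2\alpha}=\frac{\mu_{\alpha+1,m_\alpha+1}}{\mu_{\alpha,m_\alpha}}\,A_\alpha B_\alpha,$$ $A_\alpha=\lambda_{\alpha+1,m_{\alpha+1}}/\lambda_{\alpha+1,m_\alpha}$ if $m_\alpha=m_{\alpha+1}+1$ and $A_\alpha=1$ otherwise, $B_\alpha=\lambda_{\alpha-1,m_\alpha}/\lambda_{\alpha-1,m_{\alpha-1}}$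 if $m_{\alpha-1}=m_\alpha+1$ and $B_\alpha=1$ otherwise (the values of $m_0$ and $m_{r+1}$ are immaterial since $\lambda_{0,n}=\lambda_{r+1,n}=1$). Writing $y_{u,v}$ for the weight of $u\to v$, an additional edge $a\to b$ has weight $y_{a,b}=\prod_{b\le i<a}y_{i+1,i}\big/\prod_{b<i<a}y_{i',i}$. Lattice paths. The allowed steps are $(x,a)\to(x+1,a+1)$ for an edge $a\to a+1$; $(x,a)\to(x+2,a)$ for $a\to a'\to a$; and $(x,a)\to(x+2-h,a-h)$ for an edge $a\to a-h$, $h\ge1$. A step has the product of the weights of its edges as weight, and the weight of a family of paths is the product of the weights of all its steps. A family of paths is strongly non-intersecting if no two of its paths share a vertex, no two cross, and there are no steps $P\to Q$ and $S\to T$ of two different paths such that $P\to T$ and $S\to Q$ are allowed steps which cross (cross: the segments meet in a point interior to both). Claim. (a) Let $\mathbf m\in\mathcal M_r$, $1\le\alpha\le r$ and $n\ge\alpha-1$. All edge weights of $\Gamma_{\mathbf m}$ are Laurent monomials in $\mathbf x_{\mathbf m}$; there are finitely many strongly non-intersecting families of $\alpha$ paths joining the starting points $(2i-2,0)$, $1\le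 i\le\alpha$, to the end points $(2n+2\alpha-2j,0)$, $1\le j\le\alpha$; and $$R_{\alpha,n+m_1}=(R_{1,m_1})^\alpha\, Z,$$ where $Z$ is the sum of the weights of these families. (b) For every Motzkin path $\mathbf m$, every $1\le\alpha\le r$ and every $n\in\mathbb Z$, $R_{\alpha,n}$ is a Laurent polynomial in the seed $\mathbf x_{\mathbf m}$ with non-negative integer coefficients, and these depend only on $r,\mathbf m,\alpha,n$. -/

import Mathlib

universe u

/-! ## The `A_r` `Q`-system and Motzkin seeds -/

/-- `R` is a solution of the `A_r` `Q`-system in the field `K`: only the values `R α n` with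
`0 ≤ α ≤ r + 1` matter. The variables are nonzero, as all the expressions below divide by them. -/
structure IsQSystemSolution {K : Type u} [Field K] (r : ℕ) (R : ℕ → ℤ → K) : Prop where
  bottom : ∀ n, R 0 n = 1
  top : ∀ n, R (r + 1) n = 1
  rel : ∀ α n, 1 ≤ α → α ≤ r →
    R α (n + 1) * R α (n - 1) = R α n ^ 2 + R (α + 1) n * R (α - 1) n
  ne_zero : ∀ α n, 1 ≤ α → α ≤ r → R α n ≠ 0

/-- `(m 1, …, m r)` is a Motzkin path. Values of `m` outside `1, …, r` are irrelevant. -/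
def IsMotzkinPath (r : ℕ) (m : ℕ → ℤ) : Prop :=
  ∀ α, 1 ≤ α → α < r → |m α - m (α + 1)| ≤ 1

/-- The fundamental domain: Motzkin paths whose minimum is `0`. -/
def IsFundamentalMotzkinPath (r : ℕ) (m : ℕ → ℤ) : Prop :=
  IsMotzkinPath r m ∧ (∀ α, 1 ≤ α → α ≤ r → 0 ≤ m α) ∧ ∃ α, 1 ≤ α ∧ α ≤ r ∧ m α = 0

/-- The seed `x_m`: the `2r` variables `R_{α, m_α}` and `R_{α, m_α + 1}`, where `α = j.1 + 1`. -/
def motzkinSeed {K : Type u} [Field K] (r : ℕ) (m : ℕ → ℤ) (R : ℕ → ℤ → K)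
    (j : Fin r × Fin 2) : K :=
  R (j.1 + 1) (m (j.1 + 1) + ((j.2 : ℕ) : ℤ))

/-- Value at `x` of the Laurent monomial with exponents `e`. -/
def laurentMonomial {K : Type u} [Field K] {ι : Type} [Fintype ι] (e : ι → ℤ) (x : ι → K) : K :=
  ∏ j, x j ^ e j

/-- Value at `x` of the Laurent polynomial with non-negative integer coefficients `P`
(`P e` is the coefficient of the monomial with exponents `e`). -/
def evalLaurent {K : Type u} [Field K] {ι : Type} [Fintype ι] (P : (ι → ℤ) →₀ ℕ)
    (x : ι → K) : K :=
  P.sum fun e c => (c : K) * laurentMonomial e x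

/-! ## The graph `Γ_m` -/

/-- Vertices `i` (`main i`) and `i'` (`side i`, attached to `i` by a horizontal edge). -/
inductive GammaVertex where
  | main (i : ℕ)
  | side (i : ℕ)
  deriving DecidableEq

/-- The label in `Γ_m` of the lower end of the vertical skeleton edge number `2α`, i.e. of
vertex `j + 1` of the piece of the descending segment whose `(j+1)`-st entry is `m_α`
(`j = 0, 1, …`). Passing from `α` to `α + 1` raises it by `1` inside a descending segment
and at a flat separation, and by `2` at an ascending separation. -/
def gammaLabel (m : ℕ → ℤ) (α : ℕ) : ℕ :=
  α + ((Finset.Ico 1 α).filter fun β => m (β + 1) = m β + 1).card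

/-- The skeleton edge number `β` (`1 ≤ β ≤ 2r + 1`), as a pair (end farther from the root,
end nearer to the root). Edge `1` is `1 → 0`, edge `2r + 1` is the topmost one, and edge `2α - 1`
with `2 ≤ α ≤ r` is vertical if the path ascends from `α - 1` to `α` and horizontal otherwise
(both inside a descending segment and at a flat separation). -/
def skeletonEdge (r : ℕ) (m : ℕ → ℤ) (β : ℕ) : GammaVertex × GammaVertex :=
  let α := (β + 1) / 2
  if Even β then (.main (gammaLabel m α + 1), .main (gammaLabel m α))
  else if α = 1 then (.main 1, .main 0)
  else if α = r + 1 then (.main (gammaLabel m r + 2), .main (gammaLabel m r + 1))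
  else if m α = m (α - 1) + 1 then (.main (gammaLabel m α), .main (gammaLabel m α - 1))
  else (.side (gammaLabel m α), .main (gammaLabel m α))

/-- `u → v` is a skeleton edge pointing towards the root. -/
def IsSkeletonEdge (r : ℕ) (m : ℕ → ℤ) (u v : GammaVertex) : Prop :=
  ∃ β, 1 ≤ β ∧ β ≤ 2 * r + 1 ∧ skeletonEdge r m β = (u, v)

/-- `u → v` is one of the additional down-pointing edges: it joins two vertices, neither
consecutive nor equal, of the part `1, …, k + 1` of the piece of one descending segment of
length `k`. Here `m_β, …, m_γ` lie in one descending segment. -/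
def IsExtraEdge (r : ℕ) (m : ℕ → ℤ) (u v : GammaVertex) : Prop :=
  ∃ β γ, 1 ≤ β ∧ β < γ ∧ γ ≤ r ∧ (∀ δ, β ≤ δ → δ < γ → m (δ + 1) = m δ - 1) ∧
    u = .main (gammaLabel m γ + 1) ∧ v = .main (gammaLabel m β)

/-- `u → v` is an oriented edge of `Γ_m`: skeleton edges are doubly oriented. -/
def IsGammaEdge (r : ℕ) (m : ℕ → ℤ) (u v : GammaVertex) : Prop :=
  IsSkeletonEdge r m u v ∨ IsSkeletonEdge r m v u ∨ IsExtraEdge r m u v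

/-! ## The weights on `Γ_m` -/

section Weights

variable {K : Type u} [Field K]

def lambdaRatio (R : ℕ → ℤ → K) (α : ℕ) (n : ℤ) : K := R α (n + 1) / R α n

def muRatio (R : ℕ → ℤ → K) (α : ℕ) (n : ℤ) : K := R α n / R (α - 1) n

/-- The skeleton weights `y_{2α-1}(m)`. -/
def oddWeight (m : ℕ → ℤ) (R : ℕ → ℤ → K) (α : ℕ) : K :=
  lambdaRatio R α (m α) / lambdaRatio R (α - 1) (m (α - 1))

/-- The skeleton weights `y_{2α}(m)`. -/
def evenWeight (m : ℕ → ℤ) (R : ℕ → ℤ → K) (α : ℕ) : K :=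
  muRatio R (α + 1) (m α + 1) / muRatio R α (m α)
    * (if m α = m (α + 1) + 1 then
        lambdaRatio R (α + 1) (m (α + 1)) / lambdaRatio R (α + 1) (m α) else 1)
    * (if m (α - 1) = m α + 1 then
        lambdaRatio R (α - 1) (m α) / lambdaRatio R (α - 1) (m (α - 1)) else 1)

/-- The weight `y_β(m)` of the skeleton edge number `β`. -/
def skeletonWeight (m : ℕ → ℤ) (R : ℕ → ℤ → K) (β : ℕ) : K :=
  if Even β then evenWeight m R (β / 2) else oddWeight m R ((β + 1) / 2)

/-- The weight `y_{u,v}(m)` of the skeleton edge `u → v` pointing towards the root: the sum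
has exactly one term if there is such an edge, as distinct numbers give distinct edges. -/
def skeletonEdgeWeight (r : ℕ) (m : ℕ → ℤ) (R : ℕ → ℤ → K) (u v : GammaVertex) : K :=
  ∑ β ∈ (Finset.Icc 1 (2 * r + 1)).filter (fun β => skeletonEdge r m β = (u, v)),
    skeletonWeight m R β

/-- The weight `y_{a,b}(m)` of the additional edge `a → b`. -/
def extraEdgeWeight (r : ℕ) (m : ℕ → ℤ) (R : ℕ → ℤ → K) (a b : ℕ) : K :=
  (∏ i ∈ Finset.Ico b a, skeletonEdgeWeight r m R (.main (i + 1)) (.main i)) /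
    ∏ i ∈ Finset.Ioo b a, skeletonEdgeWeight r m R (.side i) (.main i)

open Classical in
/-- The weight of the oriented edge `u → v` of `Γ_m`; edges pointing away from the root have
weight `1`. -/
noncomputable def gammaWeight (r : ℕ) (m : ℕ → ℤ) (R : ℕ → ℤ → K) (u v : GammaVertex) : K :=
  if IsSkeletonEdge r m u v then skeletonEdgeWeight r m R u v
  else if IsSkeletonEdge r m v u then 1
  else match u, v with
    | .main a, .main b => if IsExtraEdge r m u v then extraEdgeWeight r m R a b else 0
    | _, _ => 0

end Weights

/-! ## Paths on the square lattice -/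

/-- Points `(x, y)` of the lattice; the height `y` is a vertex `main y` of `Γ_m`. -/
abbrev LatticePoint : Type := ℤ × ℕ

/-- The allowed steps: `(x, a) → (x + 1, a + 1)` for an edge `a → a + 1`, `(x, a) → (x + 2, a)`
for `a → a' → a`, and `(x, a) → (x + 2 - h, a - h)` for an edge `a → a - h` with `h ≥ 1`. -/
def IsLatticeStep (r : ℕ) (m : ℕ → ℤ) (P Q : LatticePoint) : Prop :=
  (Q.2 = P.2 + 1 ∧ Q.1 = P.1 + 1 ∧ IsGammaEdge r m (.main P.2) (.main Q.2)) ∨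
  (Q.2 = P.2 ∧ Q.1 = P.1 + 2 ∧
    IsGammaEdge r m (.main P.2) (.side P.2) ∧ IsGammaEdge r m (.side P.2) (.main P.2)) ∨
  (Q.2 < P.2 ∧ Q.1 = P.1 + 2 - ((P.2 : ℤ) - (Q.2 : ℤ)) ∧
    IsGammaEdge r m (.main P.2) (.main Q.2))

/-- The weight of an allowed step. -/
noncomputable def stepWeight {K : Type u} [Field K] (r : ℕ) (m : ℕ → ℤ) (R : ℕ → ℤ → K)
    (P Q : LatticePoint) : K :=
  if Q.2 = P.2 then
    gammaWeight r m R (.main P.2) (.side P.2) * gammaWeight r m R (.side P.2) (.main P.2)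
  else gammaWeight r m R (.main P.2) (.main Q.2)

/-- `L` is the list of the successive vertices of a lattice path from `s` to `e`. -/
def IsLatticePath (r : ℕ) (m : ℕ → ℤ) (s e : LatticePoint) (L : List LatticePoint) : Prop :=
  L.head? = some s ∧ L.getLast? = some e ∧ L.IsChain (IsLatticeStep r m)

/-- The successive steps of a path. -/
def pathSteps (L : List LatticePoint) : List (LatticePoint × LatticePoint) := L.zip L.tail

noncomputable def pathWeight {K : Type u} [Field K] (r : ℕ) (m : ℕ → ℤ) (R : ℕ → ℤ → K)
    (L : List LatticePoint) : K :=
  ((pathSteps L).map fun s => stepWeight r m R s.1 s.2).prod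

/-- A lattice point as a point of the plane. -/
def LatticePoint.toPlane (P : LatticePoint) : ℝ × ℝ := ((P.1 : ℝ), (P.2 : ℝ))

/-- The segments `[P, Q]` and `[S, T]` cross: they meet in a point interior to both. -/
def SegmentsCross (P Q S T : LatticePoint) : Prop :=
  (openSegment ℝ P.toPlane Q.toPlane ∩ openSegment ℝ S.toPlane T.toPlane).Nonempty

/-- Two paths are strongly non-intersecting: they share no vertex, no step of the first crosses
a step of the second, and no step `P → Q` of the first and `S → T` of the second can be made to
cross by an exchange, i.e. `P → T` and `S → Q` are not allowed steps that cross. -/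
def StronglyNonIntersecting (r : ℕ) (m : ℕ → ℤ) (L L' : List LatticePoint) : Prop :=
  (∀ P ∈ L, P ∉ L') ∧
  ∀ P Q S T, (P, Q) ∈ pathSteps L → (S, T) ∈ pathSteps L' →
    ¬ SegmentsCross P Q S T ∧
    ¬ (IsLatticeStep r m P T ∧ IsLatticeStep r m S Q ∧ SegmentsCross P T S Q)

/-- Starting points `(2i - 2, 0)`, `i = 1, …, α` (here `i` is counted from `0`). -/
def startPoint {α : ℕ} (i : Fin α) : LatticePoint := (2 * (((i : ℕ) : ℤ) + 1) - 2, 0)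

/-- End points `(2n + 2α - 2j, 0)`, `j = 1, …, α` (here `j` is counted from `0`). -/
def endPoint {α : ℕ} (n : ℕ) (j : Fin α) : LatticePoint :=
  (2 * (n : ℤ) + 2 * (α : ℤ) - 2 * (((j : ℕ) : ℤ) + 1), 0)

/-- The families of `α` pairwise strongly non-intersecting paths which join the starting points
to the end points (in any order). -/
def stronglyNonIntersectingFamilies (r : ℕ) (m : ℕ → ℤ) (α n : ℕ) :
    Set (Fin α → List LatticePoint) :=
  {F | (∃ σ : Equiv.Perm (Fin α), ∀ i, IsLatticePath r m (startPoint i) (endPoint n (σ i)) (F i)) ∧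
    ∀ i j, i ≠ j → StronglyNonIntersecting r m (F i) (F j)}

/-- The partition function of these families. -/
noncomputable def stronglyNonIntersectingPartition {K : Type u} [Field K] (r : ℕ) (m : ℕ → ℤ)
    (R : ℕ → ℤ → K) (α n : ℕ) : K :=
  ∑ᶠ F ∈ stronglyNonIntersectingFamilies r m α n, ∏ i, pathWeight r m R (F i)

/-! Path formula. Regard the first row of the solution as the moments of a linear functional. The
other rows are then Hankel determinants of the first (`IsQDSolution.det_hankel`), and the ratios of
variables which occur as weights are entries `q`, `e` of the quotient-difference scheme. Write
`qdMoment S α k n` for the functional applied to `x ^ n` times the monic polynomial of degree `α`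
which is orthogonal for the moments shifted by `k`. These numbers satisfy two contiguity relations,
in the degree (`qdMoment_succ`) and in the shift (`IsQDSolution.qdMoment_shift`). The row `r + 1` is
constant and the row `r + 2` is continued by zero, so the moments of degree `r + 1` vanish and the
scheme is finite.

A Motzkin path selects a shift `m d - d + 1` for each degree `d`. The contiguity relations between
the selected polynomials have the weights of the graph as coefficients, and they are exactly the
recursion for the generating functions of single paths by starting height. Induction on the number
of hops (`PathSumValues.succ`) identifies the path sums with moments; at the root this gives
`pathSum_eq`.

For `α` paths, the Hankel determinant of path sums has to be expanded into strongly non-intersecting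
families. Shearing the lattice makes every step up vertical and every other step lead to the next
column, so a family is cut into alternating layers of rises and hops. In each layer two rows of the
determinant either are proportional on the smaller of their supports, so that a row operation
removes the common terms, or have at most one common target, which contributes two equal rows. What
survives are the choices in which no two moves can be exchanged (`det_layer_down`, `det_layer_up`).
Such moves preserve the order of the paths, so no signs occur. The geometric condition on families
is the same condition layer by layer (`IsLayered.stronglyNonIntersecting_iff`), and
`finsum_tailFamilies` is the induction over the columns.

Positivity. This part does not use paths. Raising and lowering one entry of a seed correspond to
elementary matrices of size `r + 1`, the chips, and the `Q`-system says that raising chips can be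
moved past lowering chips. For suitable orders of the entries the product of all raising and all
lowering chips therefore transports a seed by one unit of time (`IsCompatible.flat`), and `R a (m a
+ n)` is `R a (m a)` times the leading minor of size `a` of the `n`-th power of this monodromy
(`IsCompatible.eq_leadingMinor`). Its factors have Laurent monomials of the seed as parameters and
preserve positivity of all minors (`isPositiveFactor_transvection`). Times below the seed are
reached by reversing the time. -/

/-! ## The quotient-difference scheme of a solution -/

section QuotientDifference

variable {K : Type u} [Field K]

/-- The solution `R`, continued by `0` above the row `r + 1`. -/
def truncatedSolution (r : ℕ) (R : ℕ → ℤ → K) (α : ℕ) (n : ℤ) : K :=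
  if α ≤ r + 1 then R α n else 0

/-- A solution of the octahedron-type relation in the rows `0, …, r + 1`, zero in the row `r + 2`. -/
structure IsQDSolution (r : ℕ) (S : ℕ → ℤ → K) : Prop where
  bottom : ∀ n, S 0 n = 1
  top : ∀ n, S (r + 1) n = 1
  above : ∀ n, S (r + 2) n = 0
  rel : ∀ α n, α ≤ r →
    S (α + 1) (n + 1) * S (α + 1) (n - 1) = S (α + 1) n ^ 2 + S (α + 2) n * S α n
  ne_zero : ∀ α n, α ≤ r + 1 → S α n ≠ 0

theorem truncatedSolution_of_le {r : ℕ} {R : ℕ → ℤ → K} {α : ℕ} (h : α ≤ r + 1) (n : ℤ) :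
    truncatedSolution r R α n = R α n := by
  simp [truncatedSolution, h]

theorem IsQSystemSolution.isQDSolution {r : ℕ} {R : ℕ → ℤ → K} (h : IsQSystemSolution r R) :
    IsQDSolution r (truncatedSolution r R) where
  bottom n := by simp [truncatedSolution, h.bottom]
  top n := by simp [truncatedSolution, h.top]
  above n := by simp [truncatedSolution]
  rel α n hα := by
    rcases Nat.lt_or_eq_of_le hα with hlt | rfl
    · rw [truncatedSolution_of_le (by omega), truncatedSolution_of_le (by omega),
        truncatedSolution_of_le (by omega), truncatedSolution_of_le (by omega),
        truncatedSolution_of_le (by omega)]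
      exact h.rel (α + 1) n (by omega) (by omega)
    · simp [truncatedSolution, h.top]
  ne_zero α n hα := by
    rw [truncatedSolution_of_le hα]
    rcases Nat.eq_zero_or_pos α with rfl | hpos
    · simp [h.bottom]
    · rcases Nat.lt_or_eq_of_le hα with hlt | rfl
      · exact h.ne_zero α n hpos (by omega)
      · simp [h.top]

/-- The entry `q_{α+1}^{(k)}` of the quotient-difference scheme. -/
def qdQ (S : ℕ → ℤ → K) (α : ℕ) (k : ℤ) : K :=
  S (α + 1) (k + α + 1) * S α (k + α - 1) / (S (α + 1) (k + α) * S α (k + α))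

/-- The entry `e_{α+1}^{(k)}` of the quotient-difference scheme. -/
def qdE (S : ℕ → ℤ → K) (α : ℕ) (k : ℤ) : K :=
  S (α + 2) (k + α + 1) * S α (k + α) / (S (α + 1) (k + α) * S (α + 1) (k + α + 1))

/-- The adjacent orthogonal polynomial of degree `α` and shift `k`, applied to the moment
sequence `S 1` at `n`. -/
def qdMoment (S : ℕ → ℤ → K) : ℕ → ℤ → ℤ → K
  | 0, _, n => S 1 n
  | α + 1, k, n => qdMoment S α (k + 1) (n + 1) - qdQ S α k * qdMoment S α k n

variable {r : ℕ} {S : ℕ → ℤ → K}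

/-- The multiplicative rhombus rule of the quotient-difference scheme is pure cancellation; the
relation between neighbouring rows enters only the additive rule. -/
theorem IsQDSolution.rhombus_mul (h : IsQDSolution r S) (β : ℕ) (k : ℤ) (hβ : β + 1 ≤ r) :
    qdE S β (k + 1) * qdQ S β (k + 1) = qdQ S (β + 1) k * qdE S β k := by
  have nz := h.ne_zero
  simp only [qdE, qdQ]
  push_cast
  have e1 : k + 1 + (β : ℤ) = k + β + 1 := by ring
  have e2 : k + ((β : ℤ) + 1) = k + β + 1 := by ring
  rw [e1, e2, add_sub_cancel_right]
  have h1 := nz β (k + β) (by omega)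
  have h2 := nz β (k + β + 1) (by omega)
  have h3 := nz (β + 1) (k + β) (by omega)
  have h4 := nz (β + 1) (k + β + 1) (by omega)
  have h5 := nz (β + 1) (k + β + 1 + 1) (by omega)
  have h6 := nz (β + 1 + 1) (k + β + 1) (by omega)
  rw [show β + 2 = β + 1 + 1 from rfl]
  field_simp

/-- After clearing denominators this is a combination of the relations in the rows `β + 1` and `β +
2`. -/
theorem IsQDSolution.rhombus_add (h : IsQDSolution r S) (β : ℕ) (k : ℤ) (hβ : β + 1 ≤ r) :
    qdQ S (β + 1) (k + 1) + qdE S β (k + 1) = qdQ S (β + 1) k + qdE S (β + 1) k := by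
  have nz := h.ne_zero
  simp only [qdE, qdQ]
  push_cast
  have e1 : k + 1 + (β : ℤ) = k + β + 1 := by ring
  have e2 : k + ((β : ℤ) + 1) = k + β + 1 := by ring
  have e3 : k + 1 + ((β : ℤ) + 1) = k + β + 1 + 1 := by ring
  rw [e1, e2, e3, add_sub_cancel_right, add_sub_cancel_right]
  have h3 := nz (β + 1) (k + β) (by omega)
  have h4 := nz (β + 1) (k + β + 1) (by omega)
  have h5 := nz (β + 1) (k + β + 1 + 1) (by omega)
  have h6 := nz (β + 1 + 1) (k + β + 1) (by omega)
  have h7 := nz (β + 1 + 1) (k + β + 1 + 1) (by omega)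
  have r1 := h.rel β (k + β + 1) (by omega)
  have r2 := h.rel (β + 1) (k + β + 1 + 1) (by omega)
  rw [add_sub_cancel_right] at r1 r2
  simp only [show β + 2 = β + 1 + 1 from rfl, show β + 1 + 2 = β + 1 + 1 + 1 from rfl] at *
  field_simp
  linear_combination S (β + 1) (k + β + 1) * S (β + 1) (k + β + 1) * r2 -
    S (β + 1 + 1) (k + β + 1 + 1) * S (β + 1 + 1) (k + β + 1 + 1) * r1

theorem IsQDSolution.rhombus_add_zero (h : IsQDSolution r S) (k : ℤ) :
    qdQ S 0 (k + 1) = qdQ S 0 k + qdE S 0 k := by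
  have h1 := h.ne_zero 1 k (by omega)
  have h2 := h.ne_zero 1 (k + 1) (by omega)
  have r1 := h.rel 0 (k + 1) (by omega)
  simp only [qdE, qdQ, h.bottom]
  simp [h.bottom] at r1 ⊢
  field_simp
  linear_combination r1

theorem qdMoment_succ (S : ℕ → ℤ → K) (α : ℕ) (k n : ℤ) :
    qdMoment S α (k + 1) (n + 1) = qdMoment S (α + 1) k n + qdQ S α k * qdMoment S α k n := by
  simp [qdMoment]

/-- The second contiguity relation. In the induction both degrees are expanded by `qdMoment_succ`;
the two rhombus rules are precisely the conditions under which the coefficients match. -/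
theorem IsQDSolution.qdMoment_shift (h : IsQDSolution r S) (α : ℕ) (hα : α ≤ r) (k n : ℤ) :
    qdMoment S (α + 1) k n = qdMoment S (α + 1) (k + 1) n + qdE S α k * qdMoment S α (k + 1) n := by
  induction α generalizing k n with
  | zero =>
    simp only [qdMoment]
    rw [h.rhombus_add_zero k]; ring
  | succ β ih =>
    have i1 := ih (by omega) (k + 1) (n + 1)
    have i2 := ih (by omega) k n
    have d0 := qdMoment_succ S β (k + 1) n
    have d1 := qdMoment_succ S (β + 1) k n
    have d2 := qdMoment_succ S (β + 1) (k + 1) n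
    have r1 := h.rhombus_mul β k hα
    have r2 := h.rhombus_add β k hα
    linear_combination d2 - d1 + i1 - qdQ S (β + 1) k * i2 + qdE S β (k + 1) * d0 +
      qdMoment S (β + 1) (k + 1) n * r2 + qdMoment S β (k + 1) n * r1

/-- Orthogonality, proved together with the norms. In the new degree both terms vanish for `j < β`,
and for `j = β` they cancel because `q` is the quotient of the two norms. In the shift relation the
term of full degree vanishes by orthogonality, so the new norm is `e` times the old one. -/
theorem IsQDSolution.qdMoment_vanish_aux (h : IsQDSolution r S) (α : ℕ) (hα : α ≤ r + 1) :
    (∀ k : ℤ, ∀ j : ℕ, j < α → qdMoment S α k (k + j) = 0) ∧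
      (∀ k : ℤ, qdMoment S α k (k + α) = S (α + 1) (k + α) / S α (k + α - 1)) := by
  induction α with
  | zero => simp [qdMoment, h.bottom]
  | succ β ih =>
    obtain ⟨v, d⟩ := ih (by omega)
    have key : ∀ k : ℤ, ∀ j : ℕ, j < β + 1 → qdMoment S (β + 1) k (k + j) = 0 := by
      intro k j hj
      have e : k + (j : ℤ) + 1 = k + 1 + j := by ring
      rcases Nat.lt_or_eq_of_le (Nat.le_of_lt_succ hj) with hlt | rfl
      · simp only [qdMoment]
        rw [e, v _ _ hlt, v _ _ hlt]; simp
      · simp only [qdMoment]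
        rw [e, d, d]
        have h1 := h.ne_zero j (k + j) (by omega)
        have h2 := h.ne_zero j (k + j - 1) (by omega)
        have h3 := h.ne_zero (j + 1) (k + j) (by omega)
        have e1 : k + 1 + (j : ℤ) = k + j + 1 := by ring
        simp only [qdQ, e1, add_sub_cancel_right]
        field_simp
        ring
    refine ⟨key, fun k => ?_⟩
    rw [h.qdMoment_shift β (by omega)]
    have e : k + ((β + 1 : ℕ) : ℤ) = k + 1 + β := by push_cast; ring
    have e1 : k + 1 + (β : ℤ) = k + β + 1 := by ring
    rw [e, key _ _ (by omega), d, e1]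
    have h1 := h.ne_zero β (k + β) (by omega)
    have h3 := h.ne_zero (β + 1) (k + β) (by omega)
    have h4 := h.ne_zero (β + 1) (k + β + 1) (by omega)
    simp only [qdE, add_sub_cancel_right, show β + 2 = β + 1 + 1 from rfl]
    field_simp
    ring

theorem IsQDSolution.qdMoment_vanish (h : IsQDSolution r S) {α : ℕ} (hα : α ≤ r + 1) {k n : ℤ}
    (h₁ : k ≤ n) (h₂ : n < k + α) : qdMoment S α k n = 0 := by
  have := (h.qdMoment_vanish_aux α hα).1 k (n - k).toNat (by omega)
  rwa [show k + ((n - k).toNat : ℤ) = n by omega] at this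

/-- The entry `e` of index `r` contains the zero row, so the polynomial of degree `r + 1` does not
depend on the shift. The shift may be taken equal to `n`, where orthogonality applies. Thus the
first row satisfies a linear recurrence of order `r + 1`. -/
theorem IsQDSolution.qdMoment_top (h : IsQDSolution r S) (k n : ℤ) :
    qdMoment S (r + 1) k n = 0 := by
  have step : ∀ k, qdMoment S (r + 1) k n = qdMoment S (r + 1) (k + 1) n := by
    intro k
    rw [h.qdMoment_shift r le_rfl]
    simp [qdE, h.above]
  have : ∀ j : ℤ, qdMoment S (r + 1) (n + j) n = qdMoment S (r + 1) n n := by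
    intro j
    induction j using Int.induction_on with
    | zero => simp
    | succ i ih => rw [← ih, step (n + i)]; ring_nf
    | pred i ih => rw [← ih, step (n + (-i - 1))]; ring_nf
  have h2 := this (k - n)
  rw [show n + (k - n) = k by ring] at h2
  rw [h2]
  exact h.qdMoment_vanish le_rfl le_rfl (by push_cast; omega)

/-- Elimination of the middle term between the two contiguity relations. -/
theorem IsQDSolution.qdMoment_contiguous (h : IsQDSolution r S) (α : ℕ) (hα : α + 1 ≤ r) (k n : ℤ) :
    S (α + 1) (k + α) * S (α + 1) (k + α + 1 + 1) * qdMoment S (α + 1) k n =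
      S (α + 2) (k + α + 1) * S α (k + α + 1) * qdMoment S α (k + 1 + 1) (n + 1) +
      S (α + 1) (k + α + 1) ^ 2 * qdMoment S (α + 1) (k + 1) n := by
  have d := qdMoment_succ S α (k + 1) n
  have s := h.qdMoment_shift α (by omega) k n
  have r1 := h.rel α (k + α + 1) (by omega)
  have h1 := h.ne_zero α (k + α) (by omega)
  have h2 := h.ne_zero α (k + α + 1) (by omega)
  have h3 := h.ne_zero (α + 1) (k + α) (by omega)
  have h4 := h.ne_zero (α + 1) (k + α + 1) (by omega)
  have h5 := h.ne_zero (α + 1) (k + α + 1 + 1) (by omega)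
  have e1 : k + 1 + (α : ℤ) = k + α + 1 := by ring
  rw [add_sub_cancel_right] at r1
  simp only [qdQ, qdE, e1, add_sub_cancel_right] at d s
  rw [d, s]
  field_simp
  linear_combination qdMoment S (α + 1) (k + 1) n * S (α + 1) (k + α + 1) * r1

/-- The polynomials are monic of degree `α`: their coefficients form the unitriangular matrix of row
operations used in `IsQDSolution.det_hankel`. -/
theorem exists_qdMoment_coeff (S : ℕ → ℤ → K) (α : ℕ) : ∀ k : ℤ, ∃ c : ℕ → K, c α = 1 ∧
    (∀ i, α < i → c i = 0) ∧
    ∀ n : ℤ, qdMoment S α k n = ∑ i ∈ Finset.range (α + 1), c i * S 1 (n + i) := by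
  induction α with
  | zero =>
    intro k
    exact ⟨fun i => if i = 0 then 1 else 0, by simp, fun i hi => by simp; omega,
      fun n => by simp [qdMoment]⟩
  | succ α ih =>
    intro k
    obtain ⟨c, c1, c2, c3⟩ := ih (k + 1)
    obtain ⟨d, _, d2, d3⟩ := ih k
    refine ⟨fun i => (if i = 0 then 0 else c (i - 1)) - qdQ S α k * d i, ?_, ?_, ?_⟩
    · simp [c1, d2]
    · intro i hi
      simp [c2 (i - 1) (by omega), d2 i (by omega)]
    · intro n
      simp only [qdMoment, sub_mul, Finset.sum_sub_distrib]
      congr 1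
      · rw [c3, Finset.sum_range_succ' _ (α + 1)]
        simp only [Nat.add_eq_zero_iff, one_ne_zero, and_false, if_false, if_true, zero_mul,
          add_zero, Nat.add_sub_cancel]
        refine Finset.sum_congr rfl fun i _ => ?_
        rw [show n + 1 + (i : ℤ) = n + ((i + 1 : ℕ) : ℤ) by push_cast; ring]
      · rw [d3, Finset.sum_range_succ _ (α + 1), d2 (α + 1) (by omega), Finset.mul_sum]
        simp [mul_assoc]

/-- The norms are quotients of consecutive rows along a diagonal, so their product telescopes. -/
theorem IsQDSolution.prod_qdMoment_diag (h : IsQDSolution r S) (α : ℕ) (hα : α ≤ r + 1) (k : ℤ) :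
    ∏ i ∈ Finset.range α, qdMoment S i k (k + i) = S α (k + α - 1) := by
  induction α with
  | zero => simp [h.bottom]
  | succ β ih =>
    rw [Finset.prod_range_succ, ih (by omega), (h.qdMoment_vanish_aux β (by omega)).2]
    have := h.ne_zero β (k + β - 1) (by omega)
    push_cast
    rw [← add_assoc, add_sub_cancel_right]
    field_simp

/-- The Hankel determinants of the first row of a solution are the other rows. -/
theorem IsQDSolution.det_hankel (h : IsQDSolution r S) (α : ℕ) (hα : α ≤ r + 1) (k : ℤ) :
    (Matrix.of fun i j : Fin α => S 1 (k + (i : ℕ) + (j : ℕ))).det = S α (k + α - 1) := by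
  -- Multiplication by the unitriangular matrix of coefficients replaces the Hankel matrix by the
  -- matrix of the moments `qdMoment S i k (k + j)`, which is upper triangular by orthogonality.
  choose c c1 c2 c3 using fun i : ℕ => exists_qdMoment_coeff S i k
  let P : Matrix (Fin α) (Fin α) K := Matrix.of fun i l => c i l
  have hP : P.det = 1 := by
    rw [Matrix.det_of_isLowerTriangular P]
    · simp [P, c1]
    · intro i j hij
      exact c2 i j hij
  have hmul : P * (Matrix.of fun i j : Fin α => S 1 (k + (i : ℕ) + (j : ℕ))) =
      Matrix.of fun i j : Fin α => qdMoment S i k (k + (j : ℕ)) := by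
    ext i j
    simp only [Matrix.mul_apply, Matrix.of_apply, P, c3]
    rw [Finset.sum_fin_eq_sum_range]
    rw [← Finset.sum_subset (Finset.range_subset_range.2 (Nat.succ_le_of_lt i.2))]
    · refine Finset.sum_congr rfl fun l hl => ?_
      rw [dif_pos (by have := i.2; simp at hl; omega)]
      ring_nf
    · intro l hl hl'
      simp only [Finset.mem_range] at hl hl'
      rw [dif_pos hl, c2 i l (by omega), zero_mul]
  have := congrArg Matrix.det hmul
  rw [Matrix.det_mul, hP, one_mul] at this
  rw [this, Matrix.det_of_isUpperTriangular]
  · simp only [Matrix.of_apply]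
    rw [← h.prod_qdMoment_diag α hα k, Finset.prod_range]
  · intro i j hij
    exact h.qdMoment_vanish (by have := i.2; omega) (by simp) (by simpa using hij)

end QuotientDifference

/-! ## The edges of `Γ_m` and their weights -/

section GammaEdges

variable {r : ℕ} {m : ℕ → ℤ}

theorem gammaLabel_one (m : ℕ → ℤ) : gammaLabel m 1 = 1 := by simp [gammaLabel]

theorem gammaLabel_succ_of_asc {α : ℕ} (hα : 1 ≤ α) (h : m (α + 1) = m α + 1) :
    gammaLabel m (α + 1) = gammaLabel m α + 2 := by
  unfold gammaLabel
  rw [← Finset.insert_Ico_right_eq_Ico_add_one hα, Finset.filter_insert, if_pos h,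
    Finset.card_insert_of_notMem (by simp)]
  ring

theorem gammaLabel_succ_of_not_asc {α : ℕ} (hα : 1 ≤ α) (h : m (α + 1) ≠ m α + 1) :
    gammaLabel m (α + 1) = gammaLabel m α + 1 := by
  unfold gammaLabel
  rw [← Finset.insert_Ico_right_eq_Ico_add_one hα, Finset.filter_insert, if_neg h]
  ring

theorem gammaLabel_succ_ge (m : ℕ → ℤ) {α : ℕ} (hα : 1 ≤ α) :
    gammaLabel m α + 1 ≤ gammaLabel m (α + 1) := by
  by_cases h : m (α + 1) = m α + 1
  · rw [gammaLabel_succ_of_asc hα h]; omega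
  · rw [gammaLabel_succ_of_not_asc hα h]

theorem gammaLabel_add_le (m : ℕ → ℤ) {α : ℕ} (hα : 1 ≤ α) (k : ℕ) :
    gammaLabel m α + k ≤ gammaLabel m (α + k) := by
  induction k with
  | zero => simp
  | succ k ih =>
    have := gammaLabel_succ_ge m (α := α + k) (by omega)
    rw [← add_assoc α]; omega

theorem gammaLabel_le (m : ℕ → ℤ) {α β : ℕ} (hα : 1 ≤ α) (h : α ≤ β) :
    gammaLabel m α + (β - α) ≤ gammaLabel m β := by
  have := gammaLabel_add_le m hα (β - α)
  rwa [Nat.add_sub_cancel' h] at this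

theorem le_gammaLabel (m : ℕ → ℤ) (α : ℕ) : α ≤ gammaLabel m α := Nat.le_add_right _ _

theorem gammaLabel_inj (m : ℕ → ℤ) {α β : ℕ} (hα : 1 ≤ α) (hβ : 1 ≤ β)
    (h : gammaLabel m α = gammaLabel m β) : α = β := by
  rcases lt_trichotomy α β with h' | h' | h'
  · have := gammaLabel_le m hα h'.le; omega
  · exact h'
  · have := gammaLabel_le m hβ h'.le; omega

theorem gammaLabel_pred_of_asc {α : ℕ} (hα : 2 ≤ α) (h : m α = m (α - 1) + 1) :
    gammaLabel m α = gammaLabel m (α - 1) + 2 := by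
  obtain ⟨β, rfl⟩ : ∃ β, α = β + 1 := ⟨α - 1, by omega⟩
  exact gammaLabel_succ_of_asc (by omega) h

theorem gammaLabel_pred_of_not_asc {α : ℕ} (hα : 2 ≤ α) (h : m α ≠ m (α - 1) + 1) :
    gammaLabel m α = gammaLabel m (α - 1) + 1 := by
  obtain ⟨β, rfl⟩ : ∃ β, α = β + 1 := ⟨α - 1, by omega⟩
  exact gammaLabel_succ_of_not_asc (by omega) h

/-- The vertex below an ascending separation is not a label. -/
theorem gammaLabel_ne_pred_of_asc {α β : ℕ} (hβ : 1 ≤ β) (hα : 2 ≤ α) (h : m α = m (α - 1) + 1) :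
    gammaLabel m β ≠ gammaLabel m α - 1 := by
  have e := gammaLabel_pred_of_asc hα h
  rcases Nat.lt_or_ge β α with h' | h'
  · have := gammaLabel_le m hβ (show β ≤ α - 1 by omega); omega
  · have := gammaLabel_le m (by omega) h'; have := le_gammaLabel m α; omega

theorem gammaLabel_of_descending {β γ : ℕ} (hβ : 1 ≤ β) (h : β ≤ γ)
    (hd : ∀ δ, β ≤ δ → δ < γ → m (δ + 1) = m δ - 1) :
    gammaLabel m γ = gammaLabel m β + (γ - β) := by
  induction γ, h using Nat.le_induction with
  | base => simp
  | succ γ hγ ih =>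
    rw [gammaLabel_succ_of_not_asc (by omega) (by have := hd γ hγ (by omega); omega),
      ih fun δ h1 h2 => hd δ h1 (by omega)]
    omega

theorem skeletonEdge_even (r : ℕ) (m : ℕ → ℤ) (α : ℕ) :
    skeletonEdge r m (2 * α) = (.main (gammaLabel m α + 1), .main (gammaLabel m α)) := by
  simp [skeletonEdge, show (2 * α + 1) / 2 = α by omega]

theorem skeletonEdge_odd (r : ℕ) (m : ℕ → ℤ) {α : ℕ} (hα : 1 ≤ α) :
    skeletonEdge r m (2 * α - 1) =
      if α = 1 then (.main 1, .main 0)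
      else if α = r + 1 then (.main (gammaLabel m r + 2), .main (gammaLabel m r + 1))
      else if m α = m (α - 1) + 1 then (.main (gammaLabel m α), .main (gammaLabel m α - 1))
      else (.side (gammaLabel m α), .main (gammaLabel m α)) := by
  have h1 : ¬ Even (2 * α - 1) := by
    rw [Nat.not_even_iff_odd]; exact ⟨α - 1, by omega⟩
  simp only [skeletonEdge, h1, if_false, show (2 * α - 1 + 1) / 2 = α by omega]

theorem skeletonEdge_cases {β : ℕ} (h1 : 1 ≤ β) (h2 : β ≤ 2 * r + 1) :
    (∃ α, 1 ≤ α ∧ α ≤ r ∧ β = 2 * α) ∨ (∃ α, 1 ≤ α ∧ α ≤ r + 1 ∧ β = 2 * α - 1) := by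
  rcases Nat.even_or_odd' β with ⟨c, rfl | rfl⟩
  · exact Or.inl ⟨c, by omega, by omega, rfl⟩
  · exact Or.inr ⟨c + 1, by omega, by omega, by omega⟩

theorem skeletonEdge_even_ne_odd {α β : ℕ} (hα : 1 ≤ α) (hα' : α ≤ r) (hβ : 1 ≤ β)
    (hβ' : β ≤ r + 1) : skeletonEdge r m (2 * α) ≠ skeletonEdge r m (2 * β - 1) := by
  rw [skeletonEdge_even, skeletonEdge_odd r m hβ]
  have p := le_gammaLabel m α
  split_ifs with h1 h2 h3
  · simp; omega
  · have := gammaLabel_le m hα hα'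
    simp; omega
  · have := gammaLabel_ne_pred_of_asc hα (by omega) h3
    simp [this]
  · simp

theorem skeletonEdge_odd_inj {α β : ℕ} (hα : 1 ≤ α) (hα' : α ≤ r + 1) (hβ : 1 ≤ β)
    (hβ' : β ≤ r + 1) (h : skeletonEdge r m (2 * α - 1) = skeletonEdge r m (2 * β - 1)) :
    α = β := by
  rw [skeletonEdge_odd r m hα, skeletonEdge_odd r m hβ] at h
  have p := le_gammaLabel m r
  have pa := le_gammaLabel m α
  have pb := le_gammaLabel m β
  by_cases a1 : α = 1 <;> by_cases b1 : β = 1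
  · omega
  · subst a1
    rw [if_pos rfl, if_neg b1] at h
    split_ifs at h with h2 h3 <;> simp at h
    omega
  · subst b1
    rw [if_pos rfl, if_neg a1] at h
    split_ifs at h with h2 h3 <;> simp at h
    omega
  rw [if_neg a1, if_neg b1] at h
  by_cases a2 : α = r + 1 <;> by_cases b2 : β = r + 1
  · omega
  · rw [if_pos a2, if_neg b2] at h
    have := gammaLabel_le m hβ (show β ≤ r by omega)
    split_ifs at h with h3 <;> simp at h; omega
  · rw [if_neg a2, if_pos b2] at h
    have := gammaLabel_le m hα (show α ≤ r by omega)
    split_ifs at h with h3 <;> simp at h; omega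
  rw [if_neg a2, if_neg b2] at h
  split_ifs at h <;> simp at h
  · exact gammaLabel_inj m hα hβ h.1
  · exact gammaLabel_inj m hα hβ h

/-- This makes `skeletonEdgeWeight`, which is defined as a sum over edge numbers, a single weight.
-/
theorem skeletonEdge_inj {β γ : ℕ} (hβ : 1 ≤ β) (hβ' : β ≤ 2 * r + 1) (hγ : 1 ≤ γ)
    (hγ' : γ ≤ 2 * r + 1) (h : skeletonEdge r m β = skeletonEdge r m γ) : β = γ := by
  rcases skeletonEdge_cases hβ hβ' with ⟨a, a1, a2, rfl⟩ | ⟨a, a1, a2, rfl⟩ <;>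
  rcases skeletonEdge_cases hγ hγ' with ⟨b, b1, b2, rfl⟩ | ⟨b, b1, b2, rfl⟩
  · rw [skeletonEdge_even, skeletonEdge_even] at h
    simp at h
    rw [gammaLabel_inj m a1 b1 h]
  · exact absurd h (skeletonEdge_even_ne_odd a1 a2 b1 b2)
  · exact absurd h.symm (skeletonEdge_even_ne_odd b1 b2 a1 a2)
  · rw [skeletonEdge_odd_inj a1 a2 b1 b2 h]

theorem skeletonEdgeWeight_eq {K : Type u} [Field K] (R : ℕ → ℤ → K) (hr : 1 ≤ r) {β : ℕ}
    (hβ : 1 ≤ β) (hβ' : β ≤ 2 * r + 1) {u v : GammaVertex} (h : skeletonEdge r m β = (u, v)) :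
    skeletonEdgeWeight r m R u v = skeletonWeight m R β := by
  unfold skeletonEdgeWeight
  rw [Finset.sum_eq_single β]
  · intro γ hγ hne
    simp only [Finset.mem_filter, Finset.mem_Icc] at hγ
    exact absurd (skeletonEdge_inj hγ.1.1 hγ.1.2 hβ hβ' (hγ.2.trans h.symm)) hne
  · intro hn
    exact absurd (by simp [hβ, hβ', h]) hn

theorem skeletonWeight_even {K : Type u} [Field K] (R : ℕ → ℤ → K) (m : ℕ → ℤ) (α : ℕ) :
    skeletonWeight m R (2 * α) = evenWeight m R α := by
  simp [skeletonWeight]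

theorem skeletonWeight_odd {K : Type u} [Field K] (R : ℕ → ℤ → K) (m : ℕ → ℤ) {α : ℕ}
    (hα : 1 ≤ α) : skeletonWeight m R (2 * α - 1) = oddWeight m R α := by
  have h1 : ¬ Even (2 * α - 1) := by
    rw [Nat.not_even_iff_odd]; exact ⟨α - 1, by omega⟩
  simp only [skeletonWeight, h1, if_false, show (2 * α - 1 + 1) / 2 = α by omega]

theorem isSkeletonEdge_iff {u v : GammaVertex} (hr : 1 ≤ r) : IsSkeletonEdge r m u v ↔
    (∃ α, 1 ≤ α ∧ α ≤ r ∧ u = .main (gammaLabel m α + 1) ∧ v = .main (gammaLabel m α)) ∨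
    (u = .main 1 ∧ v = .main 0) ∨
    (u = .main (gammaLabel m r + 2) ∧ v = .main (gammaLabel m r + 1)) ∨
    (∃ α, 2 ≤ α ∧ α ≤ r ∧ m α = m (α - 1) + 1 ∧
      u = .main (gammaLabel m α) ∧ v = .main (gammaLabel m α - 1)) ∨
    (∃ α, 2 ≤ α ∧ α ≤ r ∧ m α ≠ m (α - 1) + 1 ∧
      u = .side (gammaLabel m α) ∧ v = .main (gammaLabel m α)) := by
  constructor
  · rintro ⟨β, h1, h2, h⟩
    rcases skeletonEdge_cases h1 h2 with ⟨a, a1, a2, rfl⟩ | ⟨a, a1, a2, rfl⟩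
    · rw [skeletonEdge_even, Prod.mk.injEq] at h
      exact Or.inl ⟨a, a1, a2, h.1.symm, h.2.symm⟩
    · rw [skeletonEdge_odd r m a1] at h
      split_ifs at h with c1 c2 c3 <;> rw [Prod.mk.injEq] at h
      · exact Or.inr (Or.inl ⟨h.1.symm, h.2.symm⟩)
      · exact Or.inr (Or.inr (Or.inl ⟨h.1.symm, h.2.symm⟩))
      · exact Or.inr (Or.inr (Or.inr (Or.inl
          ⟨a, by omega, by omega, c3, h.1.symm, h.2.symm⟩)))
      · exact Or.inr (Or.inr (Or.inr (Or.inr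
          ⟨a, by omega, by omega, c3, h.1.symm, h.2.symm⟩)))
  · rintro (⟨a, a1, a2, rfl, rfl⟩ | ⟨rfl, rfl⟩ | ⟨rfl, rfl⟩ | ⟨a, a1, a2, h, rfl, rfl⟩ |
      ⟨a, a1, a2, h, rfl, rfl⟩)
    · exact ⟨2 * a, by omega, by omega, skeletonEdge_even r m a⟩
    · exact ⟨2 * 1 - 1, by omega, by omega, by rw [skeletonEdge_odd r m le_rfl]; simp⟩
    · exact ⟨2 * (r + 1) - 1, by omega, by omega, by
        rw [skeletonEdge_odd r m (by omega), if_neg (by omega), if_pos rfl]⟩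
    · exact ⟨2 * a - 1, by omega, by omega, by
        rw [skeletonEdge_odd r m (by omega), if_neg (by omega), if_neg (by omega), if_pos h]⟩
    · exact ⟨2 * a - 1, by omega, by omega, by
        rw [skeletonEdge_odd r m (by omega), if_neg (by omega), if_neg (by omega), if_neg h]⟩

end GammaEdges

/-! ## Hops between heights -/

section Hops

variable {r : ℕ} {m : ℕ → ℤ}

/-- `a → b` is the height change of an allowed step which does not go up. -/
def IsHop (r : ℕ) (m : ℕ → ℤ) (a b : ℕ) : Prop :=
  (b = a ∧ IsGammaEdge r m (.main a) (.side a) ∧ IsGammaEdge r m (.side a) (.main a)) ∨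
  (b < a ∧ IsGammaEdge r m (.main a) (.main b))

noncomputable def hopWeight {K : Type u} [Field K] (r : ℕ) (m : ℕ → ℤ) (R : ℕ → ℤ → K)
    (a b : ℕ) : K :=
  if b = a then gammaWeight r m R (.main a) (.side a) * gammaWeight r m R (.side a) (.main a)
  else gammaWeight r m R (.main a) (.main b)

/-- `m_β, …, m_γ` is a descending run. -/
def IsDescending (m : ℕ → ℤ) (β γ : ℕ) : Prop := ∀ δ, β ≤ δ → δ < γ → m (δ + 1) = m δ - 1

theorem IsDescending.mono {β γ β' γ' : ℕ} (h : IsDescending m β γ) (h1 : β ≤ β') (h2 : γ' ≤ γ) :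
    IsDescending m β' γ' := fun δ h3 h4 => h δ (h1.trans h3) (h4.trans_le h2)

theorem IsDescending.gammaLabel {β γ : ℕ} (h : IsDescending m β γ) (hβ : 1 ≤ β) (hγ : β ≤ γ) :
    gammaLabel m γ = gammaLabel m β + (γ - β) := gammaLabel_of_descending hβ hγ h

theorem not_isSkeletonEdge_main_side (hr : 1 ≤ r) (a b : ℕ) :
    ¬ IsSkeletonEdge r m (.main a) (.side b) := by
  rw [isSkeletonEdge_iff hr]; simp

theorem isSkeletonEdge_side_main_iff (hr : 1 ≤ r) (a b : ℕ) :
    IsSkeletonEdge r m (.side a) (.main b) ↔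
      ∃ α, 2 ≤ α ∧ α ≤ r ∧ m α ≠ m (α - 1) + 1 ∧ a = gammaLabel m α ∧ b = gammaLabel m α := by
  rw [isSkeletonEdge_iff hr]; simp

theorem isSkeletonEdge_main_main_iff (hr : 1 ≤ r) (a b : ℕ) :
    IsSkeletonEdge r m (.main a) (.main b) ↔
    (∃ α, 1 ≤ α ∧ α ≤ r ∧ a = gammaLabel m α + 1 ∧ b = gammaLabel m α) ∨
    (a = 1 ∧ b = 0) ∨ (a = gammaLabel m r + 2 ∧ b = gammaLabel m r + 1) ∨
    (∃ α, 2 ≤ α ∧ α ≤ r ∧ m α = m (α - 1) + 1 ∧ a = gammaLabel m α ∧ b = gammaLabel m α - 1) := by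
  rw [isSkeletonEdge_iff hr]; simp

theorem IsSkeletonEdge.eq_succ (hr : 1 ≤ r) {a b : ℕ}
    (h : IsSkeletonEdge r m (.main a) (.main b)) : a = b + 1 := by
  rw [isSkeletonEdge_main_main_iff hr] at h
  rcases h with ⟨α, _, _, rfl, rfl⟩ | ⟨rfl, rfl⟩ | ⟨rfl, rfl⟩ | ⟨α, h1, _, _, rfl, rfl⟩
  · rfl
  · rfl
  · rfl
  · have := le_gammaLabel m α; omega

/-- The five kinds of hops: the root edge, the top edge, an ascending edge, a descent inside a run,
and a loop. The even skeleton edges are the descents with `β = γ`; treating them together with the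
additional edges is what makes the runs uniform. -/
theorem isHop_iff (hr : 1 ≤ r) (a b : ℕ) : IsHop r m a b ↔
    (a = 1 ∧ b = 0) ∨ (a = gammaLabel m r + 2 ∧ b = gammaLabel m r + 1) ∨
    (∃ α, 2 ≤ α ∧ α ≤ r ∧ m α = m (α - 1) + 1 ∧ a = gammaLabel m α ∧ b = gammaLabel m α - 1) ∨
    (∃ β γ, 1 ≤ β ∧ β ≤ γ ∧ γ ≤ r ∧ IsDescending m β γ ∧ a = gammaLabel m γ + 1 ∧
      b = gammaLabel m β) ∨
    (∃ α, 2 ≤ α ∧ α ≤ r ∧ m α ≠ m (α - 1) + 1 ∧ a = gammaLabel m α ∧ b = gammaLabel m α) := by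
  constructor
  · rintro (⟨rfl, -, h | h | h⟩ | ⟨hlt, h | h | h⟩)
    · rw [isSkeletonEdge_side_main_iff hr] at h
      obtain ⟨α, h1, h2, h3, h4, -⟩ := h
      exact Or.inr (Or.inr (Or.inr (Or.inr ⟨α, h1, h2, h3, h4, h4⟩)))
    · exact absurd h (not_isSkeletonEdge_main_side hr _ _)
    · obtain ⟨β, γ, -, -, -, -, h, -⟩ := h
      simp at h
    · rw [isSkeletonEdge_main_main_iff hr] at h
      rcases h with ⟨α, h1, h2, h3, h4⟩ | h | h | h
      · exact Or.inr (Or.inr (Or.inr (Or.inl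
          ⟨α, α, h1, le_rfl, h2, fun δ _ _ => by omega, h3, h4⟩)))
      · exact Or.inl h
      · exact Or.inr (Or.inl h)
      · exact Or.inr (Or.inr (Or.inl h))
    · have := h.eq_succ hr
      omega
    · obtain ⟨β, γ, h1, h2, h3, h4, h5, h6⟩ := h
      simp only [GammaVertex.main.injEq] at h5 h6
      exact Or.inr (Or.inr (Or.inr (Or.inl ⟨β, γ, h1, h2.le, h3, h4, h5, h6⟩)))
  · rintro (⟨rfl, rfl⟩ | ⟨rfl, rfl⟩ | ⟨α, h1, h2, h3, rfl, rfl⟩ | ⟨β, γ, h1, h2, h3, h4, rfl, rfl⟩ |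
      ⟨α, h1, h2, h3, rfl, rfl⟩)
    · exact Or.inr ⟨by omega, Or.inl ((isSkeletonEdge_main_main_iff hr _ _).2 (by simp))⟩
    · exact Or.inr ⟨by omega, Or.inl ((isSkeletonEdge_main_main_iff hr _ _).2 (by simp))⟩
    · refine Or.inr ⟨by have := le_gammaLabel m α; omega,
        Or.inl ((isSkeletonEdge_main_main_iff hr _ _).2 ?_)⟩
      exact Or.inr (Or.inr (Or.inr ⟨α, h1, h2, h3, rfl, rfl⟩))
    · rcases Nat.lt_or_eq_of_le h2 with hlt | rfl
      · refine Or.inr ⟨by have := gammaLabel_le m h1 h2; omega, Or.inr (Or.inr ?_)⟩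
        exact ⟨β, γ, h1, hlt, h3, h4, rfl, rfl⟩
      · refine Or.inr ⟨by omega, Or.inl ((isSkeletonEdge_main_main_iff hr _ _).2 ?_)⟩
        exact Or.inl ⟨β, h1, h3, rfl, rfl⟩
    · have : IsSkeletonEdge r m (.side (gammaLabel m α)) (.main (gammaLabel m α)) :=
        (isSkeletonEdge_side_main_iff hr _ _).2 ⟨α, h1, h2, h3, rfl, rfl⟩
      exact Or.inl ⟨rfl, Or.inr (Or.inl this), Or.inl this⟩

theorem IsHop.le {a b : ℕ} (h : IsHop r m a b) : b ≤ a := by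
  rcases h with ⟨rfl, _⟩ | ⟨h, _⟩
  · exact le_rfl
  · exact h.le

theorem IsHop.le_top (hr : 1 ≤ r) {a b : ℕ} (h : IsHop r m a b) : a ≤ gammaLabel m r + 2 := by
  have h0 := le_gammaLabel m r
  rw [isHop_iff hr] at h
  rcases h with ⟨rfl, rfl⟩ | ⟨rfl, rfl⟩ | ⟨α, h1, h2, h3, rfl, rfl⟩ |
    ⟨β, γ, h1, h2, h3, h4, rfl, rfl⟩ | ⟨α, h1, h2, h3, rfl, rfl⟩
  · omega
  · omega
  · have := gammaLabel_le m (by omega) h2; omega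
  · have := gammaLabel_le m (by omega) h3; omega
  · have := gammaLabel_le m (by omega) h2; omega

theorem not_isHop_zero (hr : 1 ≤ r) (b : ℕ) : ¬ IsHop r m 0 b := by
  rw [isHop_iff hr]
  rintro (⟨h, _⟩ | ⟨h, _⟩ | ⟨α, h1, _, _, h, _⟩ | ⟨β, γ, _, _, _, _, h, _⟩ | ⟨α, h1, _, _, h, _⟩)
  · omega
  · omega
  · have := le_gammaLabel m α; omega
  · omega
  · have := le_gammaLabel m α; omega

/-- Labels grow by `1` or `2`, and the vertex skipped by a jump of `2` lies just below an ascending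
separation. -/
theorem vertex_cases (m : ℕ → ℤ) {r : ℕ} (hr : 1 ≤ r) {a : ℕ} (ha : a ≤ gammaLabel m r) :
    a = 0 ∨ (∃ α, 1 ≤ α ∧ α ≤ r ∧ a = gammaLabel m α) ∨
    (∃ α, 2 ≤ α ∧ α ≤ r ∧ m α = m (α - 1) + 1 ∧ a = gammaLabel m α - 1) := by
  induction r, hr using Nat.le_induction with
  | base =>
    rw [gammaLabel_one] at ha
    rcases Nat.eq_zero_or_pos a with h | h
    · exact Or.inl h
    · exact Or.inr (Or.inl ⟨1, le_rfl, le_rfl, by rw [gammaLabel_one]; omega⟩)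
  | succ k hk ih =>
    rcases Nat.lt_or_ge (gammaLabel m k) a with h | h
    · by_cases hasc : m (k + 1) = m k + 1
      · have e := gammaLabel_succ_of_asc hk hasc
        rcases Nat.lt_or_eq_of_le ha with h' | h'
        · exact Or.inr (Or.inr ⟨k + 1, by omega, le_rfl, by simpa using hasc, by omega⟩)
        · exact Or.inr (Or.inl ⟨k + 1, by omega, le_rfl, h'⟩)
      · have e := gammaLabel_succ_of_not_asc hk hasc
        exact Or.inr (Or.inl ⟨k + 1, by omega, le_rfl, by omega⟩)
    · rcases ih h with h | ⟨α, h1, h2, h3⟩ | ⟨α, h1, h2, h3⟩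
      · exact Or.inl h
      · exact Or.inr (Or.inl ⟨α, h1, by omega, h3⟩)
      · exact Or.inr (Or.inr ⟨α, h1, by omega, h3⟩)

/-- The vertical part of the skeleton is a chain without gaps, so a path can always step up until it
reaches the top vertex. -/
theorem isSkeletonEdge_succ_iff (hr : 1 ≤ r) (a : ℕ) :
    IsSkeletonEdge r m (.main (a + 1)) (.main a) ↔ a + 1 ≤ gammaLabel m r + 2 := by
  rw [isSkeletonEdge_main_main_iff hr]
  constructor
  · rintro (⟨α, h1, h2, _, rfl⟩ | ⟨_, rfl⟩ | ⟨_, rfl⟩ | ⟨α, h1, h2, _, h3, _⟩)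
    · have := gammaLabel_le m h1 h2; omega
    · omega
    · omega
    · have := gammaLabel_le m (by omega) h2; omega
  · intro h
    rcases Nat.lt_or_eq_of_le (show a ≤ gammaLabel m r + 1 by omega) with h' | rfl
    · rcases vertex_cases m hr (show a ≤ gammaLabel m r by omega) with
        rfl | ⟨α, h1, h2, rfl⟩ | ⟨α, h1, h2, h3, h4⟩
      · simp
      · exact Or.inl ⟨α, h1, h2, rfl, rfl⟩
      · have := le_gammaLabel m α
        exact Or.inr (Or.inr (Or.inr ⟨α, h1, h2, h3, by omega, h4⟩))
    · simp

theorem isGammaEdge_up_iff (hr : 1 ≤ r) (a : ℕ) :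
    IsGammaEdge r m (.main a) (.main (a + 1)) ↔ a + 1 ≤ gammaLabel m r + 2 := by
  rw [← isSkeletonEdge_succ_iff hr]
  constructor
  · rintro (h | h | ⟨β, γ, h1, h2, h3, h4, h5, h6⟩)
    · have := h.eq_succ hr; omega
    · exact h
    · simp only [GammaVertex.main.injEq] at h5 h6
      have := gammaLabel_le m h1 h2.le
      omega
  · exact fun h => Or.inr (Or.inl h)

theorem gammaWeight_up {K : Type u} [Field K] (R : ℕ → ℤ → K) (hr : 1 ≤ r) {a : ℕ}
    (h : a + 1 ≤ gammaLabel m r + 2) :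
    gammaWeight r m R (.main a) (.main (a + 1)) = 1 := by
  unfold gammaWeight
  rw [if_neg, if_pos ((isSkeletonEdge_succ_iff hr a).2 h)]
  intro h
  have := h.eq_succ hr
  omega

end Hops

/-! ## The weights of hops -/

section HopWeights

variable {r : ℕ} {m : ℕ → ℤ} {K : Type u} [Field K] {R : ℕ → ℤ → K}

/-- The weight of the hop from the top of the descending run `m_β, …, m_γ` to its bottom. -/
def runWeight (m : ℕ → ℤ) (R : ℕ → ℤ → K) (γ β : ℕ) : K :=
  (∏ i ∈ Finset.Ico β (γ + 1), evenWeight m R i) / ∏ i ∈ Finset.Ico (β + 1) (γ + 1), oddWeight m R i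

theorem runWeight_self (m : ℕ → ℤ) (R : ℕ → ℤ → K) (β : ℕ) :
    runWeight m R β β = evenWeight m R β := by
  simp [runWeight]

theorem runWeight_succ (m : ℕ → ℤ) (R : ℕ → ℤ → K) {γ β : ℕ} (h : β ≤ γ) :
    runWeight m R (γ + 1) β =
      runWeight m R γ β * (evenWeight m R (γ + 1) / oddWeight m R (γ + 1)) := by
  unfold runWeight
  rw [Finset.prod_Ico_succ_top (show β ≤ γ + 1 by omega),
    Finset.prod_Ico_succ_top (show β + 1 ≤ γ + 1 by omega), mul_div_mul_comm]

theorem gammaWeight_of_isSkeletonEdge {u v : GammaVertex} (h : IsSkeletonEdge r m u v) :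
    gammaWeight r m R u v = skeletonEdgeWeight r m R u v := by
  unfold gammaWeight
  rw [if_pos h]

theorem skeletonEdgeWeight_even (hr : 1 ≤ r) {α : ℕ} (h1 : 1 ≤ α) (h2 : α ≤ r) :
    skeletonEdgeWeight r m R (.main (gammaLabel m α + 1)) (.main (gammaLabel m α)) =
      evenWeight m R α := by
  rw [skeletonEdgeWeight_eq R hr (β := 2 * α) (by omega) (by omega) (skeletonEdge_even r m α),
    skeletonWeight_even]

theorem skeletonEdgeWeight_one (hr : 1 ≤ r) :
    skeletonEdgeWeight r m R (.main 1) (.main 0) = oddWeight m R 1 := by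
  rw [skeletonEdgeWeight_eq R hr (β := 2 * 1 - 1) (by omega) (by omega)
    (by rw [skeletonEdge_odd r m le_rfl]; simp), skeletonWeight_odd R m le_rfl]

theorem skeletonEdgeWeight_top (hr : 1 ≤ r) :
    skeletonEdgeWeight r m R (.main (gammaLabel m r + 2)) (.main (gammaLabel m r + 1)) =
      oddWeight m R (r + 1) := by
  rw [skeletonEdgeWeight_eq R hr (β := 2 * (r + 1) - 1) (by omega) (by omega)
    (by rw [skeletonEdge_odd r m (by omega), if_neg (by omega), if_pos rfl]),
    skeletonWeight_odd R m (by omega)]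

theorem skeletonEdgeWeight_asc (hr : 1 ≤ r) {α : ℕ} (h1 : 2 ≤ α) (h2 : α ≤ r)
    (h : m α = m (α - 1) + 1) :
    skeletonEdgeWeight r m R (.main (gammaLabel m α)) (.main (gammaLabel m α - 1)) =
      oddWeight m R α := by
  rw [skeletonEdgeWeight_eq R hr (β := 2 * α - 1) (by omega) (by omega)
    (by rw [skeletonEdge_odd r m (by omega), if_neg (by omega), if_neg (by omega), if_pos h]),
    skeletonWeight_odd R m (by omega)]

theorem skeletonEdgeWeight_side (hr : 1 ≤ r) {α : ℕ} (h1 : 2 ≤ α) (h2 : α ≤ r)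
    (h : m α ≠ m (α - 1) + 1) :
    skeletonEdgeWeight r m R (.side (gammaLabel m α)) (.main (gammaLabel m α)) =
      oddWeight m R α := by
  rw [skeletonEdgeWeight_eq R hr (β := 2 * α - 1) (by omega) (by omega)
    (by rw [skeletonEdge_odd r m (by omega), if_neg (by omega), if_neg (by omega), if_neg h]),
    skeletonWeight_odd R m (by omega)]

/-- Inside a descending run the labels are consecutive integers and every vertex strictly between
the ends carries a loop. Hence the products over heights become products over positions in the run.
-/
theorem extraEdgeWeight_eq (hr : 1 ≤ r) {β γ : ℕ} (h1 : 1 ≤ β) (h2 : β ≤ γ) (h3 : γ ≤ r)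
    (hd : IsDescending m β γ) :
    extraEdgeWeight r m R (gammaLabel m γ + 1) (gammaLabel m β) = runWeight m R γ β := by
  have e := hd.gammaLabel h1 h2
  have lab : ∀ j, j ≤ γ - β → gammaLabel m (β + j) = gammaLabel m β + j := by
    intro j hj
    rw [(hd.mono (γ' := β + j) le_rfl (by omega)).gammaLabel h1 (by omega)]
    omega
  unfold extraEdgeWeight runWeight
  congr 1
  · rw [Finset.prod_Ico_eq_prod_range, Finset.prod_Ico_eq_prod_range]
    rw [show gammaLabel m γ + 1 - gammaLabel m β = γ + 1 - β by omega]
    refine Finset.prod_congr rfl fun j hj => ?_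
    rw [Finset.mem_range] at hj
    rw [← lab j (by omega)]
    exact skeletonEdgeWeight_even hr (by omega) (by omega)
  · have : Finset.Ioo (gammaLabel m β) (gammaLabel m γ + 1) =
        Finset.Ico (gammaLabel m β + 1) (gammaLabel m γ + 1) := by ext; simp
    rw [this, Finset.prod_Ico_eq_prod_range, Finset.prod_Ico_eq_prod_range]
    rw [show gammaLabel m γ + 1 - (gammaLabel m β + 1) = γ + 1 - (β + 1) by omega]
    refine Finset.prod_congr rfl fun j hj => ?_
    rw [Finset.mem_range] at hj
    rw [show gammaLabel m β + 1 + j = gammaLabel m (β + 1 + j) by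
      rw [show β + 1 + j = β + (1 + j) by ring, lab (1 + j) (by omega), add_assoc]]
    refine skeletonEdgeWeight_side hr (by omega) (by omega) ?_
    have := hd (β + j) (by omega) (by omega)
    rw [show β + 1 + j - 1 = β + j by omega, show β + 1 + j = β + j + 1 by ring]
    omega

theorem hopWeight_run (hr : 1 ≤ r) {β γ : ℕ} (h1 : 1 ≤ β) (h2 : β ≤ γ) (h3 : γ ≤ r)
    (hd : IsDescending m β γ) :
    hopWeight r m R (gammaLabel m γ + 1) (gammaLabel m β) = runWeight m R γ β := by
  have e := hd.gammaLabel h1 h2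
  rw [hopWeight, if_neg (by omega)]
  rcases Nat.lt_or_eq_of_le h2 with hlt | rfl
  · rw [gammaWeight, if_neg, if_neg, if_pos ⟨β, γ, h1, hlt, h3, hd, rfl, rfl⟩,
      extraEdgeWeight_eq hr h1 h2 h3 hd]
    · intro h
      have := h.eq_succ hr
      omega
    · intro h
      have := h.eq_succ hr
      omega
  · rw [gammaWeight_of_isSkeletonEdge, skeletonEdgeWeight_even hr h1 h3, runWeight_self]
    exact (isSkeletonEdge_main_main_iff hr _ _).2 (Or.inl ⟨β, h1, h3, rfl, rfl⟩)

theorem hopWeight_one (hr : 1 ≤ r) : hopWeight r m R 1 0 = oddWeight m R 1 := by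
  rw [hopWeight, if_neg (by omega), gammaWeight_of_isSkeletonEdge, skeletonEdgeWeight_one hr]
  exact (isSkeletonEdge_main_main_iff hr _ _).2 (by simp)

theorem hopWeight_top (hr : 1 ≤ r) :
    hopWeight r m R (gammaLabel m r + 2) (gammaLabel m r + 1) = oddWeight m R (r + 1) := by
  rw [hopWeight, if_neg (by omega), gammaWeight_of_isSkeletonEdge, skeletonEdgeWeight_top hr]
  exact (isSkeletonEdge_main_main_iff hr _ _).2 (by simp)

theorem hopWeight_asc (hr : 1 ≤ r) {α : ℕ} (h1 : 2 ≤ α) (h2 : α ≤ r) (h : m α = m (α - 1) + 1) :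
    hopWeight r m R (gammaLabel m α) (gammaLabel m α - 1) = oddWeight m R α := by
  have := le_gammaLabel m α
  rw [hopWeight, if_neg (by omega), gammaWeight_of_isSkeletonEdge, skeletonEdgeWeight_asc hr h1 h2 h]
  exact (isSkeletonEdge_main_main_iff hr _ _).2
    (Or.inr (Or.inr (Or.inr ⟨α, h1, h2, h, rfl, rfl⟩)))

theorem hopWeight_side (hr : 1 ≤ r) {α : ℕ} (h1 : 2 ≤ α) (h2 : α ≤ r) (h : m α ≠ m (α - 1) + 1) :
    hopWeight r m R (gammaLabel m α) (gammaLabel m α) = oddWeight m R α := by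
  have hs : IsSkeletonEdge r m (.side (gammaLabel m α)) (.main (gammaLabel m α)) :=
    (isSkeletonEdge_side_main_iff hr _ _).2 ⟨α, h1, h2, h, rfl, rfl⟩
  rw [hopWeight, if_pos rfl, gammaWeight_of_isSkeletonEdge hs, skeletonEdgeWeight_side hr h1 h2 h,
    gammaWeight, if_neg (not_isSkeletonEdge_main_side hr _ _), if_pos hs, one_mul]
  intro a b _ h
  simp at h

/-- Two hops which end in the wrong order, or at the same height, and start at different heights:
either they have the same end, or they belong to the same descending run. -/
theorem IsHop.crossing (hr : 1 ≤ r) {a a' b b' : ℕ} (haa : a' < a) (h : IsHop r m a b')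
    (h' : IsHop r m a' b) (hb : b' ≤ b) :
    b = b' ∨ ∃ β ζ ε δ, 1 ≤ β ∧ β ≤ ζ ∧ ζ ≤ ε ∧ ε ≤ δ ∧ δ ≤ r ∧ β < ε ∧ IsDescending m β δ ∧
      a' = gammaLabel m ε ∧ a = gammaLabel m δ + 1 ∧ b' = gammaLabel m β ∧
      b = gammaLabel m ζ := by
  have hle := h'.le
  rw [isHop_iff hr] at h
  rcases h with ⟨rfl, rfl⟩ | ⟨rfl, rfl⟩ | ⟨α, h1, h2, h3, rfl, rfl⟩ |
    ⟨β, γ, h1, h2, h3, h4, rfl, rfl⟩ | ⟨α, h1, h2, h3, rfl, rfl⟩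
  · left; omega
  · left; omega
  · left; omega
  · have e := h4.gammaLabel h1 h2
    have lab : ∀ j, j ≤ γ - β → gammaLabel m (β + j) = gammaLabel m β + j := by
      intro j hj
      rw [(h4.mono (γ' := β + j) le_rfl (by omega)).gammaLabel h1 (by omega)]
      omega
    by_cases hab : a' = gammaLabel m β
    · left; omega
    · right
      refine ⟨β, β + (b - gammaLabel m β), β + (a' - gammaLabel m β), γ, h1, by omega, by omega,
        by omega, h3, by omega, h4, ?_, rfl, rfl, ?_⟩
      · rw [lab _ (by omega)]; omega
      · rw [lab _ (by omega)]; omega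
  · left; omega

/-- If the ends differ, both hops lie in one descending run, and a run contains all the descents
needed to exchange their ends. -/
theorem IsHop.uncross (hr : 1 ≤ r) {a a' b b' : ℕ} (haa : a' < a) (h : IsHop r m a b')
    (h' : IsHop r m a' b) (hb : b' ≤ b) : IsHop r m a b ∧ IsHop r m a' b' := by
  rcases h.crossing hr haa h' hb with rfl | ⟨β, ζ, ε, δ, h1, h2, h3, h4, h5, h6, hd, rfl, rfl, rfl, rfl⟩
  · exact ⟨h, h'⟩
  · constructor
    · exact (isHop_iff hr _ _).2 (Or.inr (Or.inr (Or.inr (Or.inl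
        ⟨ζ, δ, by omega, by omega, h5, hd.mono h2 le_rfl, rfl, rfl⟩))))
    -- The height `gammaLabel m ε` is also `gammaLabel m (ε - 1) + 1`, so as a starting height it
    -- belongs to the position `ε - 1`.
    · refine (isHop_iff hr _ _).2 (Or.inr (Or.inr (Or.inr (Or.inl
        ⟨β, ε - 1, by omega, by omega, by omega, hd.mono le_rfl (by omega), ?_, rfl⟩))))
      rw [hd.mono le_rfl h4 |>.gammaLabel h1 (by omega),
        (hd.mono le_rfl (show ε - 1 ≤ δ by omega)).gammaLabel h1 (by omega)]
      omega

/-- Two heights `a' < a` in the same descending run. -/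
def IsLinked (r : ℕ) (m : ℕ → ℤ) (a a' : ℕ) : Prop :=
  ∃ ε δ, 2 ≤ ε ∧ ε ≤ δ ∧ δ ≤ r ∧ IsDescending m (ε - 1) δ ∧
    a' = gammaLabel m ε ∧ a = gammaLabel m δ + 1

/-- Used in contrapositive form: from two heights which are not linked at most one common height can
be reached. -/
theorem isLinked_of_common (hr : 1 ≤ r) {a a' b b' : ℕ} (haa : a' < a) (h1 : IsHop r m a b')
    (h2 : IsHop r m a' b) (hb : b' < b) : IsLinked r m a a' := by
  rcases h1.crossing hr haa h2 hb.le with rfl |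
    ⟨β, ζ, ε, δ, h1, h2, h3, h4, h5, h6, hd, rfl, rfl, rfl, rfl⟩
  · omega
  · exact ⟨ε, δ, by omega, h4, h5, hd.mono (by omega) le_rfl, rfl, rfl⟩

theorem IsQSystemSolution.ne_zero' (h : IsQSystemSolution r R) {α : ℕ} (hα : α ≤ r + 1) (n : ℤ) :
    R α n ≠ 0 := by
  have := h.isQDSolution.ne_zero α n hα
  rwa [truncatedSolution_of_le hα] at this

theorem IsQSystemSolution.lambdaRatio_ne_zero (h : IsQSystemSolution r R) {α : ℕ}
    (hα : α ≤ r + 1) (n : ℤ) : lambdaRatio R α n ≠ 0 :=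
  div_ne_zero (h.ne_zero' hα _) (h.ne_zero' hα _)

theorem IsQSystemSolution.oddWeight_ne_zero (h : IsQSystemSolution r R) (m : ℕ → ℤ) {α : ℕ}
    (hα : α ≤ r + 1) : oddWeight m R α ≠ 0 :=
  div_ne_zero (h.lambdaRatio_ne_zero hα _) (h.lambdaRatio_ne_zero (by omega) _)

/-- Linked heights have proportional hop weights. -/
theorem IsLinked.proportional (hr : 1 ≤ r) (hR : IsQSystemSolution r R) {a a' : ℕ}
    (h : IsLinked r m a a') : ∃ c : K, ∀ b, IsHop r m a' b → IsHop r m a b ∧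
      hopWeight r m R a b = c * hopWeight r m R a' b := by
  obtain ⟨ε, δ, h1, h2, h3, hd, rfl, rfl⟩ := h
  -- Prolonging a run from `ε - 1` to `δ` multiplies the weight of a descent by this product,
  -- whatever its lower end is.
  refine ⟨∏ i ∈ Finset.Ico ε (δ + 1), (evenWeight m R i / oddWeight m R i), ?_⟩
  have run : ∀ ζ, 1 ≤ ζ → ζ ≤ ε - 1 → ∀ δ, ε ≤ δ → runWeight m R δ ζ =
      (∏ i ∈ Finset.Ico ε (δ + 1), (evenWeight m R i / oddWeight m R i)) *
        runWeight m R (ε - 1) ζ := by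
    intro ζ _ h5 δ h6
    induction δ, h6 using Nat.le_induction with
    | base =>
      obtain ⟨η, rfl⟩ : ∃ η, ε = η + 1 := ⟨ε - 1, by omega⟩
      rw [runWeight_succ m R (by omega)]
      simp; ring
    | succ k hk ih =>
      rw [runWeight_succ m R (by omega), ih, Finset.prod_Ico_succ_top (show ε ≤ k + 1 by omega)]
      ring
  -- The remaining target is `a'` itself, reached from `a'` by its loop of weight `oddWeight m R ε`.
  -- The same constant works because the denominator of a run weight starts one position above its
  -- lower end.
  have run' : ∀ δ, ε ≤ δ → runWeight m R δ ε =
      (∏ i ∈ Finset.Ico ε (δ + 1), (evenWeight m R i / oddWeight m R i)) * oddWeight m R ε := by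
    intro δ h6
    induction δ, h6 using Nat.le_induction with
    | base =>
      have := hR.oddWeight_ne_zero m (α := ε) (by omega)
      rw [runWeight_self]
      simp; field_simp
    | succ k hk ih =>
      rw [runWeight_succ m R (by omega), ih, Finset.prod_Ico_succ_top (show ε ≤ k + 1 by omega)]
      ring
  have hstep := hd (ε - 1) le_rfl (by omega)
  rw [Nat.sub_add_cancel (by omega)] at hstep
  have hna : m ε ≠ m (ε - 1) + 1 := by omega
  have hlab := gammaLabel_pred_of_not_asc h1 hna
  intro b hb
  have hb' := hb
  rw [isHop_iff hr] at hb
  rcases hb with ⟨hb, rfl⟩ | ⟨hb, rfl⟩ | ⟨α, g1, g2, g3, hb, rfl⟩ |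
    ⟨β, γ, g1, g2, g3, g4, hb, rfl⟩ | ⟨α, g1, g2, g3, hb, rfl⟩
  · have := le_gammaLabel m ε; omega
  · have := gammaLabel_le m (show 1 ≤ ε by omega) (show ε ≤ r by omega); omega
  · have := gammaLabel_inj m (by omega) (by omega) hb
    subst this
    exact absurd g3 hna
  · have hγ := gammaLabel_inj m (show 1 ≤ ε - 1 by omega) (show 1 ≤ γ by omega) (by omega)
    subst hγ
    have hd' : IsDescending m β δ := by
      intro x hx1 hx2
      rcases Nat.lt_or_ge x (ε - 1) with h | h
      · exact g4 x hx1 h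
      · exact hd x h hx2
    refine ⟨(isHop_iff hr _ _).2 (Or.inr (Or.inr (Or.inr (Or.inl
        ⟨β, δ, by omega, by omega, h3, hd', rfl, rfl⟩)))), ?_⟩
    rw [hopWeight_run hr g1 (by omega) h3 hd', hb, hopWeight_run hr g1 g2 g3 g4,
      run β g1 g2 δ h2]
  · have := gammaLabel_inj m (by omega) (by omega) hb
    subst this
    have hd' : IsDescending m ε δ := hd.mono (by omega) le_rfl
    refine ⟨(isHop_iff hr _ _).2 (Or.inr (Or.inr (Or.inr (Or.inl
        ⟨ε, δ, by omega, by omega, h3, hd', rfl, rfl⟩)))), ?_⟩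
    rw [hopWeight_run hr (by omega) (by omega) h3 hd', hopWeight_side hr g1 g2 g3,
      run' δ h2]

end HopWeights

/-! ## Contiguity relations with the weights of `Γ_m` as coefficients -/

section Contiguity

variable {r : ℕ} {m : ℕ → ℤ} {K : Type u} [Field K] {S : ℕ → ℤ → K}

/-- The weight `y_{2α}` without the correction by the step `m_{α-1} → m_α`. -/
def upperEvenWeight (m : ℕ → ℤ) (R : ℕ → ℤ → K) (α : ℕ) : K :=
  muRatio R (α + 1) (m α + 1) / muRatio R α (m α)
    * (if m α = m (α + 1) + 1 then
        lambdaRatio R (α + 1) (m (α + 1)) / lambdaRatio R (α + 1) (m α) else 1)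

/-- Normalization of the sums over descending runs. -/
def runFactor (m : ℕ → ℤ) (R : ℕ → ℤ → K) (α : ℕ) : K :=
  if m (α - 1) = m α + 1 then
    lambdaRatio R (α - 1) (m (α - 1)) / lambdaRatio R (α - 1) (m α) else 1

theorem IsQDSolution.lambdaRatio_ne_zero (h : IsQDSolution r S) {α : ℕ}
    (hα : α ≤ r + 1) (n : ℤ) : lambdaRatio S α n ≠ 0 :=
  div_ne_zero (h.ne_zero α _ hα) (h.ne_zero α _ hα)

/-- The correction `B` of the weight is the inverse of the factor which a run sum collects in
`IsQDSolution.run_desc`, so only `upperEvenWeight` remains in the contiguity relations. -/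
theorem IsQDSolution.evenWeight_mul_runFactor (h : IsQDSolution r S) (m : ℕ → ℤ) {α : ℕ}
    (hα : α ≤ r) : evenWeight m S α * runFactor m S α = upperEvenWeight m S α := by
  unfold evenWeight runFactor upperEvenWeight
  have h1 := h.lambdaRatio_ne_zero (α := α - 1) (by omega) (m α)
  have h2 := h.lambdaRatio_ne_zero (α := α - 1) (by omega) (m (α - 1))
  by_cases hd : m (α - 1) = m α + 1
  · simp only [hd, if_true] at h2 ⊢
    field_simp
  · simp only [hd, if_false, mul_one]

theorem IsQDSolution.contiguity_first (h : IsQDSolution r S) (m : ℕ → ℤ) (n : ℤ) :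
    S 1 (n + 1) = qdMoment S 1 (m 1) n + oddWeight m S 1 * S 1 n := by
  simp only [qdMoment, qdQ, oddWeight, lambdaRatio, h.bottom]
  simp

/-- At an ascending separation the odd weight is exactly an entry `q` of the scheme. -/
theorem contiguity_asc_odd {d : ℕ} (hm : m (d + 1) = m d + 1) (n : ℤ) :
    qdMoment S d (m (d + 1) - d + 1) (n + 1) = qdMoment S (d + 1) (m (d + 1) - d) n +
      oddWeight m S (d + 1) * qdMoment S d (m d - d + 1) n := by
  rw [qdMoment_succ, show m d - d + 1 = m (d + 1) - d by omega]
  congr 2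
  simp only [qdQ, oddWeight, lambdaRatio, Nat.add_sub_cancel]
  rw [show m (d + 1) - (d : ℤ) + d = m d + 1 by omega, hm, add_sub_cancel_right, div_div_div_eq]

/-- Below an ascending separation the even weight is exactly an entry `e` of the scheme. -/
theorem IsQDSolution.contiguity_asc_even (h : IsQDSolution r S) {d : ℕ} (hd : d + 2 ≤ r)
    (hm : m (d + 2) = m (d + 1) + 1) (n : ℤ) :
    qdMoment S (d + 1) (m (d + 1) - d) n = qdMoment S (d + 1) (m (d + 2) - d) n +
      upperEvenWeight m S (d + 1) * qdMoment S d (m (d + 1) - d + 1) n := by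
  rw [h.qdMoment_shift d (by omega), show m (d + 2) - (d : ℤ) = m (d + 1) - d + 1 by omega]
  congr 2
  simp only [qdE, upperEvenWeight, muRatio, Nat.add_sub_cancel]
  rw [if_neg (by rw [show d + 1 + 1 = d + 2 from rfl]; omega),
    show m (d + 1) - (d : ℤ) + d = m (d + 1) by omega, div_div_div_eq, mul_one]
  have := h.ne_zero (d + 1) (m (d + 1)) (by omega)
  ring

/-- The common form of the flat, the descending and the topmost case. -/
theorem IsQDSolution.contiguity_loop (h : IsQDSolution r S) {d : ℕ} (hd : d + 1 ≤ r) (k n : ℤ) :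
    qdMoment S (d + 1) (k - d) (n + 1) = qdMoment S (d + 2) (k - d - 1) n +
      S (d + 2) (k + 1) * S (d + 1) k / (S (d + 2) k * S (d + 1) (k + 1)) *
        qdMoment S (d + 1) (k - d) n +
      S (d + 2) (k + 1) * S d k / (S (d + 1) k * S (d + 1) (k + 1)) *
        qdMoment S d (k - d + 1) (n + 1) := by
  have h1 := qdMoment_succ S (d + 1) (k - d - 1) n
  have h2 := h.qdMoment_contiguous d hd (k - d - 1) n
  rw [show k - (d : ℤ) - 1 + 1 = k - d by ring] at h1 h2
  rw [show k - (d : ℤ) - 1 + d = k - 1 by ring, show k - 1 + 1 = k by ring] at h2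
  rw [h1]
  simp only [qdQ]
  push_cast
  rw [show k - (d : ℤ) - 1 + (d + 1) = k by ring]
  have n1 := h.ne_zero (d + 1) k (by omega)
  have n2 := h.ne_zero (d + 2) k (by omega)
  have n3 := h.ne_zero (d + 1) (k + 1) (by omega)
  simp only [show d + 1 + 1 = d + 2 from rfl] at *
  field_simp
  linear_combination S (d + 2) (k + 1) * h2

theorem IsQDSolution.contiguity_flat (h : IsQDSolution r S) {d : ℕ} (hd : d + 2 ≤ r)
    (hm : m (d + 2) = m (d + 1)) (n : ℤ) :
    qdMoment S (d + 1) (m (d + 1) - d) (n + 1) = qdMoment S (d + 2) (m (d + 2) - d - 1) n +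
      oddWeight m S (d + 2) * qdMoment S (d + 1) (m (d + 1) - d) n +
      upperEvenWeight m S (d + 1) * qdMoment S d (m (d + 1) - d + 1) (n + 1) := by
  rw [h.contiguity_loop (by omega), hm]
  congr 2
  · congr 1
    simp only [oddWeight, lambdaRatio, show d + 2 - 1 = d + 1 by omega, hm, div_div_div_eq]
  · simp only [upperEvenWeight, muRatio, Nat.add_sub_cancel]
    rw [if_neg (by rw [show d + 1 + 1 = d + 2 from rfl]; omega), div_div_div_eq, mul_one,
      mul_comm (S (d + 1) (m (d + 1)))]

/-- In `IsQDSolution.contiguity_loop` the moment of degree `r + 1` vanishes, and the factors from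
the row `r + 1` are `1`. -/
theorem IsQDSolution.contiguity_top (h : IsQDSolution r S) {d : ℕ} (hd : d + 1 = r) (m : ℕ → ℤ)
    (n : ℤ) :
    qdMoment S (d + 1) (m (d + 1) - d) (n + 1) =
      oddWeight m S (d + 2) * qdMoment S (d + 1) (m (d + 1) - d) n +
      upperEvenWeight m S (d + 1) * qdMoment S d (m (d + 1) - d + 1) (n + 1) := by
  subst hd
  have t := h.top
  simp only [show d + 1 + 1 = d + 2 from rfl] at t
  rw [h.contiguity_loop le_rfl]
  have hz := h.qdMoment_top (m (d + 1) - d - 1) n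
  simp only [show d + 1 + 1 = d + 2 from rfl] at hz
  rw [hz, zero_add]
  congr 2
  · simp [oddWeight, lambdaRatio, t]
  · simp only [upperEvenWeight, muRatio, lambdaRatio, Nat.add_sub_cancel,
      show d + 1 + 1 = d + 2 from rfl, t]
    simp only [div_one, ite_self, mul_one, one_mul]
    rw [mul_comm (S (d + 1) (m (d + 1))), show d + 2 - 1 = d + 1 by omega, div_div_div_eq, one_mul]

/-- Compared with `IsQDSolution.contiguity_loop`, the polynomial of degree `d + 2` has its shift
lowered by one. The extra term from `IsQDSolution.qdMoment_shift` is a combination of the two lower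
terms, and the relation in row `d + 2` merges the coefficients into the corrected weights. -/
theorem IsQDSolution.contiguity_desc (h : IsQDSolution r S) {d : ℕ} (hd : d + 2 ≤ r)
    (hm : m (d + 1) = m (d + 2) + 1) (n : ℤ) :
    qdMoment S (d + 1) (m (d + 1) - d) (n + 1) = qdMoment S (d + 2) (m (d + 2) - d - 1) n +
      oddWeight m S (d + 2) * qdMoment S (d + 1) (m (d + 1) - d) n +
      upperEvenWeight m S (d + 1) * qdMoment S d (m (d + 1) - d + 1) (n + 1) := by
  obtain ⟨k, hk⟩ : ∃ k, k = m (d + 1) := ⟨_, rfl⟩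
  have hk' : m (d + 2) = k - 1 := by omega
  have hl := h.contiguity_loop (show d + 1 ≤ r by omega) k n
  have hs := h.qdMoment_shift (d + 1) (by omega) (k - d - 1 - 1) n
  have h2 := h.qdMoment_contiguous d (by omega) (k - d - 1) n
  have r1 := h.rel (d + 1) k (by omega)
  simp only [oddWeight, upperEvenWeight, muRatio, lambdaRatio, Nat.add_sub_cancel,
    show d + 1 + 1 = d + 2 from rfl, show d + 2 - 1 = d + 1 by omega, hk', ← hk,
    sub_add_cancel, if_true]
  simp only [qdE, show d + 1 + 1 = d + 2 from rfl, show d + 1 + 2 = d + 3 from rfl] at hl hs h2 r1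
  push_cast at hs
  rw [show k - (d : ℤ) - 1 - 1 + (d + 1) = k - 1 by ring, sub_add_cancel, sub_add_cancel] at hs
  rw [show k - (d : ℤ) - 1 + d = k - 1 by ring, sub_add_cancel, sub_add_cancel] at h2
  rw [show k - 1 - (d : ℤ) - 1 = k - d - 1 - 1 by ring, hs]
  have n1 := h.ne_zero (d + 1) k (by omega)
  have n2 := h.ne_zero (d + 2) k (by omega)
  have n3 := h.ne_zero (d + 1) (k + 1) (by omega)
  have n4 := h.ne_zero (d + 2) (k - 1) (by omega)
  have n5 := h.ne_zero d k (by omega)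
  have n6 := h.ne_zero (d + 2) (k + 1) (by omega)
  have n7 := h.ne_zero (d + 1) (k - 1) (by omega)
  have h3 : qdMoment S (d + 1) (k - d - 1) n = (S (d + 2) k * S d k *
      qdMoment S d (k - d + 1) (n + 1) + S (d + 1) k ^ 2 * qdMoment S (d + 1) (k - d) n) /
      (S (d + 1) (k - 1) * S (d + 1) (k + 1)) := by
    rw [eq_div_iff (by positivity)]
    linear_combination h2
  rw [hl, h3]
  field_simp
  linear_combination (S (d + 1) k ^ 2 * qdMoment S (d + 1) (k - d) n +
    S d k * S (d + 2) k * qdMoment S d (k - d + 1) (n + 1)) * r1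

/-- The target just below the current position of a run and the sum over all earlier positions
combine into a single moment. Thus a sum over a whole run costs no more than one term. -/
theorem IsQDSolution.run_desc (h : IsQDSolution r S) {d : ℕ} (hd : d + 2 ≤ r)
    (hm : m (d + 1) = m (d + 2) + 1) (n : ℤ) :
    qdMoment S (d + 1) (m (d + 2) - d + 1) n + upperEvenWeight m S (d + 1) / oddWeight m S (d + 2) *
        qdMoment S d (m (d + 1) - d + 1) (n + 1) =
      runFactor m S (d + 2) * qdMoment S (d + 1) (m (d + 2) - d) n := by
  obtain ⟨k, hk⟩ : ∃ k, k = m (d + 1) := ⟨_, rfl⟩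
  have hk' : m (d + 2) = k - 1 := by omega
  have h2 := h.qdMoment_contiguous d (by omega) (k - d - 1) n
  simp only [oddWeight, upperEvenWeight, muRatio, lambdaRatio, runFactor, Nat.add_sub_cancel,
    show d + 1 + 1 = d + 2 from rfl, show d + 2 - 1 = d + 1 by omega, hk', ← hk,
    sub_add_cancel, if_true] at h2 ⊢
  rw [show k - (d : ℤ) - 1 + d = k - 1 by ring, sub_add_cancel] at h2
  rw [show k - 1 - (d : ℤ) = k - d - 1 by ring, sub_add_cancel]
  have n1 := h.ne_zero (d + 1) k (by omega)
  have n2 := h.ne_zero (d + 2) k (by omega)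
  have n3 := h.ne_zero (d + 1) (k + 1) (by omega)
  have n4 := h.ne_zero (d + 2) (k - 1) (by omega)
  have n5 := h.ne_zero d k (by omega)
  have n6 := h.ne_zero (d + 2) (k + 1) (by omega)
  have n7 := h.ne_zero (d + 1) (k - 1) (by omega)
  field_simp
  linear_combination -h2

end Contiguity

/-! ## Sums over single paths -/

section HopSums

variable {r : ℕ} {m : ℕ → ℤ} {K : Type u} [Field K] {R : ℕ → ℤ → K}

open Classical in
/-- The sum of `x` over the heights reached from `a` by a hop, with weights. -/
noncomputable def hopSum (r : ℕ) (m : ℕ → ℤ) (R : ℕ → ℤ → K) (x : ℕ → K) (a : ℕ) : K :=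
  ∑ b ∈ Finset.range (a + 1), if IsHop r m a b then hopWeight r m R a b * x b else 0

/-- The sum over the paths which start at height `a`, make `n` hops and end at height `0`. -/
noncomputable def pathSum (r : ℕ) (m : ℕ → ℤ) (R : ℕ → ℤ → K) : ℕ → ℕ → K
  | 0, a => if a = 0 then 1 else 0
  -- Before each hop the path climbs from `a` to some `c` by steps of weight `1`.
  | n + 1, a => ∑ c ∈ Finset.Icc a (gammaLabel m r + 2), hopSum r m R (pathSum r m R n) c

/-- Taking out the path which does not climb leaves the sum for the next height. In this form the
recursion has the shape of a contiguity relation. -/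
theorem pathSum_succ {n a : ℕ} (ha : a ≤ gammaLabel m r + 2) :
    pathSum r m R (n + 1) a =
      pathSum r m R (n + 1) (a + 1) + hopSum r m R (pathSum r m R n) a := by
  simp only [pathSum]
  rw [← Finset.insert_Icc_succ_left_eq_Icc ha, Finset.sum_insert (by simp)]
  simp [add_comm]

theorem pathSum_above {n a : ℕ} (ha : gammaLabel m r + 2 < a) :
    pathSum r m R (n + 1) a = 0 := by
  simp only [pathSum]
  rw [Finset.Icc_eq_empty (by omega), Finset.sum_empty]

theorem hopSum_zero (hr : 1 ≤ r) (x : ℕ → K) : hopSum r m R x 0 = 0 := by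
  simp [hopSum, not_isHop_zero hr]

theorem hopSum_eq_single {a b : ℕ} (h : IsHop r m a b) (hu : ∀ b', IsHop r m a b' → b' = b)
    (x : ℕ → K) : hopSum r m R x a = hopWeight r m R a b * x b := by
  unfold hopSum
  rw [Finset.sum_eq_single b]
  · rw [if_pos h]
  · intro b' _ hne
    rw [if_neg fun h' => hne (hu b' h')]
  · intro hb
    exact absurd (Finset.mem_range.2 (Nat.lt_succ_of_le h.le)) hb

theorem hopSum_one (hr : 1 ≤ r) (x : ℕ → K) :
    hopSum r m R x 1 = oddWeight m R 1 * x 0 := by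
  rw [hopSum_eq_single (b := 0), hopWeight_one hr]
  · exact (isHop_iff hr _ _).2 (by simp)
  · intro b' h
    rw [isHop_iff hr] at h
    rcases h with ⟨_, h⟩ | ⟨h, _⟩ | ⟨α, h1, h2, h3, h, _⟩ | ⟨β, γ, h1, h2, h3, h4, h, _⟩ |
      ⟨α, h1, h2, h3, h, _⟩
    · exact h
    · omega
    · have := le_gammaLabel m α; omega
    · have := le_gammaLabel m γ; omega
    · have := le_gammaLabel m α; omega

theorem hopSum_top (hr : 1 ≤ r) (x : ℕ → K) :
    hopSum r m R x (gammaLabel m r + 2) = oddWeight m R (r + 1) * x (gammaLabel m r + 1) := by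
  rw [hopSum_eq_single (b := gammaLabel m r + 1), hopWeight_top hr]
  · exact (isHop_iff hr _ _).2 (by simp)
  · intro b' h
    rw [isHop_iff hr] at h
    rcases h with ⟨h, _⟩ | ⟨_, h⟩ | ⟨α, h1, h2, h3, h, _⟩ | ⟨β, γ, h1, h2, h3, h4, h, _⟩ |
      ⟨α, h1, h2, h3, h, _⟩
    · omega
    · exact h
    · have := gammaLabel_le m (by omega) h2; omega
    · have := gammaLabel_le m (by omega) h3; omega
    · have := gammaLabel_le m (by omega) h2; omega

theorem hopSum_asc (hr : 1 ≤ r) {α : ℕ} (h1 : 2 ≤ α) (h2 : α ≤ r) (h : m α = m (α - 1) + 1)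
    (x : ℕ → K) :
    hopSum r m R x (gammaLabel m α) = oddWeight m R α * x (gammaLabel m α - 1) := by
  rw [hopSum_eq_single (b := gammaLabel m α - 1), hopWeight_asc hr h1 h2 h]
  · exact (isHop_iff hr _ _).2 (Or.inr (Or.inr (Or.inl ⟨α, h1, h2, h, rfl, rfl⟩)))
  · intro b' g
    have p := le_gammaLabel m α
    rw [isHop_iff hr] at g
    rcases g with ⟨g, _⟩ | ⟨g, _⟩ | ⟨β, g1, g2, g3, g, rfl⟩ | ⟨β, γ, g1, g2, g3, g4, g, _⟩ |
      ⟨β, g1, g2, g3, g, _⟩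
    · omega
    · have := gammaLabel_le m (by omega) h2; omega
    · rw [g]
    · exact absurd (by omega) (gammaLabel_ne_pred_of_asc (show 1 ≤ γ by omega) h1 h)
    · have := gammaLabel_inj m (by omega) (by omega) g
      subst this
      exact absurd h g3

/-- The sum over the hops into the descending run which ends with `m_d`. -/
noncomputable def runSum (m : ℕ → ℤ) (R : ℕ → ℤ → K) (x : ℕ → K) : ℕ → K
  | 0 => 0
  | d + 1 => evenWeight m R (d + 1) * (x (gammaLabel m (d + 1)) +
      if 1 ≤ d ∧ m (d + 1) = m d - 1 then runSum m R x d / oddWeight m R (d + 1) else 0)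

open Classical in
-- Going one position further down the descending part of the Motzkin path multiplies every run
-- weight by the same quotient. This justifies the recursive form of `runSum`, which suits induction
-- on `d`.
theorem runSum_eq (x : ℕ → K) (d : ℕ) : runSum m R x d =
    ∑ β ∈ (Finset.Icc 1 d).filter (fun β => IsDescending m β d),
      runWeight m R d β * x (gammaLabel m β) := by
  induction d with
  | zero => simp [runSum]
  | succ d ih =>
    rw [← Finset.insert_Icc_right_eq_Icc_add_one (by omega), Finset.filter_insert,
      if_pos (show IsDescending m (d + 1) (d + 1) from fun δ _ _ => by omega), Finset.sum_insert (by simp), runWeight_self, runSum, mul_add]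
    congr 1
    split_ifs with h
    · rw [ih, Finset.sum_div, Finset.mul_sum]
      refine Finset.sum_congr ?_ ?_
      · ext β
        simp only [Finset.mem_filter, Finset.mem_Icc, and_congr_right_iff]
        intro hβ
        constructor
        · intro hd δ h1 h2
          rcases Nat.lt_or_eq_of_le (Nat.le_of_lt_succ h2) with h3 | rfl
          · exact hd δ h1 h3
          · exact h.2
        · exact fun hd => hd.mono le_rfl (by omega)
      · intro β hβ
        simp only [Finset.mem_filter, Finset.mem_Icc] at hβ
        rw [runWeight_succ m R hβ.1.2]
        ring
    · rw [mul_zero, Finset.sum_eq_zero]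
      intro β hβ
      simp only [Finset.mem_filter, Finset.mem_Icc] at hβ
      exact absurd ⟨by omega, hβ.2 d hβ.1.2 (by omega)⟩ h

theorem isHop_run_iff (hr : 1 ≤ r) {d b : ℕ} (h1 : 1 ≤ d) (h2 : d ≤ r) (hb : b ≤ gammaLabel m d) :
    IsHop r m (gammaLabel m d + 1) b ↔
      ∃ β, 1 ≤ β ∧ β ≤ d ∧ IsDescending m β d ∧ b = gammaLabel m β := by
  rw [isHop_iff hr]
  have p := le_gammaLabel m d
  have q := gammaLabel_le m h1 h2
  constructor
  · rintro (⟨h, _⟩ | ⟨h, _⟩ | ⟨α, g1, g2, g3, h, h'⟩ | ⟨β, γ, g1, g2, g3, g4, h, rfl⟩ |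
      ⟨α, g1, g2, g3, h, h'⟩)
    · omega
    · omega
    · exact absurd (by omega) (gammaLabel_ne_pred_of_asc h1 g1 g3)
    · obtain rfl := gammaLabel_inj m h1 (show 1 ≤ γ by omega) (by omega)
      exact ⟨β, g1, g2, g4, rfl⟩
    · omega
  · rintro ⟨β, g1, g2, g3, rfl⟩
    exact Or.inr (Or.inr (Or.inr (Or.inl ⟨β, d, g1, g2, h2, g3, rfl, rfl⟩)))

theorem isHop_loop_iff (hr : 1 ≤ r) {d : ℕ} (h1 : 1 ≤ d) (h2 : d ≤ r) :
    IsHop r m (gammaLabel m d + 1) (gammaLabel m d + 1) ↔ d < r ∧ m (d + 1) ≠ m d + 1 := by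
  rw [isHop_iff hr]
  have p := le_gammaLabel m d
  have q := gammaLabel_le m h1 h2
  constructor
  · rintro (⟨h, h'⟩ | ⟨h, h'⟩ | ⟨α, g1, g2, g3, h, h'⟩ | ⟨β, γ, g1, g2, g3, g4, h, h'⟩ |
      ⟨α, g1, g2, g3, h, h'⟩)
    · omega
    · omega
    · have := le_gammaLabel m α; omega
    · have := gammaLabel_le m g1 g2; omega
    · have e := gammaLabel_pred_of_not_asc g1 g3
      obtain rfl := gammaLabel_inj m h1 (show 1 ≤ α - 1 by omega) (by omega)
      rw [Nat.sub_add_cancel (by omega)]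
      exact ⟨by omega, g3⟩
  · rintro ⟨g1, g2⟩
    have e := gammaLabel_succ_of_not_asc h1 g2
    exact Or.inr (Or.inr (Or.inr (Or.inr ⟨d + 1, by omega, by omega, by simpa using g2,
      e.symm, e.symm⟩)))

theorem hopSum_run (hr : 1 ≤ r) {d : ℕ} (h1 : 1 ≤ d) (h2 : d ≤ r) (x : ℕ → K) :
    hopSum r m R x (gammaLabel m d + 1) = runSum m R x d +
      if d < r ∧ m (d + 1) ≠ m d + 1 then oddWeight m R (d + 1) * x (gammaLabel m d + 1) else 0 := by
  classical
  unfold hopSum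
  rw [Finset.sum_range_succ]
  congr 1
  · rw [runSum_eq, ← Finset.sum_filter]
    symm
    refine Finset.sum_bij (fun β _ => gammaLabel m β) ?_ ?_ ?_ ?_
    · intro β hβ
      simp only [Finset.mem_filter, Finset.mem_Icc] at hβ
      have := gammaLabel_le m hβ.1.1 hβ.1.2
      rw [Finset.mem_filter, isHop_run_iff hr h1 h2 (by omega), Finset.mem_range]
      exact ⟨by omega, β, hβ.1.1, hβ.1.2, hβ.2, rfl⟩
    · intro β hβ γ hγ h
      simp only [Finset.mem_filter, Finset.mem_Icc] at hβ hγ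
      exact gammaLabel_inj m hβ.1.1 hγ.1.1 h
    · intro b hb
      rw [Finset.mem_filter, Finset.mem_range] at hb
      obtain ⟨β, g1, g2, g3, rfl⟩ := (isHop_run_iff hr h1 h2 (by omega)).1 hb.2
      exact ⟨β, by simp [g1, g2, g3], rfl⟩
    · intro β hβ
      simp only [Finset.mem_filter, Finset.mem_Icc] at hβ
      rw [hopWeight_run hr hβ.1.1 hβ.1.2 h2 hβ.2]
  · simp only [isHop_loop_iff hr h1 h2]
    split_ifs with h
    · have e := gammaLabel_succ_of_not_asc h1 h.2
      rw [← e, hopWeight_side hr (by omega) (by omega) (by simpa using h.2)]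
    · rfl

end HopSums

/-! ## The formula for the first row -/

section SinglePath

variable {r : ℕ} {m : ℕ → ℤ} {K : Type u} [Field K] {R : ℕ → ℤ → K}

theorem lambdaRatio_truncated (R : ℕ → ℤ → K) {α : ℕ} (h : α ≤ r + 1) (n : ℤ) :
    lambdaRatio (truncatedSolution r R) α n = lambdaRatio R α n := by
  simp [lambdaRatio, truncatedSolution_of_le h]

theorem muRatio_truncated (R : ℕ → ℤ → K) {α : ℕ} (h : α ≤ r + 1) (n : ℤ) :
    muRatio (truncatedSolution r R) α n = muRatio R α n := by
  simp [muRatio, truncatedSolution_of_le h, truncatedSolution_of_le (show α - 1 ≤ r + 1 by omega)]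

theorem oddWeight_truncated (m : ℕ → ℤ) (R : ℕ → ℤ → K) {α : ℕ} (h : α ≤ r + 1) :
    oddWeight m (truncatedSolution r R) α = oddWeight m R α := by
  simp only [oddWeight, lambdaRatio_truncated R h,
    lambdaRatio_truncated R (show α - 1 ≤ r + 1 by omega)]

theorem evenWeight_truncated (m : ℕ → ℤ) (R : ℕ → ℤ → K) {α : ℕ} (h : α ≤ r) :
    evenWeight m (truncatedSolution r R) α = evenWeight m R α := by
  simp only [evenWeight, lambdaRatio_truncated R (show α + 1 ≤ r + 1 by omega),
    lambdaRatio_truncated R (show α - 1 ≤ r + 1 by omega),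
    muRatio_truncated R (show α + 1 ≤ r + 1 by omega),
    muRatio_truncated R (show α ≤ r + 1 by omega)]

theorem IsMotzkinPath.step (hm : IsMotzkinPath r m) {d : ℕ} (h1 : 1 ≤ d) (h2 : d + 1 ≤ r) :
    m (d + 1) = m d + 1 ∨ m (d + 1) = m d ∨ m (d + 1) = m d - 1 := by
  have := abs_le.1 (hm d h1 h2)
  omega

/-- The number `m d - m 1 + d` is the delay of the height `gammaLabel m d + 1`: the path sums from
there vanish up to that many hops. Being positive, it excludes the nonzero case at the start of the
induction. -/
theorem IsMotzkinPath.delay_pos (hm : IsMotzkinPath r m) {d : ℕ} (h1 : 1 ≤ d) (h2 : d ≤ r) :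
    1 ≤ m d - m 1 + d := by
  induction d, h1 using Nat.le_induction with
  | base => simp
  | succ d hd ih =>
    have := hm.step hd h2
    have := ih (by omega)
    push_cast
    omega

/-- The values of `pathSum n` in terms of the quotient-difference scheme. -/
structure PathSumValues (r : ℕ) (m : ℕ → ℤ) (R : ℕ → ℤ → K) (n : ℕ) : Prop where
  zero : pathSum r m R n 0 = (R 1 (m 1))⁻¹ * truncatedSolution r R 1 (n + m 1)
  one_zero : n = 0 → pathSum r m R n 1 = 0
  one_pos : 1 ≤ n → pathSum r m R n 1 = (R 1 (m 1))⁻¹ * truncatedSolution r R 1 (n + m 1)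
  -- This case and the next overlap when `n` equals the delay, where the moment vanishes by
  -- orthogonality; the same holds for the last two fields.
  upper_zero : ∀ d : ℕ, 1 ≤ d → d ≤ r → (n : ℤ) ≤ m d - m 1 + d →
    pathSum r m R n (gammaLabel m d + 1) = 0
  upper_pos : ∀ d : ℕ, 1 ≤ d → d ≤ r → m d - m 1 + d ≤ n →
    pathSum r m R n (gammaLabel m d + 1) =
      (R 1 (m 1))⁻¹ * qdMoment (truncatedSolution r R) d (m d - d + 1) (n + m 1 - d)
  asc_zero : ∀ d : ℕ, 1 ≤ d → d + 1 ≤ r → m (d + 1) = m d + 1 → (n : ℤ) ≤ m d - m 1 + d + 1 →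
    pathSum r m R n (gammaLabel m (d + 1)) = 0
  asc_pos : ∀ d : ℕ, 1 ≤ d → d + 1 ≤ r → m (d + 1) = m d + 1 → m d - m 1 + d + 1 ≤ n →
    pathSum r m R n (gammaLabel m (d + 1)) =
      (R 1 (m 1))⁻¹ * qdMoment (truncatedSolution r R) d (m (d + 1) - d + 1) (n + m 1 - d)

theorem pathSumValues_zero (hr : 1 ≤ r) (hm : IsMotzkinPath r m) (hR : IsQSystemSolution r R) :
    PathSumValues r m R 0 where
  zero := by
    rw [truncatedSolution_of_le (by omega)]
    simp [pathSum, hR.ne_zero 1 (m 1) le_rfl hr]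
  one_zero _ := by simp [pathSum]
  one_pos h := by omega
  upper_zero d _ _ _ := by simp [pathSum]
  upper_pos d h1 h2 h := by
    have := hm.delay_pos h1 h2
    push_cast at h; omega
  asc_zero d h1 h2 _ _ := by
    have := le_gammaLabel m (d + 1)
    rw [pathSum, if_neg (by omega)]
  asc_pos d h1 h2 _ h := by
    have := hm.delay_pos h1 (show d ≤ r by omega)
    push_cast at h; omega

theorem evenWeight_of_not_desc (hR : IsQSystemSolution r R) {d : ℕ} (h2 : d ≤ r)
    (h : d = 1 ∨ m (d - 1) ≠ m d + 1) :
    evenWeight m R d = upperEvenWeight m (truncatedSolution r R) d := by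
  rw [← hR.isQDSolution.evenWeight_mul_runFactor m h2, evenWeight_truncated m R h2]
  have : runFactor m (truncatedSolution r R) d = 1 := by
    unfold runFactor
    rcases h with rfl | h
    · simp [lambdaRatio, hR.isQDSolution.bottom]
    · rw [if_neg h]
  rw [this, mul_one]

/-- If the Motzkin path does not descend into `d`, the run consists of one term. If it does,
`IsQDSolution.run_desc` absorbs the sum over the earlier positions, and its `runFactor` turns the
even weight into `upperEvenWeight`. -/
theorem PathSumValues.runSum_values (hm : IsMotzkinPath r m)
    (hR : IsQSystemSolution r R) {n : ℕ} (h : PathSumValues r m R n) {d : ℕ} (h1 : 1 ≤ d)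
    (h2 : d ≤ r) :
    ((n : ℤ) < m d - m 1 + d → runSum m R (pathSum r m R n) d = 0) ∧
    (m d - m 1 + d ≤ n → runSum m R (pathSum r m R n) d =
      (R 1 (m 1))⁻¹ * (upperEvenWeight m (truncatedSolution r R) d *
        qdMoment (truncatedSolution r R) (d - 1) (m d - d + 2) (n + m 1 - d + 1))) := by
  induction d, h1 using Nat.le_induction with
  | base =>
    have e : runSum m R (pathSum r m R n) 1 = evenWeight m R 1 * pathSum r m R n 1 := by
      simp [runSum, gammaLabel_one]
    rw [e]
    constructor
    · intro hn
      rw [h.one_zero (by push_cast at hn; omega)]; simp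
    · intro hn
      rw [h.one_pos (by push_cast at hn; omega), evenWeight_of_not_desc hR h2 (Or.inl rfl)]
      simp [qdMoment]
      ring
  | succ d hd ih =>
    have ih := ih (by omega)
    simp only [runSum, Nat.add_sub_cancel]
    rcases hm.step hd h2 with hs | hs | hs
    · rw [if_neg (by omega), add_zero, evenWeight_of_not_desc hR h2
        (Or.inr (by rw [Nat.add_sub_cancel]; omega))]
      constructor
      · intro hn
        rw [h.asc_zero d hd h2 hs (by push_cast at hn; omega), mul_zero]
      · intro hn
        rw [h.asc_pos d hd h2 hs (by push_cast at hn; omega)]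
        push_cast
        rw [show m (d + 1) - ((d : ℤ) + 1) + 2 = m (d + 1) - d + 1 by ring,
          show (n : ℤ) + m 1 - (d + 1) + 1 = n + m 1 - d by ring]
        ring
    · have e := gammaLabel_succ_of_not_asc hd (show m (d + 1) ≠ m d + 1 by omega)
      rw [if_neg (by omega), add_zero, evenWeight_of_not_desc hR h2
        (Or.inr (by rw [Nat.add_sub_cancel]; omega)), e]
      constructor
      · intro hn
        rw [h.upper_zero d hd (by omega) (by push_cast at hn; omega), mul_zero]
      · intro hn
        rw [h.upper_pos d hd (by omega) (by push_cast at hn; omega)]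
        push_cast
        rw [show m (d + 1) - ((d : ℤ) + 1) + 2 = m d - d + 1 by rw [hs]; ring,
          show (n : ℤ) + m 1 - (d + 1) + 1 = n + m 1 - d by ring]
        ring
    · have e := gammaLabel_succ_of_not_asc hd (show m (d + 1) ≠ m d + 1 by omega)
      rw [if_pos ⟨hd, hs⟩, e]
      constructor
      · intro hn
        push_cast at hn
        rw [h.upper_zero d hd (by omega) (by omega), ih.1 (by omega)]
        simp
      · intro hn
        push_cast at hn
        rw [h.upper_pos d hd (by omega) (by omega), ih.2 (by omega)]
        obtain ⟨i, rfl⟩ : ∃ i, d = i + 1 := ⟨d - 1, by omega⟩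
        have key := hR.isQDSolution.run_desc (m := m) (d := i) h2 (by
          rw [show i + 2 = i + 1 + 1 from rfl, hs]; ring) (n + m 1 - (i + 1))
        have key2 := hR.isQDSolution.evenWeight_mul_runFactor m h2
        rw [evenWeight_truncated m R h2] at key2
        rw [oddWeight_truncated m R (by omega)] at key
        simp only [show i + 1 + 1 = i + 2 from rfl, Nat.add_sub_cancel] at *
        push_cast
        rw [show m (i + 1) - ((i : ℤ) + 1) + 1 = m (i + 2) - i + 1 by rw [hs]; ring,
          show m (i + 1) - ((i : ℤ) + 1) + 2 = m (i + 1) - i + 1 by ring,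
          show m (i + 2) - ((i : ℤ) + 2) + 2 = m (i + 2) - i by ring,
          show (n : ℤ) + m 1 - (i + 2) + 1 = n + m 1 - (i + 1) by ring, ← key2]
        linear_combination (R 1 (m 1))⁻¹ * evenWeight m R (i + 2) * key

/-- Each value is computed by `pathSum_succ` from the value one vertex higher with the same number
of hops and from values with one hop less. The contiguity relation for the local shape of `m` says
that the moments obey the same rule. -/
theorem PathSumValues.succ (hr : 1 ≤ r) (hm : IsMotzkinPath r m) (hR : IsQSystemSolution r R)
    {n : ℕ} (h : PathSumValues r m R n) : PathSumValues r m R (n + 1) := by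
  have hS := hR.isQDSolution
  have below : ∀ d, 1 ≤ d → d ≤ r → gammaLabel m d ≤ gammaLabel m r := fun d h1 h2 => by
    have := gammaLabel_le m h1 h2; omega
  -- the two values above an ascending separation
  have asc : ∀ d : ℕ, 1 ≤ d → d + 1 ≤ r → m (d + 1) = m d + 1 →
      (((n + 1 : ℕ) : ℤ) ≤ m (d + 1) - m 1 + (d + 1 : ℕ) →
        pathSum r m R (n + 1) (gammaLabel m (d + 1) + 1) = 0) →
      (m (d + 1) - m 1 + (d + 1 : ℕ) ≤ (n + 1 : ℕ) →
        pathSum r m R (n + 1) (gammaLabel m (d + 1) + 1) = (R 1 (m 1))⁻¹ *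
          qdMoment (truncatedSolution r R) (d + 1) (m (d + 1) - (d + 1 : ℕ) + 1)
            ((n + 1 : ℕ) + m 1 - (d + 1 : ℕ))) →
      ((((n + 1 : ℕ) : ℤ) ≤ m d - m 1 + d + 1 →
        pathSum r m R (n + 1) (gammaLabel m (d + 1)) = 0) ∧
      (m d - m 1 + d + 1 ≤ (n + 1 : ℕ) →
        pathSum r m R (n + 1) (gammaLabel m (d + 1)) = (R 1 (m 1))⁻¹ *
          qdMoment (truncatedSolution r R) d (m (d + 1) - d + 1) ((n + 1 : ℕ) + m 1 - d))) := by
    intro d h1 h2 hs z p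
    have e := gammaLabel_succ_of_asc h1 hs
    have hb := below (d + 1) (by omega) h2
    rw [pathSum_succ (by omega), hopSum_asc hr (by omega) h2 (by simpa using hs),
      show gammaLabel m (d + 1) - 1 = gammaLabel m d + 1 by omega]
    constructor
    · intro hn
      push_cast at hn z
      rw [z (by omega), h.upper_zero d h1 (by omega) (by omega)]
      simp
    · intro hn
      push_cast at hn z p ⊢
      have key := contiguity_asc_odd (S := truncatedSolution r R) hs (n + m 1 - d)
      rw [oddWeight_truncated m R (by omega)] at key
      rw [h.upper_pos d h1 (by omega) (by omega),
        show (n : ℤ) + 1 + m 1 - d = n + m 1 - d + 1 by ring, key]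
      -- Before the delay of the upper height its path sum is zero; the moment of degree `d + 1` in
      -- the relation is then zero as well, by orthogonality.
      rcases lt_or_ge ((n : ℤ) + 1) (m (d + 1) - m 1 + (d + 1)) with hlt | hge
      · rw [z hlt.le, hS.qdMoment_vanish (α := d + 1) (by omega) (by omega) (by push_cast; omega)]
        ring
      · rw [p hge, show (n : ℤ) + 1 + m 1 - (d + 1) = n + m 1 - d by ring,
          show m (d + 1) - ((d : ℤ) + 1) + 1 = m (d + 1) - d by ring]
        ring
  -- Induction from the top vertex downwards; `j` is the distance of `d` from `r`.
  have upper : ∀ j d : ℕ, d + j = r → 1 ≤ d →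
      (((n + 1 : ℕ) : ℤ) ≤ m d - m 1 + d →
        pathSum r m R (n + 1) (gammaLabel m d + 1) = 0) ∧
      (m d - m 1 + d ≤ (n + 1 : ℕ) →
        pathSum r m R (n + 1) (gammaLabel m d + 1) = (R 1 (m 1))⁻¹ *
          qdMoment (truncatedSolution r R) d (m d - d + 1) ((n + 1 : ℕ) + m 1 - d)) := by
    intro j
    induction j with
    | zero =>
      rintro d rfl h1
      have T := h.runSum_values hm hR h1 le_rfl
      simp only [Nat.add_zero] at *
      rw [pathSum_succ (by omega), pathSum_succ (by omega), pathSum_above (by omega),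
        hopSum_run hr h1 le_rfl, if_neg (by omega), hopSum_top hr]
      constructor
      · intro hn
        push_cast at hn
        rw [h.upper_zero d h1 le_rfl (by omega), T.1 (by omega)]
        simp
      · intro hn
        -- At the delay itself all path sums involved are zero and so is the moment; only beyond it
        -- is the contiguity relation needed.
        rcases eq_or_lt_of_le hn with heq | hlt
        · push_cast at heq
          rw [h.upper_zero d h1 le_rfl (by omega), T.1 (by omega),
            hS.qdMoment_vanish (by omega) (by push_cast; omega) (by push_cast; omega)]
          simp
        · push_cast at hlt
          rw [h.upper_pos d h1 le_rfl (by omega), T.2 (by omega)]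
          obtain ⟨i, rfl⟩ : ∃ i, d = i + 1 := ⟨d - 1, by omega⟩
          have key := hS.contiguity_top rfl m (n + m 1 - (i + 1))
          rw [oddWeight_truncated m R le_rfl] at key
          push_cast
          simp only [Nat.add_sub_cancel, show i + 1 + 1 = i + 2 from rfl] at *
          rw [show m (i + 1) - ((i : ℤ) + 1) + 1 = m (i + 1) - i by ring,
            show m (i + 1) - ((i : ℤ) + 1) + 2 = m (i + 1) - i + 1 by ring,
            show (n : ℤ) + 1 + m 1 - (i + 1) = n + m 1 - (i + 1) + 1 by ring, key]
          ring
    | succ j ih =>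
      intro d hj h1
      have h2 : d + 1 ≤ r := by omega
      obtain ⟨z, p⟩ := ih (d + 1) (by omega) (by omega)
      have T := h.runSum_values hm hR h1 (by omega)
      have hb := below d h1 (by omega)
      rw [pathSum_succ (by omega), hopSum_run hr h1 (by omega)]
      have hd := hm.delay_pos h1 (by omega)
      rcases hm.step h1 h2 with hs | hs | hs
      · obtain ⟨z', p'⟩ := asc d h1 h2 hs z p
        have e := gammaLabel_succ_of_asc h1 hs
        rw [if_neg (by omega), show gammaLabel m d + 1 + 1 = gammaLabel m (d + 1) by omega]
        constructor
        · intro hn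
          push_cast at hn z'
          rw [z' (by omega), T.1 (by omega)]
          simp
        · intro hn
          rcases eq_or_lt_of_le hn with heq | hlt
          · push_cast at heq z'
            rw [z' (by omega), T.1 (by omega),
              hS.qdMoment_vanish (by omega) (by push_cast; omega) (by push_cast; omega)]
            simp
          · push_cast at hlt p'
            rw [p' (by omega), T.2 (by omega)]
            obtain ⟨i, rfl⟩ : ∃ i, d = i + 1 := ⟨d - 1, by omega⟩
            have key := hS.contiguity_asc_even (m := m) h2 hs (n + m 1 - i)
            push_cast
            simp only [Nat.add_sub_cancel, show i + 1 + 1 = i + 2 from rfl] at *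
            rw [show m (i + 1) - ((i : ℤ) + 1) + 1 = m (i + 1) - i by ring,
              show m (i + 1) - ((i : ℤ) + 1) + 2 = m (i + 1) - i + 1 by ring,
              show m (i + 2) - ((i : ℤ) + 1) + 1 = m (i + 2) - i by ring,
              show (n : ℤ) + 1 + m 1 - (i + 1) = n + m 1 - i by ring,
              show (n : ℤ) + m 1 - (i + 1) + 1 = n + m 1 - i by ring, key]
            ring
      all_goals
        have e := gammaLabel_succ_of_not_asc h1 (show m (d + 1) ≠ m d + 1 by omega)
        rw [if_pos ⟨by omega, by omega⟩,
          show gammaLabel m d + 1 + 1 = gammaLabel m (d + 1) + 1 by omega]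
        constructor
        · intro hn
          push_cast at hn z
          rw [z (by omega), T.1 (by omega), h.upper_zero d h1 (by omega) (by omega)]
          simp
        · intro hn
          rcases eq_or_lt_of_le hn with heq | hlt
          · push_cast at heq z
            rw [z (by omega), T.1 (by omega), h.upper_zero d h1 (by omega) (by omega),
              hS.qdMoment_vanish (by omega) (by push_cast; omega) (by push_cast; omega)]
            simp
          · push_cast at hlt p
            rw [p (by omega), T.2 (by omega), h.upper_pos d h1 (by omega) (by omega)]
            obtain ⟨i, rfl⟩ : ∃ i, d = i + 1 := ⟨d - 1, by omega⟩
            simp only [Nat.add_sub_cancel, show i + 1 + 1 = i + 2 from rfl] at *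
            -- The flat and the descending relation have the same form and differ only in the values
            -- of the weights.
            have key := by
              first
              | exact hS.contiguity_flat (m := m) h2 hs (n + m 1 - (i + 1))
              | exact hS.contiguity_desc (m := m) h2 (by omega) (n + m 1 - (i + 1))
            rw [oddWeight_truncated m R (by omega)] at key
            push_cast
            rw [show m (i + 1) - ((i : ℤ) + 1) + 1 = m (i + 1) - i by ring,
              show m (i + 1) - ((i : ℤ) + 1) + 2 = m (i + 1) - i + 1 by ring,
              show m (i + 2) - ((i : ℤ) + 1 + 1) + 1 = m (i + 2) - i - 1 by ring,
              show (n : ℤ) + 1 + m 1 - (i + 1 + 1) = n + m 1 - (i + 1) by ring,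
              show (n : ℤ) + 1 + m 1 - (i + 1) = n + m 1 - (i + 1) + 1 by ring, key]
            ring
  have one : pathSum r m R (n + 1) 1 =
      (R 1 (m 1))⁻¹ * truncatedSolution r R 1 ((n + 1 : ℕ) + m 1) := by
    have u := (upper (r - 1) 1 (by omega) le_rfl).2 (by push_cast; omega)
    rw [gammaLabel_one] at u
    rw [pathSum_succ (by omega), hopSum_one hr, u, h.zero]
    have key := hS.contiguity_first m (n + m 1)
    rw [oddWeight_truncated m R (by omega)] at key
    push_cast
    rw [show m 1 - (1 : ℤ) + 1 = m 1 by ring, show (n : ℤ) + 1 + m 1 - 1 = n + m 1 by ring,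
      show (n : ℤ) + 1 + m 1 = n + m 1 + 1 by ring, key]
    ring
  exact
    { zero := by rw [pathSum_succ (by omega), hopSum_zero hr, add_zero, zero_add, one]
      one_zero := fun h => by omega
      one_pos := fun _ => one
      upper_zero := fun d h1 h2 => (upper (r - d) d (by omega) h1).1
      upper_pos := fun d h1 h2 => (upper (r - d) d (by omega) h1).2
      asc_zero := fun d h1 h2 hs =>
        (asc d h1 h2 hs (upper (r - (d + 1)) (d + 1) (by omega) (by omega)).1
          (upper (r - (d + 1)) (d + 1) (by omega) (by omega)).2).1
      asc_pos := fun d h1 h2 hs =>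
        (asc d h1 h2 hs (upper (r - (d + 1)) (d + 1) (by omega) (by omega)).1
          (upper (r - (d + 1)) (d + 1) (by omega) (by omega)).2).2 }

/-- The generating function of the paths from the root to the root is the first row. -/
theorem pathSum_eq (hr : 1 ≤ r) (hm : IsMotzkinPath r m) (hR : IsQSystemSolution r R) (n : ℕ) :
    pathSum r m R n 0 = (R 1 (m 1))⁻¹ * R 1 (n + m 1) := by
  have : PathSumValues r m R n := by
    induction n with
    | zero => exact pathSumValues_zero hr hm hR
    | succ n ih => exact ih.succ hr hm hR
  rw [this.zero, truncatedSolution_of_le (by omega)]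

end SinglePath

/-! ## Lattice paths by columns -/

section Columns

variable {r : ℕ} {m : ℕ → ℤ}

/-- The lattice point of height `y` in column `v`. Steps up stay in a column, the other steps go
to the next column. -/
def columnPoint (v y : ℕ) : LatticePoint := (2 * (v : ℤ) + y, y)

theorem columnPoint_inj {v y w z : ℕ} : columnPoint v y = columnPoint w z ↔ v = w ∧ y = z := by
  simp only [columnPoint, Prod.mk.injEq]
  omega

/-- The difference of the two coordinates is constant on steps up and grows by `2` on every other
step, whatever the height change is. -/
theorem isLatticeStep_columnPoint (hr : 1 ≤ r) {v y : ℕ} {Q : LatticePoint} :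
    IsLatticeStep r m (columnPoint v y) Q ↔
      (Q = columnPoint v (y + 1) ∧ y + 1 ≤ gammaLabel m r + 2) ∨
      ∃ b, IsHop r m y b ∧ Q = columnPoint (v + 1) b := by
  obtain ⟨x, z⟩ := Q
  simp only [IsLatticeStep, columnPoint, Prod.mk.injEq, IsHop]
  constructor
  · rintro (⟨rfl, h2, h3⟩ | ⟨rfl, h2, h3, h4⟩ | ⟨h1, h2, h3⟩)
    · left
      rw [isGammaEdge_up_iff hr] at h3
      exact ⟨⟨by push_cast; omega, rfl⟩, h3⟩
    · right
      exact ⟨z, Or.inl ⟨rfl, h3, h4⟩, by push_cast; omega, rfl⟩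
    · right
      exact ⟨z, Or.inr ⟨h1, h3⟩, by push_cast; omega, rfl⟩
  · rintro (⟨⟨h1, rfl⟩, h2⟩ | ⟨b, ⟨rfl, h1, h2⟩ | ⟨h1, h2⟩, h3, rfl⟩)
    · left
      rw [isGammaEdge_up_iff hr]
      push_cast at h1
      exact ⟨rfl, by omega, h2⟩
    · right; left
      push_cast at h3
      exact ⟨rfl, by omega, h1, h2⟩
    · right; right
      push_cast at h3
      exact ⟨h1, by omega, h2⟩

theorem stepWeight_up {K : Type u} [Field K] (R : ℕ → ℤ → K) (hr : 1 ≤ r) {v y : ℕ}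
    (h : y + 1 ≤ gammaLabel m r + 2) :
    stepWeight r m R (columnPoint v y) (columnPoint v (y + 1)) = 1 := by
  unfold stepWeight
  rw [if_neg (by simp [columnPoint])]
  exact gammaWeight_up R hr h

theorem stepWeight_hop {K : Type u} [Field K] (R : ℕ → ℤ → K) (v a b : ℕ) :
    stepWeight r m R (columnPoint v a) (columnPoint (v + 1) b) = hopWeight r m R a b := rfl

theorem SegmentsCross.symm {P Q S T : LatticePoint} (h : SegmentsCross P Q S T) :
    SegmentsCross S T P Q := by
  unfold SegmentsCross at *
  rwa [Set.inter_comm]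

theorem StronglyNonIntersecting.symm {L L' : List LatticePoint}
    (h : StronglyNonIntersecting r m L L') : StronglyNonIntersecting r m L' L := by
  refine ⟨fun P hP hP' => h.1 P hP' hP, fun P Q S T h1 h2 => ?_⟩
  obtain ⟨g1, g2⟩ := h.2 S T P Q h2 h1
  exact ⟨fun c => g1 c.symm, fun c => g2 ⟨c.2.1, c.1, c.2.2.symm⟩⟩

theorem SegmentsCross.exists_params {v y v' y' w z w' z' : ℕ}
    (h : SegmentsCross (columnPoint v y) (columnPoint v' y') (columnPoint w z)
      (columnPoint w' z')) :
    ∃ s t : ℝ, 0 < s ∧ s < 1 ∧ 0 < t ∧ t < 1 ∧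
      (v : ℝ) + s * (v' - v) = w + t * (w' - w) ∧ (y : ℝ) + s * (y' - y) = z + t * (z' - z) := by
  obtain ⟨p, ⟨a, b, ha, hb, hab, hp⟩, ⟨c, d, hc, hd, hcd, hp'⟩⟩ := h
  have := hp.trans hp'.symm
  simp only [LatticePoint.toPlane, columnPoint, Prod.smul_mk, Prod.mk_add_mk, smul_eq_mul,
    Prod.mk.injEq] at this
  push_cast at this
  obtain ⟨h1, h2⟩ := this
  refine ⟨b, d, hb, by linarith, hd, by linarith, ?_, ?_⟩
  · have ea : a = 1 - b := by linarith
    have ec : c = 1 - d := by linarith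
    subst ea ec
    linarith
  · have ea : a = 1 - b := by linarith
    have ec : c = 1 - d := by linarith
    subst ea ec
    linarith

theorem segmentsCross_of_lt {v a b a' b' : ℕ} (h1 : a < a') (h2 : b' < b) :
    SegmentsCross (columnPoint v a) (columnPoint (v + 1) b) (columnPoint v a')
      (columnPoint (v + 1) b') := by
  have g1 : (a : ℝ) < a' := by exact_mod_cast h1
  have g2 : (b' : ℝ) < b := by exact_mod_cast h2
  have hD : (0 : ℝ) < (a' - a) + (b - b') := by linarith
  -- Both segments move through the columns at the same rate, so they meet at the parameter `t` with
  -- `a + t (b - a) = a' + t (b' - a')`.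
  obtain ⟨t, ht⟩ : ∃ t : ℝ, t = (a' - a) / ((a' - a) + (b - b')) := ⟨_, rfl⟩
  have t0 : 0 < t := by rw [ht]; apply div_pos <;> linarith
  have t1 : t < 1 := by rw [ht, div_lt_one hD]; linarith
  have te : t * ((a' - a) + (b - b')) = a' - a := by rw [ht]; field_simp
  refine ⟨(1 - t) • (columnPoint v a).toPlane + t • (columnPoint (v + 1) b).toPlane,
    ⟨1 - t, t, by linarith, t0, by ring, rfl⟩, ⟨1 - t, t, by linarith, t0, by ring, ?_⟩⟩
  simp only [LatticePoint.toPlane, columnPoint, Prod.smul_mk, Prod.mk_add_mk, smul_eq_mul,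
    Prod.mk.injEq]
  push_cast
  constructor <;> linarith

/-- Steps cross only if they go from the same column to the next one. -/
theorem SegmentsCross.cases (hr : 1 ≤ r) {v y w z : ℕ} {Q T : LatticePoint}
    (hQ : IsLatticeStep r m (columnPoint v y) Q) (hT : IsLatticeStep r m (columnPoint w z) T)
    (h : SegmentsCross (columnPoint v y) Q (columnPoint w z) T) :
    (v = w ∧ y = z) ∨ (v = w ∧ ∃ b b', IsHop r m y b ∧ IsHop r m z b' ∧
      Q = columnPoint (v + 1) b ∧ T = columnPoint (v + 1) b' ∧
      ((y < z ∧ b' < b) ∨ (z < y ∧ b < b'))) := by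
  rw [isLatticeStep_columnPoint hr] at hQ hT
  rcases hQ with ⟨rfl, _⟩ | ⟨b, hb, rfl⟩ <;> rcases hT with ⟨rfl, _⟩ | ⟨b', hb', rfl⟩ <;>
    obtain ⟨s, t, hs0, hs1, ht0, ht1, e1, e2⟩ := h.exists_params <;> push_cast at e1 e2
  · left
    have hv : (v : ℝ) = w := by linarith
    have hv' : v = w := by exact_mod_cast hv
    have l1 : (y : ℝ) < z + 1 := by linarith
    have l2 : (z : ℝ) < y + 1 := by linarith
    have l1' : y < z + 1 := by exact_mod_cast l1
    have l2' : z < y + 1 := by exact_mod_cast l2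
    exact ⟨hv', by omega⟩
  · exfalso
    have l1 : (w : ℝ) < v := by linarith
    have l2 : (v : ℝ) < w + 1 := by linarith
    have l1' : w < v := by exact_mod_cast l1
    have l2' : v < w + 1 := by exact_mod_cast l2
    omega
  · exfalso
    have l1 : (v : ℝ) < w := by linarith
    have l2 : (w : ℝ) < v + 1 := by linarith
    have l1' : v < w := by exact_mod_cast l1
    have l2' : w < v + 1 := by exact_mod_cast l2
    omega
  · have l1 : (v : ℝ) < w + 1 := by linarith
    have l2 : (w : ℝ) < v + 1 := by linarith
    have l1' : v < w + 1 := by exact_mod_cast l1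
    have l2' : w < v + 1 := by exact_mod_cast l2
    obtain rfl : v = w := by omega
    obtain rfl : s = t := by linarith
    rcases lt_trichotomy y z with hlt | heq | hgt
    · refine Or.inr ⟨rfl, b, b', hb, hb', rfl, rfl, Or.inl ⟨hlt, ?_⟩⟩
      by_contra hle
      have g1 : (y : ℝ) < z := by exact_mod_cast hlt
      have g2 : (b : ℝ) ≤ b' := by exact_mod_cast not_lt.1 hle
      nlinarith
    · exact Or.inl ⟨rfl, heq⟩
    · refine Or.inr ⟨rfl, b, b', hb, hb', rfl, rfl, Or.inr ⟨hgt, ?_⟩⟩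
      by_contra hle
      have g1 : (z : ℝ) < y := by exact_mod_cast hgt
      have g2 : (b' : ℝ) ≤ b := by exact_mod_cast not_lt.1 hle
      nlinarith

end Columns

/-! ## Determinants of sums over monotone layers -/

section Layers

/-- `B` is obtained from `S` by moves of `T`, and no two of these moves can be exchanged. -/
def IsUnexchangeable {k : ℕ} (T : ℤ → ℤ → Prop) (S B : Fin k → ℤ) : Prop :=
  (∀ i, T (S i) (B i)) ∧ ∀ i j, i < j → ¬ (T (S i) (B j) ∧ T (S j) (B i))

/-- Moves which arrive in the wrong order can be exchanged. -/
def IsUncrossable (T : ℤ → ℤ → Prop) : Prop :=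
  ∀ ⦃s s' a a' : ℤ⦄, s' < s → T s a → T s' a' → a ≤ a' → T s a' ∧ T s' a

/-- The order of the paths is preserved from layer to layer; therefore the determinant produces no
signs. -/
theorem IsUnexchangeable.strictAnti {k : ℕ} {T : ℤ → ℤ → Prop} (hT : IsUncrossable T)
    {S B : Fin k → ℤ} (hS : StrictAnti S) (h : IsUnexchangeable T S B) : StrictAnti B := by
  intro i j hij
  by_contra hle
  exact h.2 i j hij (hT (hS hij) (h.1 i) (h.1 j) (not_lt.1 hle))

/-- If the moves numbered `i < j` could be exchanged, uncrossing them with the move numbered `i + 1`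
would make the moves numbered `i` and `i + 1` exchangeable. So the adjacent pairs seen by row
operations suffice. -/
theorem isUnexchangeable_of_adjacent {k : ℕ} {T : ℤ → ℤ → Prop} (hT : IsUncrossable T)
    {S B : Fin (k + 1) → ℤ} (hS : StrictAnti S) (h : ∀ i, T (S i) (B i))
    (hadj : ∀ i : Fin k, ¬ (T (S i.castSucc) (B i.succ) ∧ T (S i.succ) (B i.castSucc))) :
    IsUnexchangeable T S B := by
  have hB : StrictAnti B := by
    rw [Fin.strictAnti_iff_succ_lt]
    intro i
    by_contra hle
    exact hadj i (hT (hS (Fin.castSucc_lt_succ)) (h _) (h _) (not_lt.1 hle))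
  refine ⟨h, fun i j hij ⟨h1, h2⟩ => ?_⟩
  obtain ⟨i, rfl⟩ : ∃ i' : Fin k, i = i'.castSucc :=
    ⟨i.castPred (Fin.ne_last_of_lt hij), by simp⟩
  rcases eq_or_lt_of_le (Fin.castSucc_lt_iff_succ_le.1 hij) with rfl | hlt
  · exact hadj i ⟨h1, h2⟩
  · exact hadj i ⟨(hT (hS Fin.castSucc_lt_succ) h1 (h _) (hB hlt).le).1,
      (hT (hS hlt) (h _) h2 (hB Fin.castSucc_lt_succ).le).1⟩

variable {K : Type u} [Field K]

open Classical in
/-- Expansion of a determinant whose rows are sums, when consecutive rows either are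
proportional where both are supported or have at most one common term. -/
theorem det_sum_rows {k : ℕ} (T : ℤ → ℤ → Prop) (w : ℤ → ℤ → K) (X : Finset ℤ)
    (y : ℤ → Fin (k + 1) → K) (s : Fin (k + 1) → ℤ)
    (hlink : ∀ i : Fin k,
      (∃ c : K, ∀ b, T (s i.castSucc) b →
        T (s i.succ) b ∧ w (s i.succ) b = c * w (s i.castSucc) b) ∨
      ∀ b b', T (s i.castSucc) b → T (s i.succ) b → T (s i.castSucc) b' → T (s i.succ) b' →
        b = b') :
    (Matrix.of fun i j => ∑ b ∈ X with T (s i) b, w (s i) b * y b j).det =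
      ∑ B ∈ Fintype.piFinset (fun _ : Fin (k + 1) => X) with
        (∀ i, T (s i) (B i)) ∧
          ∀ i : Fin k, ¬ (T (s i.castSucc) (B i.succ) ∧ T (s i.succ) (B i.castSucc)),
        (∏ i, w (s i) (B i)) * (Matrix.of fun i j => y (B i) j).det := by
  -- `L i` marks the pairs of consecutive rows which are proportional where the upper one is
  -- supported.
  let L : Fin k → Prop := fun i => ∃ c : K, ∀ b, T (s i.castSucc) b →
        T (s i.succ) b ∧ w (s i.succ) b = c * w (s i.castSucc) b
  -- The targets which remain in each row after subtracting the multiple `c i` of the previous row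
  -- of the original matrix: for a marked pair the common targets disappear.
  let A : Fin (k + 1) → Finset ℤ := Fin.cases (X.filter fun b => T (s 0) b)
    (fun i => X.filter fun b => T (s i.succ) b ∧ (L i → ¬ T (s i.castSucc) b))
  let c : Fin k → K := fun i => if h : L i then h.choose else 0
  have step1 : (Matrix.of fun i j => ∑ b ∈ X with T (s i) b, w (s i) b * y b j).det =
      (Matrix.of fun i j => ∑ b ∈ A i, w (s i) b * y b j).det := by
    refine Matrix.det_eq_of_forall_row_eq_smul_add_pred c (fun j => rfl) fun i j => ?_
    simp only [Matrix.of_apply]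
    by_cases hL : L i
    · have hc := hL.choose_spec
      have hci : c i = hL.choose := by simp [c, hL]
      rw [← hci] at hc
      rw [Finset.mul_sum]
      have e1 : ∑ b ∈ X with T (s i.castSucc) b, c i * (w (s i.castSucc) b * y b j) =
          ∑ b ∈ X.filter (fun b => T (s i.succ) b) with T (s i.castSucc) b,
            w (s i.succ) b * y b j := by
        rw [Finset.filter_filter]
        refine Finset.sum_congr ?_ ?_
        · ext b
          simp only [Finset.mem_filter]
          constructor
          · rintro ⟨h1, h2⟩
            exact ⟨h1, (hc b h2).1, h2⟩
          · rintro ⟨h1, _, h2⟩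
            exact ⟨h1, h2⟩
        · intro b hb
          simp only [Finset.mem_filter] at hb
          rw [(hc b hb.2.2).2]
          ring
      have e2 : A i.succ = (X.filter (fun b => T (s i.succ) b)).filter
          (fun b => ¬ T (s i.castSucc) b) := by
        simp only [A, Fin.cases_succ, Finset.filter_filter, hL, true_implies]
      rw [e1, e2, add_comm, Finset.sum_filter_add_sum_filter_not]
    · have hci : c i = 0 := by simp [c, hL]
      simp only [hci, zero_mul, add_zero, A, Fin.cases_succ, hL, false_implies, and_true]
  have step2 : (Matrix.of fun i j => ∑ b ∈ A i, w (s i) b * y b j).det =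
      ∑ B ∈ Fintype.piFinset A, (∏ i, w (s i) (B i)) * (Matrix.of fun i j => y (B i) j).det := by
    -- The reduced determinant is expanded by multilinearity in its rows.
    have := (Matrix.detRowAlternating (n := Fin (k + 1)) (R := K)).toMultilinearMap.map_sum_finset
      (fun i b => w (s i) b • y b) A
    have e : (Matrix.of fun i j => ∑ b ∈ A i, w (s i) b * y b j) =
        fun i => ∑ b ∈ A i, w (s i) b • y b := by
      ext i j
      simp [Finset.sum_apply]
    rw [e]
    refine this.trans (Finset.sum_congr rfl fun B _ => ?_)
    exact (Matrix.detRowAlternating (n := Fin (k + 1)) (R := K)).toMultilinearMap.map_smul_univ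
      (fun i => w (s i) (B i)) (fun i => y (B i))
  rw [step1, step2]
  symm
  refine Finset.sum_subset_zero_on_sdiff ?_ ?_ fun _ _ => rfl
  · intro B hB
    simp only [Finset.mem_filter, Fintype.mem_piFinset] at hB ⊢
    obtain ⟨h1, h2, h3⟩ := hB
    intro i
    refine Fin.cases ?_ (fun i => ?_) i
    · simp [A, h1, h2]
    · simp only [A, Fin.cases_succ, Finset.mem_filter, h1, h2, true_and]
      intro ⟨c, hL⟩ hT
      exact h3 i ⟨hT, (hL _ (h2 _)).1⟩
  · intro B hB
    simp only [Finset.mem_sdiff, Finset.mem_filter, Fintype.mem_piFinset, not_and, not_forall,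
      not_not] at hB
    obtain ⟨h1, h2⟩ := hB
    have hX : ∀ i, B i ∈ X ∧ T (s i) (B i) := by
      intro i
      have := h1 i
      revert this
      refine Fin.cases ?_ (fun i => ?_) i
      · simp [A]
      · simp only [A, Fin.cases_succ, Finset.mem_filter]
        tauto
    obtain ⟨i, g1, g2⟩ := h2 (fun i => (hX i).1) (fun i => (hX i).2)
    -- A surviving choice with an exchangeable adjacent pair can only come from an unmarked pair.
    -- Both targets are then common to the two rows, so they coincide and the minor has two equal
    -- rows.
    have hL : ¬ L i := by
      intro hL
      have := h1 i.succ
      simp only [A, Fin.cases_succ, Finset.mem_filter] at this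
      exact this.2.2 hL g1
    have heq := (hlink i).resolve_left hL _ _ (hX i.castSucc).2 g2 g1 (hX i.succ).2
    rw [Matrix.det_zero_of_row_eq (i := i.castSucc) (j := i.succ) Fin.castSucc_lt_succ.ne, mul_zero]
    ext j
    simp [heq]

open Classical in
/-- Expansion of the determinant of a layer of moves in which the supports grow downwards. -/
theorem det_layer_down {k : ℕ} {T : ℤ → ℤ → Prop} (hT : IsUncrossable T) (w : ℤ → ℤ → K)
    (X : Finset ℤ) (y : ℤ → Fin (k + 1) → K) {s : Fin (k + 1) → ℤ} (hs : StrictAnti s)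
    (hlink : ∀ a a', a' < a → (∃ c : K, ∀ b, T a b → T a' b ∧ w a' b = c * w a b) ∨
      ∀ b b', T a b → T a' b → T a b' → T a' b' → b = b') :
    (Matrix.of fun i j => ∑ b ∈ X with T (s i) b, w (s i) b * y b j).det =
      ∑ B ∈ Fintype.piFinset (fun _ : Fin (k + 1) => X) with IsUnexchangeable T s B,
        (∏ i, w (s i) (B i)) * (Matrix.of fun i j => y (B i) j).det := by
  rw [det_sum_rows T w X y s fun i => hlink _ _ (hs Fin.castSucc_lt_succ)]
  refine Finset.sum_congr ?_ fun _ _ => rfl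
  refine Finset.filter_congr fun B _ => ⟨fun h => isUnexchangeable_of_adjacent hT hs h.1 h.2,
    fun h => ⟨h.1, fun i => h.2 _ _ Fin.castSucc_lt_succ⟩⟩

open Classical in
/-- Expansion of the determinant of a layer of moves in which the supports grow upwards. -/
theorem det_layer_up {k : ℕ} {T : ℤ → ℤ → Prop} (hT : IsUncrossable T) (w : ℤ → ℤ → K)
    (X : Finset ℤ) (y : ℤ → Fin (k + 1) → K) {s : Fin (k + 1) → ℤ} (hs : StrictAnti s)
    (hlink : ∀ a a', a' < a → (∃ c : K, ∀ b, T a' b → T a b ∧ w a b = c * w a' b) ∨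
      ∀ b b', T a b → T a' b → T a b' → T a' b' → b = b') :
    (Matrix.of fun i j => ∑ b ∈ X with T (s i) b, w (s i) b * y b j).det =
      ∑ B ∈ Fintype.piFinset (fun _ : Fin (k + 1) => X) with IsUnexchangeable T s B,
        (∏ i, w (s i) (B i)) * (Matrix.of fun i j => y (B i) j).det := by
  -- Reversing the order of rows and columns keeps the determinant and turns supports growing
  -- upwards into supports growing downwards.
  have h := det_sum_rows T w X (fun b j => y b j.rev) (fun i => s i.rev) (fun i => by
    rcases hlink (s i.succ.rev) (s i.castSucc.rev)
      (hs (Fin.rev_lt_rev.2 Fin.castSucc_lt_succ)) with h | h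
    · exact Or.inl h
    · exact Or.inr fun b b' h1 h2 h3 h4 => h b b' h2 h1 h4 h3)
  have e1 : (Matrix.of fun i j => ∑ b ∈ X with T (s i) b, w (s i) b * y b j).det =
      (Matrix.of fun i j : Fin (k + 1) => ∑ b ∈ X with T (s i.rev) b,
        w (s i.rev) b * y b j.rev).det := by
    rw [← Matrix.det_submatrix_equiv_self Fin.revPerm]
    rfl
  rw [e1, h]
  symm
  refine Finset.sum_bij' (fun B _ i => B i.rev) (fun B _ i => B i.rev) ?_ ?_ ?_ ?_ ?_
  · intro B hB
    simp only [Finset.mem_filter, Fintype.mem_piFinset] at hB ⊢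
    exact ⟨fun i => hB.1 _, fun i => hB.2.1 _, fun i ⟨g1, g2⟩ =>
      hB.2.2 i.succ.rev i.castSucc.rev (Fin.rev_lt_rev.2 Fin.castSucc_lt_succ) ⟨g2, g1⟩⟩
  · intro B hB
    simp only [Finset.mem_filter, Fintype.mem_piFinset] at hB ⊢
    refine ⟨fun i => hB.1 _, isUnexchangeable_of_adjacent hT hs
      (fun i => by simpa using hB.2.1 i.rev) fun i ⟨g1, g2⟩ => ?_⟩
    refine hB.2.2 i.rev ⟨?_, ?_⟩
    · simpa [Fin.rev_castSucc, Fin.rev_succ] using g2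
    · simpa [Fin.rev_castSucc, Fin.rev_succ] using g1
  · intro B _; simp
  · intro B _; simp
  · intro B _
    congr 1
    · rw [← Equiv.prod_comp Fin.revPerm]; rfl
    · rw [← Matrix.det_submatrix_equiv_self Fin.revPerm]; rfl

end Layers

/-! ## Decomposition of a path along its first column -/

section Decomposition

variable {r : ℕ} {m : ℕ → ℤ}

/-- The part of the column `v` between the heights `s` and `a`. -/
def columnSegment (v s a : ℕ) : List LatticePoint := (List.range' s (a + 1 - s)).map (columnPoint v)

theorem columnSegment_cons {v s a : ℕ} (h : s ≤ a) :
    columnSegment v s a = columnPoint v s :: columnSegment v (s + 1) a := by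
  unfold columnSegment
  rw [show a + 1 - s = (a + 1 - (s + 1)) + 1 by omega, List.range'_succ, List.map_cons]

theorem columnSegment_of_lt {v s a : ℕ} (h : a < s) : columnSegment v s a = [] := by
  unfold columnSegment
  rw [show a + 1 - s = 0 by omega]
  simp

theorem columnSegment_self (v s : ℕ) : columnSegment v s s = [columnPoint v s] := by
  rw [columnSegment_cons le_rfl, columnSegment_of_lt (by omega)]

theorem mem_columnSegment {v s a : ℕ} {P : LatticePoint} :
    P ∈ columnSegment v s a ↔ ∃ y, s ≤ y ∧ y ≤ a ∧ P = columnPoint v y := by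
  simp only [columnSegment, List.mem_map, List.mem_range'_1]
  constructor
  · rintro ⟨y, h, rfl⟩
    exact ⟨y, h.1, by omega, rfl⟩
  · rintro ⟨y, h1, h2, rfl⟩
    exact ⟨y, ⟨h1, by omega⟩, rfl⟩

theorem columnSegment_inj {v s a a' : ℕ} (h : s ≤ a) (h' : s ≤ a')
    (e : columnSegment v s a = columnSegment v s a') : a = a' := by
  have := congrArg List.length e
  simp only [columnSegment, List.length_map, List.length_range'] at this
  omega

theorem IsLatticePath.exists_cons {s e : LatticePoint} {L : List LatticePoint}
    (h : IsLatticePath r m s e L) : ∃ l, L = s :: l := by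
  obtain ⟨h1, -, -⟩ := h
  cases L with
  | nil => simp at h1
  | cons a l => simp at h1; exact ⟨l, by rw [h1]⟩

theorem isLatticePath_cons_cons {s e P Q : LatticePoint} {l : List LatticePoint} :
    IsLatticePath r m s e (P :: Q :: l) ↔
      P = s ∧ IsLatticeStep r m P Q ∧ IsLatticePath r m Q e (Q :: l) := by
  simp only [IsLatticePath, List.head?_cons, Option.some.injEq, List.getLast?_cons_cons,
    List.isChain_cons_cons, true_and]
  tauto

theorem isLatticePath_singleton {s e P : LatticePoint} :
    IsLatticePath r m s e [P] ↔ P = s ∧ P = e := by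
  simp [IsLatticePath]

theorem pathSteps_cons_cons (P Q : LatticePoint) (l : List LatticePoint) :
    pathSteps (P :: Q :: l) = (P, Q) :: pathSteps (Q :: l) := rfl

theorem pathWeight_cons_cons {K : Type u} [Field K] (R : ℕ → ℤ → K) (P Q : LatticePoint)
    (l : List LatticePoint) :
    pathWeight r m R (P :: Q :: l) = stepWeight r m R P Q * pathWeight r m R (Q :: l) := by
  simp [pathWeight, pathSteps_cons_cons]

theorem pathWeight_nil {K : Type u} [Field K] (R : ℕ → ℤ → K) : pathWeight r m R [] = 1 := rfl

theorem pathWeight_singleton {K : Type u} [Field K] (R : ℕ → ℤ → K) (P : LatticePoint) :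
    pathWeight r m R [P] = 1 := rfl

theorem IsLatticePath.columns (hr : 1 ≤ r) {v s e : ℕ} {L : List LatticePoint}
    (h : IsLatticePath r m (columnPoint v s) (columnPoint e 0) L) :
    v ≤ e ∧ (∀ P ∈ L, ∃ w y, v ≤ w ∧ P = columnPoint w y) ∧
      ∀ P Q, (P, Q) ∈ pathSteps L → P ∈ L ∧ Q ∈ L ∧ IsLatticeStep r m P Q := by
  obtain ⟨l, rfl⟩ := h.exists_cons
  induction l generalizing v s with
  | nil =>
    obtain ⟨-, h⟩ := isLatticePath_singleton.1 h
    rw [columnPoint_inj] at h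
    refine ⟨h.1.le, ?_, by simp [pathSteps]⟩
    simp only [List.mem_singleton, forall_eq]
    exact ⟨v, s, le_rfl, rfl⟩
  | cons Q l ih =>
    rw [isLatticePath_cons_cons] at h
    obtain ⟨-, h1, h2⟩ := h
    have h1' := h1
    rw [isLatticeStep_columnPoint hr] at h1
    have key : ∃ w y, v ≤ w ∧ Q = columnPoint w y := by
      rcases h1 with ⟨rfl, -⟩ | ⟨b, -, rfl⟩
      · exact ⟨v, _, le_rfl, rfl⟩
      · exact ⟨v + 1, _, by omega, rfl⟩
    obtain ⟨w, y, hw, rfl⟩ := key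
    obtain ⟨i1, i2, i3⟩ := ih h2
    refine ⟨hw.trans i1, ?_, ?_⟩
    · intro P hP
      rcases List.mem_cons.1 hP with rfl | hP
      · exact ⟨v, s, le_rfl, rfl⟩
      · obtain ⟨w', y', h3, h4⟩ := i2 P hP
        exact ⟨w', y', hw.trans h3, h4⟩
    · intro P Q hPQ
      rw [pathSteps_cons_cons] at hPQ
      rcases List.mem_cons.1 hPQ with heq | hPQ
      · rw [Prod.mk.injEq] at heq
        obtain ⟨rfl, rfl⟩ := heq
        exact ⟨by simp, by simp, h1'⟩
      · obtain ⟨j1, j2, j3⟩ := i3 P Q hPQ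
        exact ⟨List.mem_cons_of_mem _ j1, List.mem_cons_of_mem _ j2, j3⟩

theorem IsLatticePath.decompose (hr : 1 ≤ r) {v s e : ℕ} {L : List LatticePoint}
    (h : IsLatticePath r m (columnPoint v s) (columnPoint e 0) L) :
    ∃ a, s ≤ a ∧ ((a = 0 ∧ v = e ∧ L = columnSegment v s a) ∨
      ∃ b L', IsHop r m a b ∧ v + 1 ≤ e ∧
        IsLatticePath r m (columnPoint (v + 1) b) (columnPoint e 0) L' ∧
        L = columnSegment v s a ++ L') := by
  obtain ⟨l, rfl⟩ := h.exists_cons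
  induction l generalizing s with
  | nil =>
    obtain ⟨-, h⟩ := isLatticePath_singleton.1 h
    rw [columnPoint_inj] at h
    obtain ⟨rfl, rfl⟩ := h
    exact ⟨0, le_rfl, Or.inl ⟨rfl, rfl, (columnSegment_self v 0).symm⟩⟩
  | cons Q l ih =>
    rw [isLatticePath_cons_cons] at h
    obtain ⟨-, h1, h2⟩ := h
    rw [isLatticeStep_columnPoint hr] at h1
    rcases h1 with ⟨rfl, -⟩ | ⟨b, hb, rfl⟩
    · obtain ⟨a, ha, ⟨rfl, -, -⟩ | ⟨b, L', g1, g2, g3, g4⟩⟩ := ih h2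
      · omega
      · refine ⟨a, by omega, Or.inr ⟨b, L', g1, g2, g3, ?_⟩⟩
        rw [columnSegment_cons (by omega), List.cons_append, g4]
    · refine ⟨s, le_rfl, Or.inr ⟨b, _, hb, (h2.columns hr).1, h2, ?_⟩⟩
      rw [columnSegment_self]; rfl

/-- A column segment followed by a hop and a path. -/
theorem isLatticePath_append (hr : 1 ≤ r) {v s a b : ℕ} {e : LatticePoint} {L' : List LatticePoint}
    (hsa : s ≤ a) (hb : IsHop r m a b) (h : IsLatticePath r m (columnPoint (v + 1) b) e L') :
    IsLatticePath r m (columnPoint v s) e (columnSegment v s a ++ L') ∧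
    (∀ P Q, (P, Q) ∈ pathSteps (columnSegment v s a ++ L') ↔
      (∃ y, s ≤ y ∧ y < a ∧ P = columnPoint v y ∧ Q = columnPoint v (y + 1)) ∨
      (P = columnPoint v a ∧ Q = columnPoint (v + 1) b) ∨ (P, Q) ∈ pathSteps L') ∧
    ∀ (K : Type u) [Field K] (R : ℕ → ℤ → K), pathWeight r m R (columnSegment v s a ++ L') =
      hopWeight r m R a b * pathWeight r m R L' := by
  have ha := hb.le_top hr
  obtain ⟨l, rfl⟩ := h.exists_cons
  obtain ⟨d, rfl⟩ : ∃ d, a = s + d := ⟨a - s, by omega⟩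
  induction d generalizing s with
  | zero =>
    simp only [Nat.add_zero] at *
    rw [columnSegment_self, List.singleton_append]
    refine ⟨isLatticePath_cons_cons.2 ⟨rfl, (isLatticeStep_columnPoint hr).2
      (Or.inr ⟨b, hb, rfl⟩), h⟩, ?_, ?_⟩
    · intro P Q
      rw [pathSteps_cons_cons, List.mem_cons, Prod.mk.injEq]
      constructor
      · exact fun h => Or.inr h
      · rintro (⟨y, h1, h2, -⟩ | h)
        · omega
        · exact h
    · intro K _ R
      rw [pathWeight_cons_cons, stepWeight_hop]
  | succ d ih =>
    rw [show s + (d + 1) = s + 1 + d by ring] at *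
    obtain ⟨i1, i2, i3⟩ := ih (s := s + 1) (by omega) hb ha
    have e1 : columnSegment v s (s + 1 + d) ++ columnPoint (v + 1) b :: l =
        columnPoint v s :: columnPoint v (s + 1) :: (columnSegment v (s + 1 + 1) (s + 1 + d) ++
          columnPoint (v + 1) b :: l) := by
      rw [columnSegment_cons (show s ≤ s + 1 + d by omega),
        columnSegment_cons (show s + 1 ≤ s + 1 + d by omega)]
      rfl
    have e2 : columnSegment v (s + 1) (s + 1 + d) ++ columnPoint (v + 1) b :: l =
        columnPoint v (s + 1) :: (columnSegment v (s + 1 + 1) (s + 1 + d) ++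
          columnPoint (v + 1) b :: l) := by
      rw [columnSegment_cons (show s + 1 ≤ s + 1 + d by omega)]
      rfl
    rw [e2] at i1 i2 i3
    rw [e1]
    refine ⟨isLatticePath_cons_cons.2 ⟨rfl, (isLatticeStep_columnPoint hr).2
      (Or.inl ⟨rfl, by omega⟩), i1⟩, ?_, ?_⟩
    · intro P Q
      rw [pathSteps_cons_cons, List.mem_cons, i2, Prod.mk.injEq]
      constructor
      · rintro (⟨rfl, rfl⟩ | ⟨y, h1, h2, h3⟩ | h)
        · exact Or.inl ⟨s, le_rfl, by omega, rfl, rfl⟩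
        · exact Or.inl ⟨y, by omega, h2, h3⟩
        · exact Or.inr h
      · rintro (⟨y, h1, h2, h3, h4⟩ | h)
        · rcases eq_or_lt_of_le h1 with rfl | hlt
          · exact Or.inl ⟨h3, h4⟩
          · exact Or.inr (Or.inl ⟨y, by omega, h2, h3, h4⟩)
        · exact Or.inr (Or.inr h)
    · intro K _ R
      rw [pathWeight_cons_cons, stepWeight_up R hr (by omega), one_mul, i3]

end Decomposition

/-! ## Lanes

A family of paths is cut into columns. In column `v` the state of a path is its height, or a
negative number: the path numbered `i` which has not started yet is in the lane `-(i + 1)`, and so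
is the path which has arrived at the end point numbered `i`. -/

section Lanes

variable {r : ℕ} {m : ℕ → ℤ} {α n : ℕ}

/-- The lane `s` is not left in column `v`. -/
def IsLane (α n v : ℕ) (s : ℤ) : Prop :=
  -- In the first alternative the path starts in a later column. In the second it arrived in an
  -- earlier one: the end point numbered `j` lies in column `n + α - 1 - j`.
  s < 0 ∧ -(α : ℤ) ≤ s ∧ (s < -((v : ℤ) + 1) ∨ s < -((n : ℤ) + α - v))

/-- The part of a path in column `v` may lead from the state `s` to the state `a`. -/
def IsRise (r : ℕ) (m : ℕ → ℤ) (α n v : ℕ) (s a : ℤ) : Prop :=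
  (0 ≤ s ∧ s ≤ a ∧ a ≤ (gammaLabel m r + 2 : ℕ)) ∨
  (s = -((v : ℤ) + 1) ∧ v < α ∧ 0 ≤ a ∧ a ≤ (gammaLabel m r + 2 : ℕ)) ∨
  (s = a ∧ IsLane α n v s)

/-- A path may change from the state `a` to the state `b` between the columns `v` and `v + 1`. -/
def IsPassage (r : ℕ) (m : ℕ → ℤ) (α n v : ℕ) (a b : ℤ) : Prop :=
  (0 ≤ a ∧ 0 ≤ b ∧ IsHop r m a.toNat b.toNat) ∨
  (a = 0 ∧ n ≤ v ∧ v < n + α ∧ b = -((n : ℤ) + α - v)) ∨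
  (a = b ∧ IsLane α n v a)

/-- The weight of a passage. -/
noncomputable def passageWeight {K : Type u} [Field K] (r : ℕ) (m : ℕ → ℤ) (R : ℕ → ℤ → K)
    (a b : ℤ) : K :=
  if 0 ≤ a ∧ 0 ≤ b then hopWeight r m R a.toNat b.toNat else 1

/-- Starts occupy the columns `0, …, α - 1` and arrivals the columns `n, …, n + α - 1`. With `α ≤ n
+ 1`, waiting paths and arrived paths never occupy lanes in the same column, so the lanes preserve
the order. -/
theorem isUncrossable_isRise (hα : α ≤ n + 1) (v : ℕ) : IsUncrossable (IsRise r m α n v) := by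
  intro s s' a a' hs h1 h2 ha
  unfold IsRise IsLane at *
  omega

theorem isUncrossable_isPassage (hr : 1 ≤ r) (hα : α ≤ n + 1) (v : ℕ) :
    IsUncrossable (IsPassage r m α n v) := by
  intro s s' a a' hs h1 h2 ha
  rcases h1 with ⟨h1, h1', g⟩ | h1 | h1
  · rcases h2 with ⟨h2, h2', g'⟩ | h2 | h2
    · obtain ⟨i1, i2⟩ := IsHop.uncross hr (a := s.toNat) (a' := s'.toNat) (by omega) g g'
        (by omega)
      exact ⟨Or.inl ⟨h1, h2', i1⟩, Or.inl ⟨h2, h1', i2⟩⟩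
    · omega
    · unfold IsLane at h2; omega
  · unfold IsPassage IsLane at *
    omega
  · unfold IsPassage IsLane at *
    omega

/-- Among paths which have started, a lower state can rise to every height a higher one can, with
the same weight `1`. The supports grow downwards, as `det_layer_down` requires; all other pairs have
at most one common target. -/
theorem isRise_link {K : Type u} [Field K] (v : ℕ) (a a' : ℤ) (haa : a' < a) :
    (∃ c : K, ∀ b, IsRise r m α n v a b → IsRise r m α n v a' b ∧ (1 : K) = c * 1) ∨
      ∀ b b', IsRise r m α n v a b → IsRise r m α n v a' b → IsRise r m α n v a b' →
        IsRise r m α n v a' b' → b = b' := by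
  by_cases h : 0 ≤ a ∧ (0 ≤ a' ∨ (a' = -((v : ℤ) + 1) ∧ v < α))
  · left
    refine ⟨1, fun b hb => ⟨?_, by ring⟩⟩
    unfold IsRise IsLane at *
    omega
  · right
    intro b b' h1 h2 h3 h4
    unfold IsRise IsLane at *
    omega

/-- Here the supports grow upwards: by `IsLinked.proportional`, the higher of two linked heights has
all the targets of the lower one with proportional weights. Unlinked states have at most one common
target. -/
theorem isPassage_link {K : Type u} [Field K] {R : ℕ → ℤ → K} (hr : 1 ≤ r)
    (hR : IsQSystemSolution r R) (v : ℕ) (a a' : ℤ) (haa : a' < a) :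
    (∃ c : K, ∀ b, IsPassage r m α n v a' b → IsPassage r m α n v a b ∧
        passageWeight r m R a b = c * passageWeight r m R a' b) ∨
      ∀ b b', IsPassage r m α n v a b → IsPassage r m α n v a' b → IsPassage r m α n v a b' →
        IsPassage r m α n v a' b' → b = b' := by
  by_cases h : 0 ≤ a' ∧ IsLinked r m a.toNat a'.toNat
  · obtain ⟨h0, hl⟩ := h
    by_cases h0' : a' = 0
    · right
      intro b b' h1 h2 h3 h4
      subst h0'
      have := not_isHop_zero (m := m) hr
      unfold IsPassage IsLane at h2 h4
      simp only [Int.toNat_zero, this, and_false, false_or] at h2 h4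
      omega
    · left
      obtain ⟨c, hc⟩ := hl.proportional hr hR
      refine ⟨c, fun b hb => ?_⟩
      obtain ⟨-, hb0, hb⟩ : 0 ≤ a' ∧ 0 ≤ b ∧ IsHop r m a'.toNat b.toNat := by
        rcases hb with hb | hb | hb
        · exact hb
        · omega
        · unfold IsLane at hb; omega
      refine ⟨Or.inl ⟨by omega, hb0, (hc _ hb).1⟩, ?_⟩
      rw [passageWeight, passageWeight, if_pos ⟨by omega, hb0⟩, if_pos ⟨h0, hb0⟩]
      exact (hc _ hb).2
  · right
    intro b b' h1 h2 h3 h4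
    by_cases h0 : 0 ≤ a'
    · have key : ∀ b, IsPassage r m α n v a b → 0 ≤ b ∧ IsHop r m a.toNat b.toNat := by
        intro b hb
        rcases hb with hb | hb | hb
        · exact hb.2
        · omega
        · unfold IsLane at hb; omega
      have key' : ∀ b, 0 ≤ b → IsPassage r m α n v a' b → IsHop r m a'.toNat b.toNat := by
        intro b hb0 hb
        rcases hb with hb | hb | hb
        · exact hb.2.2
        · omega
        · unfold IsLane at hb; omega
      obtain ⟨p1, q1⟩ := key b h1
      obtain ⟨p3, q3⟩ := key b' h3
      have q2 := key' b p1 h2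
      have q4 := key' b' p3 h4
      by_contra hne
      apply h
      refine ⟨h0, ?_⟩
      rcases lt_or_gt_of_ne hne with hlt | hgt
      · exact isLinked_of_common hr (by omega) q1 q4 (by omega)
      · exact isLinked_of_common hr (by omega) q3 q2 (by omega)
    · unfold IsPassage IsLane at h2 h4
      omega

end Lanes

/-! ### Tails of paths from a given column on -/

section Tails

variable {r : ℕ} {m : ℕ → ℤ} {α n : ℕ}

/-- `L` is the part from column `v` on of a path in state `s` with end point numbered `j`. -/
def IsTail (r : ℕ) (m : ℕ → ℤ) (α n v : ℕ) (s : ℤ) (j : ℕ) (L : List LatticePoint) : Prop :=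
  (0 ≤ s ∧ IsLatticePath r m (columnPoint v s.toNat) (columnPoint (n + α - 1 - j) 0) L) ∨
  (s < 0 ∧ (v : ℤ) < -s ∧
    IsLatticePath r m (columnPoint (-s - 1).toNat 0) (columnPoint (n + α - 1 - j) 0) L) ∨
  (s = -((j : ℤ) + 1) ∧ n + α - 1 - j < v ∧ L = [])

/-- The points in column `v` of a path which rises from the state `s` to the state `a`. -/
def riseSegment (v : ℕ) (s a : ℤ) : List LatticePoint :=
  if a < 0 then [] else columnSegment v s.toNat a.toNat

/-- `L` consists of the part in column `v` given by the states `s` and `a`, and of the tail `L'`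
in state `b`. -/
structure IsLayered (r : ℕ) (m : ℕ → ℤ) (α n v : ℕ) (s a b : ℤ) (L' L : List LatticePoint) :
    Prop where
  rise : IsRise r m α n v s a
  passage : IsPassage r m α n v a b
  mem : ∀ P, P ∈ L ↔
    (0 ≤ a ∧ ∃ y, s.toNat ≤ y ∧ y ≤ a.toNat ∧ P = columnPoint v y) ∨ P ∈ L'
  steps : ∀ P Q, (P, Q) ∈ pathSteps L ↔
    (0 ≤ a ∧ ∃ y, s.toNat ≤ y ∧ y < a.toNat ∧ P = columnPoint v y ∧ Q = columnPoint v (y + 1)) ∨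
    (0 ≤ a ∧ 0 ≤ b ∧ P = columnPoint v a.toNat ∧ Q = columnPoint (v + 1) b.toNat) ∨
    (P, Q) ∈ pathSteps L'
  columns : ∀ P ∈ L', ∃ w y, v + 1 ≤ w ∧ P = columnPoint w y
  tail_steps : ∀ P Q, (P, Q) ∈ pathSteps L' → P ∈ L' ∧ Q ∈ L' ∧ IsLatticeStep r m P Q
  head : 0 ≤ b → columnPoint (v + 1) b.toNat ∈ L'

theorem IsTail.columns (hr : 1 ≤ r) {v j : ℕ} {s : ℤ} {L : List LatticePoint}
    (h : IsTail r m α n v s j L) :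
    (∀ P ∈ L, ∃ w y, v ≤ w ∧ P = columnPoint w y) ∧
      ∀ P Q, (P, Q) ∈ pathSteps L → P ∈ L ∧ Q ∈ L ∧ IsLatticeStep r m P Q := by
  rcases h with ⟨_, h⟩ | ⟨_, h1, h⟩ | ⟨_, _, rfl⟩
  · exact (h.columns hr).2
  · obtain ⟨-, h2, h3⟩ := h.columns hr
    refine ⟨fun P hP => ?_, h3⟩
    obtain ⟨w, y, hw, e⟩ := h2 P hP
    exact ⟨w, y, by omega, e⟩
  · simp [pathSteps]

/-- The three behaviours in a column are staying in a lane, rising and hopping on, and rising by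
nothing in order to arrive. A lane contributes no points and the weight `1`. -/
theorem IsTail.compose (hr : 1 ≤ r) (hα : α ≤ n + 1) {v j : ℕ} {s a b : ℤ} {L' : List LatticePoint}
    (hv : v < n + α) (hj : j < α)
    (h1 : IsRise r m α n v s a) (h2 : IsPassage r m α n v a b) (h : IsTail r m α n (v + 1) b j L') :
    IsTail r m α n v s j (riseSegment v s a ++ L') ∧
      IsLayered r m α n v s a b L' (riseSegment v s a ++ L') ∧
      ∀ (K : Type u) [Field K] (R : ℕ → ℤ → K), pathWeight r m R (riseSegment v s a ++ L') =
        passageWeight r m R a b * pathWeight r m R L' := by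
  have hc := h.columns hr
  by_cases ha : a < 0
  · have hb : a = b ∧ IsLane α n v a := by
      rcases h2 with h2 | h2 | h2
      · omega
      · omega
      · exact h2
    obtain ⟨rfl, hb⟩ := hb
    obtain rfl : s = a := by
      rcases h1 with h1 | h1 | h1
      · omega
      · omega
      · exact h1.1
    simp only [riseSegment, if_pos ha, List.nil_append]
    refine ⟨?_, ⟨h1, h2, ?_, ?_, hc.1, hc.2, ?_⟩, ?_⟩
    · unfold IsLane at hb
      rcases h with ⟨h, _⟩ | ⟨_, h3, h⟩ | ⟨h3, h4, rfl⟩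
      · omega
      · exact Or.inr (Or.inl ⟨ha, by push_cast at h3; omega, h⟩)
      · exact Or.inr (Or.inr ⟨h3, by omega, rfl⟩)
    · intro P; simp only [not_le.2 ha, false_and, false_or]
    · intro P Q; simp only [not_le.2 ha, false_and, false_or]
    · intro h; omega
    · intro K _ R
      rw [passageWeight, if_neg (by omega), one_mul]
  · have hs : s.toNat ≤ a.toNat ∧ (0 ≤ s ∨ s = -((v : ℤ) + 1)) := by
      unfold IsRise IsLane at h1; omega
    simp only [riseSegment, if_neg ha]
    by_cases hb : 0 ≤ b
    · have hh : IsHop r m a.toNat b.toNat := by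
        rcases h2 with h2 | h2 | h2
        · exact h2.2.2
        · omega
        · unfold IsLane at h2; omega
      have hL : IsLatticePath r m (columnPoint (v + 1) b.toNat) (columnPoint (n + α - 1 - j) 0)
          L' := by
        rcases h with h | h | h
        · exact h.2
        · omega
        · omega
      obtain ⟨i1, i2, i3⟩ := isLatticePath_append.{u} hr hs.1 hh hL
      refine ⟨?_, ⟨h1, h2, ?_, ?_, hc.1, hc.2, ?_⟩, ?_⟩
      · rcases hs.2 with h0 | h0
        · exact Or.inl ⟨h0, i1⟩
        · refine Or.inr (Or.inl ⟨by omega, by omega, ?_⟩)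
          simpa only [show (-s - 1).toNat = v by omega, show s.toNat = 0 by omega] using i1
      · intro P
        rw [List.mem_append, mem_columnSegment]
        simp only [not_lt.1 ha, true_and]
      · intro P Q
        rw [i2]
        simp only [not_lt.1 ha, hb, true_and]
      · intro _
        obtain ⟨l, rfl⟩ := hL.exists_cons
        simp
      · intro K _ R
        rw [i3, passageWeight, if_pos ⟨not_lt.1 ha, hb⟩]
    · have h2' : a = 0 ∧ n ≤ v ∧ v < n + α ∧ b = -((n : ℤ) + α - v) := by
        rcases h2 with h2 | h2 | h2
        · omega
        · exact h2
        · unfold IsLane at h2; omega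
      obtain ⟨rfl, g1, g2, g3⟩ := h2'
      have hL : b = -((j : ℤ) + 1) ∧ L' = [] := by
        rcases h with h | h | h
        · omega
        · omega
        · exact ⟨h.1, h.2.2⟩
      obtain ⟨g4, rfl⟩ := hL
      have hs0 : s.toNat = 0 := by simpa using hs.1
      have hp : IsLatticePath r m (columnPoint v 0) (columnPoint (n + α - 1 - j) 0)
          [columnPoint v 0] :=
        isLatticePath_singleton.2 ⟨rfl, columnPoint_inj.2 ⟨by omega, rfl⟩⟩
      simp only [hs0, Int.toNat_zero, columnSegment_self, List.append_nil]
      refine ⟨?_, ⟨h1, h2, ?_, ?_, hc.1, hc.2, ?_⟩, ?_⟩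
      · rcases hs.2 with h0 | h0
        · refine Or.inl ⟨h0, ?_⟩
          rwa [hs0]
        · refine Or.inr (Or.inl ⟨by omega, by omega, ?_⟩)
          rwa [show (-s - 1).toNat = v by omega]
      · intro P
        simp only [List.mem_singleton, hs0, le_refl, Int.toNat_zero, true_and, List.not_mem_nil,
          or_false]
        constructor
        · rintro rfl; exact ⟨0, le_rfl, le_rfl, rfl⟩
        · rintro ⟨y, -, hy, rfl⟩
          rw [Nat.le_zero.1 hy]
      · intro P Q
        simp [pathSteps, hb]
      · intro h; omega
      · intro K _ R
        rw [pathWeight_singleton, pathWeight_nil, passageWeight, if_neg (by omega), one_mul]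

theorem IsTail.decompose (hr : 1 ≤ r) (hα : α ≤ n + 1) {v j : ℕ} {s : ℤ} {L : List LatticePoint}
    (hv : v < n + α) (hj : j < α) (hs : -(α : ℤ) ≤ s)
    (hs' : s ≤ (gammaLabel m r + 2 : ℕ)) (h : IsTail r m α n v s j L) :
    ∃ a b L', IsRise r m α n v s a ∧ IsPassage r m α n v a b ∧ IsTail r m α n (v + 1) b j L' ∧
      L = riseSegment v s a ++ L' := by
  have key : ∀ h : ℕ, (∀ a : ℕ, h ≤ a → a ≤ gammaLabel m r + 2 → IsRise r m α n v s a) →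
      s.toNat = h → h ≤ gammaLabel m r + 2 →
      IsLatticePath r m (columnPoint v h) (columnPoint (n + α - 1 - j) 0) L →
      ∃ a b L', IsRise r m α n v s a ∧ IsPassage r m α n v a b ∧ IsTail r m α n (v + 1) b j L' ∧
        L = riseSegment v s a ++ L' := by
    intro h h1 h2 h3 hL
    obtain ⟨a, ha, ⟨rfl, rfl, rfl⟩ | ⟨b, L', g1, g2, g3, rfl⟩⟩ := hL.decompose hr
    · refine ⟨0, -((j : ℤ) + 1), [], h1 0 ha (by omega), Or.inr (Or.inl ⟨rfl, by omega, hv,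
        by omega⟩), Or.inr (Or.inr ⟨rfl, by omega, rfl⟩), ?_⟩
      simp [riseSegment, h2]
    · refine ⟨a, b, L', h1 a ha (g1.le_top hr), Or.inl ⟨by omega, by omega, by simpa using g1⟩,
        Or.inl ⟨by omega, by simpa using g3⟩, ?_⟩
      simp [riseSegment, h2]
  rcases h with ⟨h, hL⟩ | ⟨h1, h2, hL⟩ | ⟨h1, h2, rfl⟩
  · refine key s.toNat (fun a ha ha' => Or.inl ⟨h, by omega, by exact_mod_cast ha'⟩) rfl
      (by omega) hL
  · by_cases h3 : (v : ℤ) + 1 < -s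
    · have hl : IsLane α n v s := ⟨h1, hs, Or.inl (by omega)⟩
      refine ⟨s, s, L, Or.inr (Or.inr ⟨rfl, hl⟩), Or.inr (Or.inr ⟨rfl, hl⟩),
        Or.inr (Or.inl ⟨h1, by push_cast; omega, hL⟩), ?_⟩
      simp [riseSegment, h1]
    · refine key 0 (fun a ha ha' => Or.inr (Or.inl ⟨by omega, by omega, by omega,
        by exact_mod_cast ha'⟩)) (by omega) (by omega) ?_
      rwa [show (-s - 1).toNat = v by omega] at hL
  · have hl : IsLane α n v s := ⟨by omega, hs, Or.inr (by omega)⟩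
    refine ⟨s, s, [], Or.inr (Or.inr ⟨rfl, hl⟩), Or.inr (Or.inr ⟨rfl, hl⟩),
      Or.inr (Or.inr ⟨h1, by omega, rfl⟩), ?_⟩
    simp [riseSegment, hl.1]

theorem IsTail.unique (hr : 1 ≤ r) (hα : α ≤ n + 1) {v j j' : ℕ} {s a b a' b' : ℤ}
    {L L' : List LatticePoint}
    (h1 : IsRise r m α n v s a) (h2 : IsPassage r m α n v a b) (h3 : IsTail r m α n (v + 1) b j L)
    (h1' : IsRise r m α n v s a') (h2' : IsPassage r m α n v a' b')
    (h3' : IsTail r m α n (v + 1) b' j' L') (he : riseSegment v s a ++ L = riseSegment v s a' ++ L') :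
    a = a' ∧ b = b' ∧ L = L' := by
  -- Points of column `v` are recognised by their coordinates, so filtering a path by column
  -- separates its first segment from the tail and recovers the height reached.
  have hf : ∀ (b : ℤ) (j : ℕ) (L : List LatticePoint), IsTail r m α n (v + 1) b j L →
      L.filter (fun P => P.1 = 2 * (v : ℤ) + P.2) = [] := by
    intro b j L h
    rw [List.filter_eq_nil_iff]
    intro P hP
    obtain ⟨w, y, hw, rfl⟩ := (h.columns hr).1 P hP
    intro hd
    have := of_decide_eq_true hd
    simp only [columnPoint] at this
    omega
  have hg : ∀ s a : ℕ, (columnSegment v s a).filter (fun P => P.1 = 2 * (v : ℤ) + P.2) =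
      columnSegment v s a := by
    intro s a
    rw [List.filter_eq_self]
    intro P hP
    obtain ⟨y, -, -, rfl⟩ := mem_columnSegment.1 hP
    simp [columnPoint]
  have ha : a = a' := by
    by_cases h0 : a < 0
    · unfold IsRise IsLane at *; omega
    · have hs : s.toNat ≤ a.toNat ∧ s.toNat ≤ a'.toNat ∧ 0 ≤ a' := by
        unfold IsRise IsLane at *; omega
      simp only [riseSegment, if_neg h0, if_neg (not_lt.2 hs.2.2)] at he
      have := congrArg (List.filter (fun P => P.1 = 2 * (v : ℤ) + P.2)) he
      rw [List.filter_append, List.filter_append, hf _ _ _ h3, hf _ _ _ h3', hg, hg,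
        List.append_nil, List.append_nil] at this
      have := columnSegment_inj hs.1 hs.2.1 this
      omega
  subst ha
  have hL := List.append_cancel_left he
  subst hL
  refine ⟨rfl, ?_, rfl⟩
  by_cases h0 : a < 0
  · unfold IsPassage IsLane at *; omega
  by_cases h0 : a = 0
  · subst h0
    have := not_isHop_zero (m := m) hr
    unfold IsPassage IsLane at h2 h2'
    simp only [Int.toNat_zero, this, and_false, false_or] at h2 h2'
    omega
  have hb : 0 ≤ b ∧ 0 ≤ b' := by
    unfold IsPassage IsLane at h2 h2'
    omega
  have p1 : L.head? = some (columnPoint (v + 1) b.toNat) := by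
    rcases h3 with h3 | h3 | h3
    · exact h3.2.1
    · omega
    · omega
  have p2 : L.head? = some (columnPoint (v + 1) b'.toNat) := by
    rcases h3' with h3 | h3 | h3
    · exact h3.2.1
    · omega
    · omega
  rw [p1, Option.some.injEq, columnPoint_inj] at p2
  omega

end Tails

/-! ## Strongly non-intersecting families by columns -/

section Families

variable {r : ℕ} {m : ℕ → ℤ} {α n : ℕ}

theorem IsLayered.columns_all {v : ℕ} {s a b : ℤ} {L' L : List LatticePoint}
    (h : IsLayered r m α n v s a b L' L) {P : LatticePoint} (hP : P ∈ L) :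
    ∃ w y, P = columnPoint w y := by
  rcases (h.mem P).1 hP with ⟨_, y, _, _, e⟩ | hP
  · exact ⟨_, _, e⟩
  · obtain ⟨w, y, _, e⟩ := h.columns P hP
    exact ⟨w, y, e⟩

theorem IsLayered.isLatticeStep (hr : 1 ≤ r) {v : ℕ} {s a b : ℤ} {L' L : List LatticePoint}
    (h : IsLayered r m α n v s a b L' L) {P Q : LatticePoint} (hP : (P, Q) ∈ pathSteps L) :
    P ∈ L ∧ Q ∈ L ∧ IsLatticeStep r m P Q := by
  rcases (h.steps P Q).1 hP with ⟨h0, y, h1, h2, rfl, rfl⟩ | ⟨h0, h1, rfl, rfl⟩ | hP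
  · refine ⟨(h.mem _).2 (Or.inl ⟨h0, y, h1, h2.le, rfl⟩),
      (h.mem _).2 (Or.inl ⟨h0, y + 1, by omega, h2, rfl⟩), ?_⟩
    rw [isLatticeStep_columnPoint hr]
    refine Or.inl ⟨rfl, ?_⟩
    have := h.rise
    unfold IsRise IsLane at this
    omega
  · refine ⟨(h.mem _).2 (Or.inl ⟨h0, a.toNat, ?_, le_rfl, rfl⟩), (h.mem _).2 (Or.inr (h.head h1)),
      ?_⟩
    · have := h.rise
      unfold IsRise IsLane at this
      omega
    · rw [isLatticeStep_columnPoint hr]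
      refine Or.inr ⟨_, ?_, rfl⟩
      have := h.passage
      unfold IsPassage IsLane at this
      rcases this with this | this | this
      · exact this.2.2
      · omega
      · omega
  · obtain ⟨h1, h2, h3⟩ := h.tail_steps P Q hP
    exact ⟨(h.mem _).2 (Or.inr h1), (h.mem _).2 (Or.inr h2), h3⟩

/-- A step to the next column is either the passage out of the first column or a step of the
tail. -/
theorem IsLayered.hop_cases {v w y z : ℕ} {s a b : ℤ} {L' L : List LatticePoint}
    (h : IsLayered r m α n v s a b L' L)
    (hP : (columnPoint w y, columnPoint (w + 1) z) ∈ pathSteps L) :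
    (w = v ∧ 0 ≤ a ∧ 0 ≤ b ∧ y = a.toNat ∧ z = b.toNat) ∨
      (v < w ∧ (columnPoint w y, columnPoint (w + 1) z) ∈ pathSteps L') := by
  rcases (h.steps _ _).1 hP with ⟨h0, x, h1, h2, h3, h4⟩ | ⟨h0, h1, h2, h3⟩ | hP
  · rw [columnPoint_inj] at h3 h4
    omega
  · rw [columnPoint_inj] at h2 h3
    exact Or.inl ⟨h2.1, h0, h1, h2.2, h3.2⟩
  · obtain ⟨w', y', h1, h2⟩ := h.columns _ (h.tail_steps _ _ hP).1
    rw [columnPoint_inj] at h2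
    exact Or.inr ⟨by omega, hP⟩

/-- Two column segments overlap when the bottom of the upper one is not above the top of the lower
one; then each path could continue to the other's height. -/
theorem isRise_exchange {v : ℕ} {s a s₂ a₂ : ℤ} (hs : s₂ < s) (h : IsRise r m α n v s a)
    (h₂ : IsRise r m α n v s₂ a₂) (ha : 0 ≤ a) (ha₂ : 0 ≤ a₂) (hle : s.toNat ≤ a₂.toNat) :
    IsRise r m α n v s a₂ ∧ IsRise r m α n v s₂ a := by
  unfold IsRise IsLane at *
  omega

/-- The bridge from geometry to layers. A shared point of the column means that the rises can be
exchanged. A shared target, a crossing, or a crossing after exchange means that the passages can. By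
`SegmentsCross.cases`, distinct steps without a common start cross only as hops out of the same
column, so there is no interaction between different layers. -/
theorem IsLayered.stronglyNonIntersecting_iff (hr : 1 ≤ r) (hα : α ≤ n + 1) {v : ℕ}
    {s a b s₂ a₂ b₂ : ℤ} {L' L L₂' L₂ : List LatticePoint} (hs : s₂ < s)
    (h : IsLayered r m α n v s a b L' L) (h₂ : IsLayered r m α n v s₂ a₂ b₂ L₂' L₂) :
    StronglyNonIntersecting r m L L₂ ↔
      ¬ (IsRise r m α n v s a₂ ∧ IsRise r m α n v s₂ a) ∧
      ¬ (IsPassage r m α n v a b₂ ∧ IsPassage r m α n v a₂ b) ∧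
      StronglyNonIntersecting r m L' L₂' := by
  have hop : ∀ {a b : ℤ}, 0 ≤ a → 0 ≤ b → IsPassage r m α n v a b →
      IsHop r m a.toNat b.toNat := by
    intro a b h1 h2 h3
    unfold IsPassage IsLane at h3
    rcases h3 with h3 | h3 | h3
    · exact h3.2.2
    · omega
    · omega
  have hrise := h.rise
  have hrise₂ := h₂.rise
  have hpass := h.passage
  have hpass₂ := h₂.passage
  constructor
  · intro hsni
    have g1 : ¬ (IsRise r m α n v s a₂ ∧ IsRise r m α n v s₂ a) := by
      rintro ⟨c1, c2⟩
      by_cases h0 : 0 ≤ s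
      · refine hsni.1 (columnPoint v s.toNat) ((h.mem _).2 (Or.inl ⟨?_, s.toNat, le_rfl, ?_, rfl⟩))
          ((h₂.mem _).2 (Or.inl ⟨?_, s.toNat, ?_, ?_, rfl⟩)) <;>
        · clear hpass hpass₂ hop
          unfold IsRise IsLane at c1 c2 hrise hrise₂
          omega
      · clear hpass hpass₂ hop
        unfold IsRise IsLane at c1 c2 hrise hrise₂
        omega
    have haa : a₂ < a := by
      by_contra hle
      exact g1 (isUncrossable_isRise hα v hs hrise hrise₂ (not_lt.1 hle))
    refine ⟨g1, ?_, ?_⟩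
    · rintro ⟨c1, c2⟩
      have hpos : 0 ≤ a₂ ∧ 0 ≤ a ∧ 0 ≤ b ∧ 0 ≤ b₂ := by
        clear hrise hrise₂ hop
        unfold IsPassage IsLane at c1 c2 hpass hpass₂
        omega
      obtain ⟨p1, p2, p3, p4⟩ := hpos
      -- For targets in the right order the exchanged steps cross, equal targets are a common
      -- vertex, and targets in the wrong order make the steps themselves cross.
      rcases lt_trichotomy b₂ b with hlt | heq | hgt
      · refine (hsni.2 _ _ _ _ ((h.steps _ _).2 (Or.inr (Or.inl ⟨p2, p3, rfl, rfl⟩)))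
          ((h₂.steps _ _).2 (Or.inr (Or.inl ⟨p1, p4, rfl, rfl⟩)))).2 ⟨?_, ?_, ?_⟩
        · exact (isLatticeStep_columnPoint hr).2 (Or.inr ⟨_, hop p2 p4 c1, rfl⟩)
        · exact (isLatticeStep_columnPoint hr).2 (Or.inr ⟨_, hop p1 p3 c2, rfl⟩)
        · exact (segmentsCross_of_lt (by omega) (by omega)).symm
      · exact hsni.1 _ ((h.mem _).2 (Or.inr (h.head p3)))
          ((h₂.mem _).2 (Or.inr (heq ▸ h₂.head p4)))
      · refine (hsni.2 _ _ _ _ ((h.steps _ _).2 (Or.inr (Or.inl ⟨p2, p3, rfl, rfl⟩)))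
          ((h₂.steps _ _).2 (Or.inr (Or.inl ⟨p1, p4, rfl, rfl⟩)))).1 ?_
        exact (segmentsCross_of_lt (by omega) (by omega)).symm
    · exact ⟨fun P hP hP' => hsni.1 P ((h.mem _).2 (Or.inr hP)) ((h₂.mem _).2 (Or.inr hP')),
        fun P Q S T h1 h2 => hsni.2 P Q S T ((h.steps _ _).2 (Or.inr (Or.inr h1)))
          ((h₂.steps _ _).2 (Or.inr (Or.inr h2)))⟩
  · rintro ⟨g1, g2, g3⟩
    have haa : a₂ < a := by
      by_contra hle
      exact g1 (isUncrossable_isRise hα v hs hrise hrise₂ (not_lt.1 hle))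
    have hbb : b₂ < b := by
      by_contra hle
      exact g2 (isUncrossable_isPassage hr hα v haa hpass hpass₂ (not_lt.1 hle))
    have hshare : ∀ P ∈ L, P ∉ L₂ := by
      intro P hP hP₂
      rcases (h.mem P).1 hP with ⟨h0, y, h1, h2, rfl⟩ | hP <;>
        rcases (h₂.mem _).1 hP₂ with ⟨h0', y', h1', h2', he⟩ | hP₂
      · rw [columnPoint_inj] at he
        exact g1 (isRise_exchange hs hrise hrise₂ h0 h0' (by omega))
      · obtain ⟨w, y', hw, he⟩ := h₂.columns _ hP₂
        rw [columnPoint_inj] at he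
        omega
      · obtain ⟨w, y, hw, he'⟩ := h.columns _ hP
        rw [he, columnPoint_inj] at he'
        omega
      · exact g3.1 P hP hP₂
    refine ⟨hshare, fun P Q S T hPQ hST => ?_⟩
    obtain ⟨m1, m2, m3⟩ := h.isLatticeStep hr hPQ
    obtain ⟨n1, n2, n3⟩ := h₂.isLatticeStep hr hST
    obtain ⟨v', y, rfl⟩ := h.columns_all m1
    obtain ⟨w', z, rfl⟩ := h₂.columns_all n1
    constructor
    · intro hc
      rcases SegmentsCross.cases hr m3 n3 hc with ⟨rfl, rfl⟩ | ⟨rfl, c, c', -, -, rfl, rfl, hlt⟩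
      · exact hshare _ m1 n1
      · rcases h.hop_cases hPQ with ⟨rfl, _⟩ | ⟨h1, hPQ'⟩ <;>
          rcases h₂.hop_cases hST with ⟨h1', _⟩ | ⟨h1', hST'⟩
        · omega
        · omega
        · omega
        · exact (g3.2 _ _ _ _ hPQ' hST').1 hc
    · rintro ⟨k1, k2, hc⟩
      rcases SegmentsCross.cases hr k1 k2 hc with ⟨rfl, rfl⟩ | ⟨rfl, c, c', -, -, rfl, rfl, hlt⟩
      · exact hshare _ m1 n1
      · rcases h.hop_cases hPQ with ⟨rfl, p1, p2, p3, p4⟩ | ⟨h1, hPQ'⟩ <;>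
          rcases h₂.hop_cases hST with ⟨h1', q1, q2, q3, q4⟩ | ⟨h1', hST'⟩
        · apply g2
          subst p3 p4 q3 q4
          rw [isLatticeStep_columnPoint hr] at k1 k2
          simp only [columnPoint_inj] at k1 k2
          refine ⟨Or.inl ⟨p1, q2, ?_⟩, Or.inl ⟨q1, p2, ?_⟩⟩
          · rcases k1 with k1 | ⟨b, k1, k1', rfl⟩
            · omega
            · exact k1
          · rcases k2 with k2 | ⟨b, k2, k2', rfl⟩
            · omega
            · exact k2
        · omega
        · omega
        · exact (g3.2 _ _ _ _ hPQ' hST').2 ⟨k1, k2, hc⟩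

/-- The families of pairwise strongly non-intersecting tails with given states in column `v`. -/
def tailFamilies (r : ℕ) (m : ℕ → ℤ) (α n v : ℕ) (S : Fin α → ℤ) :
    Set (Fin α → List LatticePoint) :=
  {F | (∃ σ : Equiv.Perm (Fin α), ∀ i, IsTail r m α n v (S i) (σ i) (F i)) ∧
    ∀ i j, i ≠ j → StronglyNonIntersecting r m (F i) (F j)}

theorem forall_ne_stronglyNonIntersecting_iff (F : Fin α → List LatticePoint) :
    (∀ i j, i ≠ j → StronglyNonIntersecting r m (F i) (F j)) ↔
      ∀ i j, i < j → StronglyNonIntersecting r m (F i) (F j) := by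
  refine ⟨fun h i j hij => h i j hij.ne, fun h i j hij => ?_⟩
  rcases lt_or_gt_of_ne hij with h1 | h1
  · exact h i j h1
  · exact (h j i h1).symm

/-- The families of tails, given by what happens in column `v` and by families of tails in
column `v + 1`. -/
theorem mem_tailFamilies_iff (hr : 1 ≤ r) (hα : α ≤ n + 1) {v : ℕ} (hv : v < n + α)
    {S : Fin α → ℤ} (hS : StrictAnti S) (hS1 : ∀ i, -(α : ℤ) ≤ S i)
    (hS2 : ∀ i, S i ≤ (gammaLabel m r + 2 : ℕ)) (F : Fin α → List LatticePoint) :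
    F ∈ tailFamilies r m α n v S ↔ ∃ A B : Fin α → ℤ, IsUnexchangeable (IsRise r m α n v) S A ∧
      IsUnexchangeable (IsPassage r m α n v) A B ∧
      ∃ G ∈ tailFamilies r m α n (v + 1) B, F = fun i => riseSegment v (S i) (A i) ++ G i := by
  constructor
  · rintro ⟨⟨σ, hσ⟩, h⟩
    choose A B G h1 h2 h3 h4 using fun i =>
      (hσ i).decompose hr hα hv (σ i).2 (hS1 i) (hS2 i)
    obtain rfl : F = fun i => riseSegment v (S i) (A i) ++ G i := funext h4
    have hl : ∀ i, IsLayered r m α n v (S i) (A i) (B i) (G i) _ := fun i =>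
      (IsTail.compose.{0} hr hα hv (σ i).2 (h1 i) (h2 i) (h3 i)).2.1
    rw [forall_ne_stronglyNonIntersecting_iff] at h
    have hh := fun i j hij => ((hl i).stronglyNonIntersecting_iff hr hα (hS hij) (hl j)).1
      (h i j hij)
    refine ⟨A, B, ⟨h1, fun i j hij => (hh i j hij).1⟩, ⟨h2, fun i j hij => (hh i j hij).2.1⟩,
      G, ⟨⟨σ, h3⟩, (forall_ne_stronglyNonIntersecting_iff G).2 fun i j hij => (hh i j hij).2.2⟩, rfl⟩
  · rintro ⟨A, B, hA, hB, G, ⟨⟨σ, hσ⟩, hG⟩, rfl⟩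
    have hc := fun i => IsTail.compose.{0} hr hα hv (σ i).2 (hA.1 i) (hB.1 i) (hσ i)
    refine ⟨⟨σ, fun i => (hc i).1⟩, (forall_ne_stronglyNonIntersecting_iff _).2 fun i j hij => ?_⟩
    exact ((hc i).2.1.stronglyNonIntersecting_iff hr hα (hS hij) (hc j).2.1).2
      ⟨hA.2 i j hij, hB.2 i j hij, hG i j hij.ne⟩

end Families

/-! ## The determinant formula for families of tails -/

section TailSums

variable {r : ℕ} {m : ℕ → ℤ} {α n : ℕ} {K : Type u} [Field K] {R : ℕ → ℤ → K}

/-- The sum of the weights of the tails in state `s` in column `v` with end point numbered `j`. -/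
noncomputable def tailSum (r : ℕ) (m : ℕ → ℤ) (R : ℕ → ℤ → K) (α n v : ℕ) (s : ℤ) (j : ℕ) : K :=
  if 0 ≤ s then
    if v ≤ n + α - 1 - j then pathSum r m R (n + α - 1 - j - v) s.toNat else 0
  else if (v : ℤ) < -s then pathSum r m R (n + α - 1 - j - (-s - 1).toNat) 0
  else if s = -((j : ℤ) + 1) ∧ n + α - 1 - j < v then 1 else 0

/-- The range of the states. -/
noncomputable def stateRange (r : ℕ) (m : ℕ → ℤ) (α : ℕ) : Finset ℤ :=
  Finset.Icc (-(α : ℤ)) (gammaLabel m r + 2 : ℕ)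

theorem mem_stateRange {s : ℤ} :
    s ∈ stateRange r m α ↔ -(α : ℤ) ≤ s ∧ s ≤ (gammaLabel m r + 2 : ℕ) := by
  simp [stateRange]

open Classical in
/-- The sum over the passages from the state `a`. -/
noncomputable def passageSum (r : ℕ) (m : ℕ → ℤ) (R : ℕ → ℤ → K) (α n v : ℕ) (a : ℤ) (j : ℕ) : K :=
  ∑ b ∈ stateRange r m α with IsPassage r m α n v a b,
    passageWeight r m R a b * tailSum r m R α n (v + 1) b j

theorem passageSum_lane {v j : ℕ} {s : ℤ} (hs : IsLane α n v s) :
    passageSum r m R α n v s j = tailSum r m R α n (v + 1) s j := by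
  classical
  unfold passageSum
  rw [Finset.sum_eq_single s]
  · rw [passageWeight, if_neg (by have := hs.1; omega), one_mul]
  · intro b hb hne
    rw [Finset.mem_filter] at hb
    have := hb.2
    unfold IsPassage IsLane at *
    omega
  · intro h
    exfalso
    apply h
    rw [Finset.mem_filter, mem_stateRange]
    exact ⟨⟨hs.2.1, by have := hs.1; omega⟩, Or.inr (Or.inr ⟨rfl, hs⟩)⟩

/-- Before the arrival column a passage is a hop followed by a tail with one hop less. In the
arrival column only height `0` contributes, by passing to the lane of the end point. -/
theorem passageSum_height (hr : 1 ≤ r) (hα : α ≤ n + 1) {v j a : ℕ} (hj : j < α)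
    (ha : a ≤ gammaLabel m r + 2) :
    passageSum r m R α n v a j =
      if v < n + α - 1 - j then hopSum r m R (pathSum r m R (n + α - 1 - j - v - 1)) a
      else if v = n + α - 1 - j ∧ a = 0 then 1 else 0 := by
  classical
  have hnot := not_isHop_zero (m := m) hr
  rcases Nat.eq_zero_or_pos a with rfl | hpos
  · have e : (if v < n + α - 1 - j then hopSum r m R (pathSum r m R (n + α - 1 - j - v - 1)) 0
        else if v = n + α - 1 - j ∧ 0 = 0 then 1 else 0) =
        if v = n + α - 1 - j then (1 : K) else 0 := by
      rw [hopSum_zero hr]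
      split_ifs <;> first | rfl | omega
    rw [e]
    unfold passageSum
    by_cases hv : n ≤ v ∧ v < n + α
    · rw [Finset.sum_eq_single (-((n : ℤ) + α - v))]
      · rw [passageWeight, if_neg (by omega), one_mul, tailSum, if_neg (by omega),
          if_neg (by push_cast; omega)]
        split_ifs <;> first | rfl | omega
      · intro b hb hne
        rw [Finset.mem_filter] at hb
        have := hb.2
        unfold IsPassage IsLane at this
        simp only [Nat.cast_zero, Int.toNat_zero, hnot, and_false, false_or] at this
        omega
      · intro h
        exfalso
        apply h
        rw [Finset.mem_filter, mem_stateRange]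
        exact ⟨by omega, Or.inr (Or.inl ⟨rfl, hv.1, hv.2, rfl⟩)⟩
    · rw [Finset.sum_eq_zero]
      · rw [if_neg (by omega)]
      · intro b hb
        rw [Finset.mem_filter] at hb
        have := hb.2
        unfold IsPassage IsLane at this
        simp only [Nat.cast_zero, Int.toNat_zero, hnot, and_false, false_or] at this
        omega
  · have hiff : ∀ b : ℤ, IsPassage r m α n v a b ↔ 0 ≤ b ∧ IsHop r m a b.toNat := by
      intro b
      unfold IsPassage IsLane
      simp only [Int.toNat_natCast]
      constructor
      · rintro (h | h | h)
        · exact h.2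
        · omega
        · omega
      · exact fun h => Or.inl ⟨by omega, h⟩
    have e : passageSum r m R α n v a j = ∑ b ∈ Finset.range (a + 1) with IsHop r m a b,
        hopWeight r m R a b * tailSum r m R α n (v + 1) b j := by
      unfold passageSum
      refine Finset.sum_bij' (fun b _ => b.toNat) (fun b _ => (b : ℤ)) ?_ ?_ ?_ ?_ ?_
      · intro b hb
        rw [Finset.mem_filter, hiff] at hb
        rw [Finset.mem_filter, Finset.mem_range]
        exact ⟨Nat.lt_succ_of_le hb.2.2.le, hb.2.2⟩
      · intro b hb
        rw [Finset.mem_filter, Finset.mem_range] at hb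
        rw [Finset.mem_filter, hiff, mem_stateRange]
        exact ⟨by omega, by omega, by simpa using hb.2⟩
      · intro b hb
        rw [Finset.mem_filter, hiff] at hb
        omega
      · intro b _; simp
      · intro b hb
        rw [Finset.mem_filter, hiff] at hb
        rw [passageWeight, if_pos ⟨by omega, hb.2.1⟩, Int.toNat_natCast,
          Int.toNat_of_nonneg hb.2.1]
    rw [e, Finset.sum_filter]
    simp only [tailSum, if_pos (Int.natCast_nonneg _), Int.toNat_natCast]
    by_cases hv : v < n + α - 1 - j
    · simp only [if_pos hv, if_pos (Nat.succ_le_of_lt hv), hopSum,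
        show n + α - 1 - j - v - 1 = n + α - 1 - j - (v + 1) by omega]
    · rw [if_neg hv, if_neg (by omega)]
      simp only [if_neg (show ¬ v + 1 ≤ n + α - 1 - j by omega), mul_zero, ite_self,
        Finset.sum_const_zero]

open Classical in
-- Writes a row of the matrix of tail sums as a sum over rises, the factor `1` being their weight;
-- this is the form to which `det_layer_down` applies.
theorem tailSum_eq (hr : 1 ≤ r) (hα : α ≤ n + 1) {v j : ℕ} {s : ℤ} (hj : j < α)
    (hs : s ∈ stateRange r m α) :
    tailSum r m R α n v s j = ∑ a ∈ stateRange r m α with IsRise r m α n v s a,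
      1 * passageSum r m R α n v a j := by
  rw [mem_stateRange] at hs
  simp only [one_mul]
  by_cases h1 : 0 ≤ s ∨ s = -((v : ℤ) + 1)
  · have e1 : tailSum r m R α n v s j =
        if v ≤ n + α - 1 - j then pathSum r m R (n + α - 1 - j - v) s.toNat else 0 := by
      unfold tailSum
      by_cases h0 : 0 ≤ s
      · rw [if_pos h0]
      · rw [if_neg h0, if_pos (by omega), if_pos (by omega), show (-s - 1).toNat = v by omega,
          show s.toNat = 0 by omega]
    have e2 : ∑ a ∈ stateRange r m α with IsRise r m α n v s a, passageSum r m R α n v a j =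
        ∑ a ∈ Finset.Icc s.toNat (gammaLabel m r + 2), passageSum r m R α n v a j := by
      have hiff : ∀ a : ℤ, IsRise r m α n v s a ↔
          0 ≤ a ∧ s ≤ a ∧ a ≤ (gammaLabel m r + 2 : ℕ) := by
        intro a
        unfold IsRise IsLane
        omega
      refine Finset.sum_bij' (fun a _ => a.toNat) (fun a _ => (a : ℤ)) ?_ ?_ ?_ ?_ ?_
      · intro a ha
        rw [Finset.mem_filter, hiff] at ha
        rw [Finset.mem_Icc]
        omega
      · intro a ha
        rw [Finset.mem_Icc] at ha
        rw [Finset.mem_filter, hiff, mem_stateRange]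
        omega
      · intro a ha
        rw [Finset.mem_filter, hiff] at ha
        omega
      · intro a _; simp
      · intro a ha
        rw [Finset.mem_filter, hiff] at ha
        rw [Int.toNat_of_nonneg ha.2.1]
    rw [e1, e2, Finset.sum_congr rfl fun a ha =>
      passageSum_height hr hα hj (Finset.mem_Icc.1 ha).2]
    rcases lt_trichotomy v (n + α - 1 - j) with hlt | heq | hgt
    · simp only [if_pos hlt, if_pos hlt.le]
      obtain ⟨d, hd⟩ : ∃ d, n + α - 1 - j - v = d + 1 := ⟨n + α - 1 - j - v - 1, by omega⟩
      rw [hd]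
      rfl
    · rw [if_pos heq.le, show n + α - 1 - j - v = 0 by omega]
      rw [heq]
      simp only [lt_irrefl, if_false, true_and]
      by_cases h0 : s.toNat = 0
      · simp [pathSum, h0]
      · simp [pathSum, h0]
    · rw [if_neg (by omega)]
      refine (Finset.sum_eq_zero fun a _ => ?_).symm
      rw [if_neg (by omega), if_neg (by omega)]
  · by_cases hl : IsLane α n v s
    · rw [Finset.sum_eq_single s]
      · rw [passageSum_lane hl]
        unfold IsLane at hl
        unfold tailSum
        rw [if_neg (show ¬ 0 ≤ s by omega), if_neg (show ¬ 0 ≤ s by omega)]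
        push_cast
        by_cases h2 : (v : ℤ) < -s
        · rw [if_pos h2, if_pos (by omega)]
        · rw [if_neg h2, if_neg (show ¬ (v : ℤ) + 1 < -s by omega)]
          by_cases h3 : s = -((j : ℤ) + 1)
          · rw [if_pos ⟨h3, by omega⟩, if_pos ⟨h3, by omega⟩]
          · rw [if_neg fun h => h3 h.1, if_neg fun h => h3 h.1]
      · intro a ha hne
        rw [Finset.mem_filter] at ha
        have := ha.2
        unfold IsRise IsLane at *
        omega
      · intro h
        exfalso
        apply h
        rw [Finset.mem_filter, mem_stateRange]
        exact ⟨hs, Or.inr (Or.inr ⟨rfl, hl⟩)⟩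
    · rw [Finset.sum_eq_zero]
      · unfold IsLane at hl
        unfold tailSum
        rw [if_neg (by omega), if_neg (by omega), if_neg (by omega)]
      · intro a ha
        rw [Finset.mem_filter] at ha
        have := ha.2
        unfold IsRise IsLane at *
        omega

/-- In column `n + α` every path has arrived. Since there are `α` lanes and the states are strictly
ordered, the only admissible states are all the lanes in order, and then the matrix is the identity.
-/
theorem tailFamilies_last (hr : 1 ≤ r) {S : Fin α → ℤ} (hS : StrictAnti S)
    (hS1 : ∀ i, S i ∈ stateRange r m α) :
    (tailFamilies r m α n (n + α) S).Finite ∧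
      ∑ᶠ F ∈ tailFamilies r m α n (n + α) S, ∏ i, pathWeight r m R (F i) =
        (Matrix.of fun i j : Fin α => tailSum r m R α n (n + α) (S i) j).det := by
  have htail : ∀ (s : ℤ) (j : ℕ) (L : List LatticePoint), j < α → s ∈ stateRange r m α →
      (IsTail r m α n (n + α) s j L ↔ s = -((j : ℤ) + 1) ∧ L = []) := by
    intro s j L hj hs
    rw [mem_stateRange] at hs
    constructor
    · rintro (⟨_, h⟩ | h | h)
      · have := (h.columns hr).1
        omega
      · push_cast at h
        omega
      · exact ⟨h.1, h.2.2⟩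
    · rintro ⟨rfl, rfl⟩
      exact Or.inr (Or.inr ⟨rfl, by omega, rfl⟩)
  have hsum : ∀ (s : ℤ) (j : ℕ), j < α → s ∈ stateRange r m α →
      tailSum r m R α n (n + α) s j = if s = -((j : ℤ) + 1) then 1 else 0 := by
    intro s j hj hs
    rw [mem_stateRange] at hs
    unfold tailSum
    by_cases h0 : 0 ≤ s
    · rw [if_pos h0, if_neg (by omega), if_neg (by omega)]
    · rw [if_neg h0, if_neg (by push_cast; omega)]
      by_cases h3 : s = -((j : ℤ) + 1)
      · rw [if_pos ⟨h3, by omega⟩, if_pos h3]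
      · rw [if_neg fun h => h3 h.1, if_neg h3]
  by_cases hneg : ∀ i, S i < 0
  · have hex : ∀ i, ∃ j : Fin α, S i = -(((j : ℕ) : ℤ) + 1) := by
      intro i
      have h1 := mem_stateRange.1 (hS1 i)
      have h2 := hneg i
      exact ⟨⟨(-(S i) - 1).toNat, by omega⟩, by simp only; omega⟩
    choose f hf using hex
    have hmono : StrictMono f := by
      intro i j hij
      have := hS hij
      rw [hf i, hf j] at this
      exact Fin.lt_def.2 (by omega)
    -- A strictly increasing map of `Fin α` to itself is surjective, hence the identity.
    have hfid : f = id := by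
      refine (hmono.range_inj strictMono_id).1 ?_
      rw [(Finite.surjective_of_injective hmono.injective).range_eq, Set.range_id]
    have hSi : ∀ i, S i = -(((i : ℕ) : ℤ) + 1) := by
      intro i
      rw [hf i, hfid]
      rfl
    have hfam : tailFamilies r m α n (n + α) S = {fun _ => []} := by
      ext F
      rw [Set.mem_singleton_iff]
      constructor
      · rintro ⟨⟨σ, hσ⟩, -⟩
        funext i
        exact ((htail _ _ _ (σ i).2 (hS1 i)).1 (hσ i)).2
      · rintro rfl
        refine ⟨⟨1, fun i => (htail _ _ _ i.2 (hS1 i)).2 ⟨hSi i, rfl⟩⟩, fun i j _ => ?_⟩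
        simp [StronglyNonIntersecting, pathSteps]
    rw [hfam]
    refine ⟨Set.finite_singleton _, ?_⟩
    rw [finsum_mem_singleton]
    have hone : (Matrix.of fun i j : Fin α => tailSum r m R α n (n + α) (S i) j) = 1 := by
      ext i j
      rw [Matrix.of_apply, hsum _ _ j.2 (hS1 i), hSi i, Matrix.one_apply]
      refine if_congr ?_ rfl rfl
      rw [Fin.ext_iff]
      omega
    rw [hone, Matrix.det_one]
    simp [pathWeight_nil]
  · push Not at hneg
    obtain ⟨i, hi⟩ := hneg
    have hfam : tailFamilies r m α n (n + α) S = ∅ := by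
      rw [Set.eq_empty_iff_forall_notMem]
      rintro F ⟨⟨σ, hσ⟩, -⟩
      have := ((htail _ _ _ (σ i).2 (hS1 i)).1 (hσ i)).1
      omega
    rw [hfam]
    refine ⟨Set.finite_empty, ?_⟩
    rw [finsum_mem_empty, Matrix.det_eq_zero_of_row_eq_zero i]
    intro j
    rw [Matrix.of_apply, hsum _ _ j.2 (hS1 i), if_neg (by omega)]

/-- Induction over the columns from the last one backwards. The families and the determinant are
expanded over the same pairs of states, after the rises and after the passages, which again are
strictly ordered. Finiteness is carried along because the finite sums are rearranged over the
families of the next column. -/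
theorem finsum_tailFamilies (hr : 1 ≤ r) (hα : α ≤ n + 1)
    (hα1 : 1 ≤ α) {v d : ℕ} (hv : v + d = n + α) {S : Fin α → ℤ} (hS : StrictAnti S)
    (hS1 : ∀ i, S i ∈ stateRange r m α) :
    (tailFamilies r m α n v S).Finite ∧ (IsQSystemSolution r R →
      ∑ᶠ F ∈ tailFamilies r m α n v S, ∏ i, pathWeight r m R (F i) =
        (Matrix.of fun i j : Fin α => tailSum r m R α n v (S i) j).det) := by
  classical
  induction d generalizing v S with
  | zero =>
    obtain rfl : v = n + α := by omega
    exact ⟨(tailFamilies_last (R := R) hr hS hS1).1, fun _ => (tailFamilies_last hr hS hS1).2⟩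
  | succ d ih =>
    have hv' : v < n + α := by omega
    let X := Fintype.piFinset (fun _ : Fin α => stateRange r m α)
    let I : Finset ((Fin α → ℤ) × (Fin α → ℤ)) := (X ×ˢ X).filter fun p =>
      IsUnexchangeable (IsRise r m α n v) S p.1 ∧ IsUnexchangeable (IsPassage r m α n v) p.1 p.2
    let glue : (Fin α → ℤ) → (Fin α → List LatticePoint) → Fin α → List LatticePoint :=
      fun A G i => riseSegment v (S i) (A i) ++ G i
    let U : (Fin α → ℤ) × (Fin α → ℤ) → Set (Fin α → List LatticePoint) := fun p =>
      glue p.1 '' tailFamilies r m α n (v + 1) p.2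
    have hI : ∀ p ∈ I, (∀ i, p.1 i ∈ stateRange r m α) ∧ (∀ i, p.2 i ∈ stateRange r m α) ∧
        IsUnexchangeable (IsRise r m α n v) S p.1 ∧
        IsUnexchangeable (IsPassage r m α n v) p.1 p.2 := by
      intro p hp
      simp only [I, X, Finset.mem_filter, Finset.mem_product, Fintype.mem_piFinset] at hp
      exact ⟨hp.1.1, hp.1.2, hp.2⟩
    have hih : ∀ p ∈ I, _ := fun p hp => ih (v := v + 1) (S := p.2) (by omega)
      ((hI p hp).2.2.2.strictAnti (isUncrossable_isPassage hr hα v)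
        ((hI p hp).2.2.1.strictAnti (isUncrossable_isRise hα v) hS)) (hI p hp).2.1
    have hfam : tailFamilies r m α n v S = ⋃ p ∈ (I : Set _), U p := by
      ext F
      rw [mem_tailFamilies_iff hr hα hv' hS (fun i => (mem_stateRange.1 (hS1 i)).1)
        (fun i => (mem_stateRange.1 (hS1 i)).2)]
      simp only [Set.mem_iUnion, Finset.mem_coe, exists_prop]
      constructor
      · rintro ⟨A, B, hA, hB, G, hG, rfl⟩
        refine ⟨(A, B), ?_, G, hG, rfl⟩
        simp only [I, X, Finset.mem_filter, Finset.mem_product, Fintype.mem_piFinset]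
        have hA' : ∀ i, A i ∈ stateRange r m α := by
          intro i
          have h1 := hA.1 i
          rw [mem_stateRange]
          unfold IsRise IsLane at h1
          omega
        refine ⟨⟨hA', fun i => ?_⟩, hA, hB⟩
        have h1 := hB.1 i
        have h2 := mem_stateRange.1 (hA' i)
        rw [mem_stateRange]
        rcases h1 with ⟨h1, h3, h4⟩ | h1 | h1
        · have := h4.le
          omega
        · omega
        · rwa [← h1.1]
      · rintro ⟨p, hp, G, hG, rfl⟩
        exact ⟨p.1, p.2, (hI p hp).2.2.1, (hI p hp).2.2.2, G, hG, rfl⟩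
    have huniq : ∀ p ∈ I, ∀ q ∈ I, ∀ G ∈ tailFamilies r m α n (v + 1) p.2,
        ∀ H ∈ tailFamilies r m α n (v + 1) q.2, glue p.1 G = glue q.1 H → p = q ∧ G = H := by
      intro p hp q hq G hG H hH he
      obtain ⟨⟨σ, hσ⟩, -⟩ := hG
      obtain ⟨⟨τ, hτ⟩, -⟩ := hH
      have hu := fun i => IsTail.unique hr hα ((hI p hp).2.2.1.1 i) ((hI p hp).2.2.2.1 i) (hσ i)
        ((hI q hq).2.2.1.1 i) ((hI q hq).2.2.2.1 i) (hτ i) (congrFun he i)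
      exact ⟨Prod.ext (funext fun i => (hu i).1) (funext fun i => (hu i).2.1),
        funext fun i => (hu i).2.2⟩
    have hfin : ∀ p ∈ I, (U p).Finite := fun p hp => (hih p hp).1.image _
    have hdisj : (I : Set _).PairwiseDisjoint U := by
      intro p hp q hq hpq
      rw [Function.onFun, Set.disjoint_left]
      rintro _ ⟨G, hG, rfl⟩ ⟨H, hH, he⟩
      exact hpq (huniq p hp q hq G hG H hH he.symm).1
    rw [hfam]
    refine ⟨I.finite_toSet.biUnion hfin, fun hR => ?_⟩
    rw [finsum_mem_biUnion hdisj I.finite_toSet hfin, finsum_mem_coe_finset]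
    have hU : ∀ p ∈ I, ∑ᶠ F ∈ U p, ∏ i, pathWeight r m R (F i) =
        (∏ i, passageWeight r m R (p.1 i) (p.2 i)) *
          (Matrix.of fun i j : Fin α => tailSum r m R α n (v + 1) (p.2 i) j).det := by
      intro p hp
      rw [finsum_mem_image fun G hG H hH he => (huniq p hp p hp G hG H hH he).2,
        ← (hih p hp).2 hR, mul_finsum_mem' _ _ (hih p hp).1]
      refine finsum_mem_congr rfl fun G hG => ?_
      obtain ⟨⟨σ, hσ⟩, -⟩ := hG
      rw [← Finset.prod_mul_distrib]
      exact Finset.prod_congr rfl fun i _ => (IsTail.compose hr hα hv' (σ i).2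
        ((hI p hp).2.2.1.1 i) ((hI p hp).2.2.2.1 i) (hσ i)).2.2 K R
    rw [Finset.sum_congr rfl hU]
    obtain ⟨k, rfl⟩ : ∃ k, α = k + 1 := ⟨α - 1, by omega⟩
    have e1 : (Matrix.of fun i j : Fin (k + 1) => tailSum r m R (k + 1) n v (S i) j) =
        Matrix.of fun i j : Fin (k + 1) => ∑ a ∈ stateRange r m (k + 1) with
          IsRise r m (k + 1) n v (S i) a, (1 : K) * passageSum r m R (k + 1) n v a j := by
      ext i j
      exact tailSum_eq hr hα j.2 (hS1 i)
    -- The determinant is expanded along the rises; below, each resulting minor is expanded along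
    -- the passages.
    rw [e1, det_layer_down (isUncrossable_isRise hα v) (fun _ _ => (1 : K)) _
      (fun a j => passageSum r m R (k + 1) n v a j) hS (fun a a' haa => isRise_link v a a' haa),
      Finset.sum_filter, Finset.sum_product, ]
    rw [Finset.sum_filter]
    refine Finset.sum_congr rfl fun A hA => ?_
    split_ifs with hAS
    · have hA' := hAS.strictAnti (isUncrossable_isRise hα v) hS
      simp only [hAS, true_and, Finset.prod_const_one, one_mul]
      rw [← Finset.sum_filter]
      exact (det_layer_up (isUncrossable_isPassage hr hα v) (passageWeight r m R) _
        (fun b j => tailSum r m R (k + 1) n (v + 1) b j) hA'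
        (fun a a' haa => isPassage_link hr hR v a a' haa)).symm
    · simp [hAS]

theorem stronglyNonIntersectingFamilies_eq (α n : ℕ) :
    stronglyNonIntersectingFamilies r m α n =
      tailFamilies r m α n 0 fun i => -(((i : ℕ) : ℤ) + 1) := by
  ext F
  unfold tailFamilies
  simp only [stronglyNonIntersectingFamilies, Set.mem_ofPred_eq]
  refine and_congr (exists_congr fun σ => forall_congr' fun i => ?_) Iff.rfl
  have h1 : startPoint i = columnPoint (i : ℕ) 0 := by
    simp only [startPoint, columnPoint, Prod.mk.injEq, and_true]
    push_cast
    ring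
  have h2 : endPoint n (σ i) = columnPoint (n + α - 1 - (σ i : ℕ)) 0 := by
    have := (σ i).2
    simp only [endPoint, columnPoint, Prod.mk.injEq, and_true]
    omega
  rw [h1, h2]
  unfold IsTail
  rw [show (-(-(((i : ℕ) : ℤ) + 1)) - 1).toNat = (i : ℕ) by omega]
  constructor
  · exact fun h => Or.inr (Or.inl ⟨by omega, by push_cast; omega, h⟩)
  · rintro (h | h | h)
    · omega
    · exact h.2.2
    · omega

theorem strictAnti_startState : StrictAnti fun i : Fin α => -(((i : ℕ) : ℤ) + 1) := by
  intro i j hij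
  have := Fin.lt_def.1 hij
  simp only
  omega

theorem startState_mem_stateRange (i : Fin α) :
    -(((i : ℕ) : ℤ) + 1) ∈ stateRange r m α :=
  mem_stateRange.2 (by have := i.2; omega)

theorem stronglyNonIntersectingFamilies_finite (hr : 1 ≤ r) (hα : α ≤ n + 1) (hα1 : 1 ≤ α) :
    (stronglyNonIntersectingFamilies r m α n).Finite := by
  rw [stronglyNonIntersectingFamilies_eq]
  -- Finiteness does not refer to the weights, so any field and any `R` will do.
  exact (finsum_tailFamilies (K := ℚ) (R := 0) hr hα hα1 (zero_add _) strictAnti_startState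
    startState_mem_stateRange).1

/-- In column `0` the path numbered `i` waits in lane `-(i + 1)`. It starts in column `i` and ends
in column `n + α - 1 - j`, so it makes as many hops as these columns differ. -/
theorem stronglyNonIntersectingPartition_eq (hr : 1 ≤ r) (hR : IsQSystemSolution r R)
    (hα : α ≤ n + 1) (hα1 : 1 ≤ α) :
    stronglyNonIntersectingPartition r m R α n =
      (Matrix.of fun i j : Fin α => pathSum r m R (n + α - 1 - (j : ℕ) - (i : ℕ)) 0).det := by
  unfold stronglyNonIntersectingPartition
  rw [stronglyNonIntersectingFamilies_eq]
  refine ((finsum_tailFamilies hr hα hα1 (zero_add _) strictAnti_startState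
    startState_mem_stateRange).2 hR).trans ?_
  congr 1
  ext i j
  rw [Matrix.of_apply, Matrix.of_apply, tailSum, if_neg (by omega),
    if_pos (by push_cast; omega), show (-(-(((i : ℕ) : ℤ) + 1)) - 1).toNat = (i : ℕ) by omega]

/-- The path formula. -/
theorem eq_stronglyNonIntersectingPartition (hm : IsMotzkinPath r m) (hR : IsQSystemSolution r R)
    (hα1 : 1 ≤ α) (hαr : α ≤ r) (hα : α ≤ n + 1) :
    R α ((n : ℤ) + m 1) = R 1 (m 1) ^ α * stronglyNonIntersectingPartition r m R α n := by
  have hr : 1 ≤ r := hα1.trans hαr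
  have h0 := hR.ne_zero 1 (m 1) le_rfl hr
  rw [stronglyNonIntersectingPartition_eq hr hR hα hα1]
  have h1 := hR.isQDSolution.det_hankel α (by omega) ((n : ℤ) + m 1 + 1 - α)
  have h2 : ∀ k : ℤ, truncatedSolution r R 1 k = R 1 k := fun k =>
    truncatedSolution_of_le (by omega) _
  have h3 := truncatedSolution_of_le (r := r) (α := α) (R := R) (by omega)
    ((n : ℤ) + m 1 + 1 - α + α - 1)
  rw [h3, show (n : ℤ) + m 1 + 1 - α + α - 1 = n + m 1 by ring] at h1
  -- The number of hops decreases with `i + j`; reversing rows and columns gives a Hankel matrix.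
  rw [← h1, ← Matrix.det_submatrix_equiv_self Fin.revPerm]
  have e : (Matrix.of fun i j : Fin α => pathSum r m R (n + α - 1 - (j : ℕ) - (i : ℕ)) 0) =
      (R 1 (m 1))⁻¹ • (Matrix.submatrix (Matrix.of fun i j : Fin α =>
        truncatedSolution r R 1 ((n : ℤ) + m 1 + 1 - α + (i : ℕ) + (j : ℕ)))
          Fin.revPerm Fin.revPerm) := by
    ext i j
    simp only [Matrix.of_apply, Matrix.smul_apply, Matrix.submatrix_apply, Fin.revPerm_apply,
      smul_eq_mul, h2]
    rw [pathSum_eq hr hm hR]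
    congr 2
    rw [Fin.val_rev, Fin.val_rev]
    omega
  rw [e, Matrix.det_smul, Fintype.card_fin, ← mul_assoc, ← mul_pow, mul_inv_cancel₀ h0, one_pow,
    one_mul]

end TailSums

/-! ## Laurent monomials in the seed -/

section Monomials

variable {r : ℕ} {m : ℕ → ℤ}

/-- The function `f` of the solutions is a Laurent monomial in the seed. -/
def IsSeedMonomial (r : ℕ) (m : ℕ → ℤ) (f : (K : Type u) → [Field K] → (ℕ → ℤ → K) → K) : Prop :=
  ∃ e : Fin r × Fin 2 → ℤ, ∀ (K : Type u) [Field K] (R : ℕ → ℤ → K), IsQSystemSolution r R →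
    f K R = laurentMonomial e (motzkinSeed r m R)

theorem motzkinSeed_ne_zero {K : Type u} [Field K] {R : ℕ → ℤ → K} (hR : IsQSystemSolution r R)
    (m : ℕ → ℤ) (j : Fin r × Fin 2) : motzkinSeed r m R j ≠ 0 :=
  hR.ne_zero _ _ (by omega) (by have := j.1.2; omega)

theorem laurentMonomial_zero {K : Type u} [Field K] {ι : Type} [Fintype ι] (x : ι → K) :
    laurentMonomial 0 x = 1 := by
  simp [laurentMonomial]

theorem laurentMonomial_add {K : Type u} [Field K] {ι : Type} [Fintype ι] {x : ι → K}
    (hx : ∀ j, x j ≠ 0) (e e' : ι → ℤ) :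
    laurentMonomial (e + e') x = laurentMonomial e x * laurentMonomial e' x := by
  simp only [laurentMonomial, ← Finset.prod_mul_distrib, Pi.add_apply]
  exact Finset.prod_congr rfl fun j _ => zpow_add₀ (hx j) _ _

theorem laurentMonomial_sub {K : Type u} [Field K] {ι : Type} [Fintype ι] {x : ι → K}
    (hx : ∀ j, x j ≠ 0) (e e' : ι → ℤ) :
    laurentMonomial (e - e') x = laurentMonomial e x / laurentMonomial e' x := by
  simp only [laurentMonomial, ← Finset.prod_div_distrib, Pi.sub_apply]
  exact Finset.prod_congr rfl fun j _ => zpow_sub₀ (hx j) _ _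

variable {f g : (K : Type u) → [Field K] → (ℕ → ℤ → K) → K}

theorem IsSeedMonomial.congr (hf : IsSeedMonomial r m f)
    (h : ∀ (K : Type u) [Field K] (R : ℕ → ℤ → K), IsQSystemSolution r R → g K R = f K R) :
    IsSeedMonomial r m g := by
  obtain ⟨e, he⟩ := hf
  exact ⟨e, fun K _ R hR => (h K R hR).trans (he K R hR)⟩

theorem isSeedMonomial_one : IsSeedMonomial.{u} r m fun _ _ _ => 1 :=
  ⟨0, fun _ _ _ _ => (laurentMonomial_zero _).symm⟩

theorem IsSeedMonomial.mul (hf : IsSeedMonomial r m f) (hg : IsSeedMonomial r m g) :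
    IsSeedMonomial r m fun K _ R => f K R * g K R := by
  obtain ⟨e, he⟩ := hf
  obtain ⟨e', he'⟩ := hg
  refine ⟨e + e', fun K _ R hR => ?_⟩
  rw [laurentMonomial_add (motzkinSeed_ne_zero hR m), ← he K R hR, ← he' K R hR]

theorem IsSeedMonomial.div (hf : IsSeedMonomial r m f) (hg : IsSeedMonomial r m g) :
    IsSeedMonomial r m fun K _ R => f K R / g K R := by
  obtain ⟨e, he⟩ := hf
  obtain ⟨e', he'⟩ := hg
  refine ⟨e - e', fun K _ R hR => ?_⟩
  rw [laurentMonomial_sub (motzkinSeed_ne_zero hR m), ← he K R hR, ← he' K R hR]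

theorem IsSeedMonomial.prod {ι : Type*} (s : Finset ι)
    {F : ι → (K : Type u) → [Field K] → (ℕ → ℤ → K) → K} (h : ∀ i ∈ s, IsSeedMonomial r m (F i)) :
    IsSeedMonomial r m fun K _ R => ∏ i ∈ s, F i K R := by
  classical
  induction s using Finset.induction_on with
  | empty => exact isSeedMonomial_one.congr fun K _ R _ => by simp
  | insert a s ha ih =>
    refine ((h a (by simp)).mul (ih fun i hi => h i (by simp [hi]))).congr fun K _ R _ => ?_
    rw [Finset.prod_insert ha]

theorem isSeedMonomial_boundary {α : ℕ} (hα : α = 0 ∨ α = r + 1) (k : ℤ) :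
    IsSeedMonomial.{u} r m fun _ _ R => R α k := by
  refine isSeedMonomial_one.congr fun K _ R hR => ?_
  rcases hα with rfl | rfl
  · exact hR.bottom k
  · exact hR.top k

theorem isSeedMonomial_var {α : ℕ} (hα : α ≤ r + 1) {k : ℤ} (hk : k = m α ∨ k = m α + 1) :
    IsSeedMonomial.{u} r m fun _ _ R => R α k := by
  by_cases hb : α = 0 ∨ α = r + 1
  · exact isSeedMonomial_boundary hb k
  · obtain ⟨i, rfl⟩ : ∃ i, α = i + 1 := ⟨α - 1, by omega⟩
    have hi : i < r := by omega
    rcases hk with rfl | rfl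
    · refine ⟨Pi.single (⟨i, hi⟩, 0) 1, fun K _ R hR => ?_⟩
      rw [laurentMonomial, Fintype.prod_eq_single ((⟨i, hi⟩, 0) : Fin r × Fin 2)]
      · simp [motzkinSeed]
      · intro j hj
        rw [Pi.single_eq_of_ne hj, zpow_zero]
    · refine ⟨Pi.single (⟨i, hi⟩, 1) 1, fun K _ R hR => ?_⟩
      rw [laurentMonomial, Fintype.prod_eq_single ((⟨i, hi⟩, 1) : Fin r × Fin 2)]
      · simp [motzkinSeed]
      · intro j hj
        rw [Pi.single_eq_of_ne hj, zpow_zero]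

theorem isSeedMonomial_lambdaRatio {α : ℕ} (hα : α ≤ r + 1) :
    IsSeedMonomial.{u} r m fun _ _ R => lambdaRatio R α (m α) :=
  (isSeedMonomial_var hα (Or.inr rfl)).div (isSeedMonomial_var hα (Or.inl rfl))

theorem isSeedMonomial_oddWeight {α : ℕ} (hα : α ≤ r + 1) :
    IsSeedMonomial.{u} r m fun _ _ R => oddWeight m R α :=
  (isSeedMonomial_lambdaRatio hα).div (isSeedMonomial_lambdaRatio (by omega))

/-- If `m α = m (α + 1) + 1`, the variable of row `α + 1` at height `m (α + 1) + 2` is not in the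
seed; the correction `A` cancels it. -/
theorem isSeedMonomial_evenWeight_upper (hm : IsMotzkinPath r m) {α : ℕ} (h1 : 1 ≤ α)
    (h2 : α ≤ r) : IsSeedMonomial.{u} r m fun _ _ R => R (α + 1) (m α + 1) *
      (if m α = m (α + 1) + 1 then
        lambdaRatio R (α + 1) (m (α + 1)) / lambdaRatio R (α + 1) (m α) else 1) := by
  by_cases hr : α = r
  · have hb := fun k => isSeedMonomial_boundary.{u} (r := r) (m := m) (α := α + 1)
      (Or.inr (by omega)) k
    split_ifs
    · exact (hb _).mul (((hb _).div (hb _)).div ((hb _).div (hb _)))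
    · exact (hb _).mul isSeedMonomial_one
  · have hs := abs_le.1 (hm α h1 (by omega))
    split_ifs with h
    · have h0 := isSeedMonomial_var.{u} (r := r) (m := m) (α := α + 1) (by omega) (Or.inl rfl)
      have h1 := isSeedMonomial_var.{u} (r := r) (m := m) (α := α + 1) (by omega) (Or.inr rfl)
      refine ((h1.mul h1).div h0).congr fun K _ R hR => ?_
      have n0 := hR.ne_zero' (show α + 1 ≤ r + 1 by omega) (m (α + 1))
      have n1 := hR.ne_zero' (show α + 1 ≤ r + 1 by omega) (m (α + 1) + 1)
      have n2 := hR.ne_zero' (show α + 1 ≤ r + 1 by omega) (m (α + 1) + 1 + 1)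
      rw [h, lambdaRatio, lambdaRatio]
      field_simp
    · exact (isSeedMonomial_var (by omega) (by omega)).mul isSeedMonomial_one

/-- If `m (α - 1) = m α + 1`, the variable of row `α - 1` at height `m α` lies below the seed; the
correction `B` cancels it. -/
theorem isSeedMonomial_evenWeight_lower (hm : IsMotzkinPath r m) {α : ℕ} (h1 : 1 ≤ α)
    (h2 : α ≤ r) : IsSeedMonomial.{u} r m fun _ _ R => R (α - 1) (m α) *
      (if m (α - 1) = m α + 1 then
        lambdaRatio R (α - 1) (m α) / lambdaRatio R (α - 1) (m (α - 1)) else 1) := by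
  by_cases hr : α = 1
  · have hb := fun k => isSeedMonomial_boundary.{u} (r := r) (m := m) (α := α - 1)
      (Or.inl (by omega)) k
    split_ifs
    · exact (hb _).mul (((hb _).div (hb _)).div ((hb _).div (hb _)))
    · exact (hb _).mul isSeedMonomial_one
  · obtain ⟨β, rfl⟩ : ∃ β, α = β + 1 := ⟨α - 1, by omega⟩
    have hs := abs_le.1 (hm β (by omega) (by omega))
    simp only [Nat.add_sub_cancel]
    split_ifs with h
    · have h0 := isSeedMonomial_var.{u} (r := r) (m := m) (α := β) (by omega) (Or.inl rfl)
      have h1 := isSeedMonomial_var.{u} (r := r) (m := m) (α := β) (by omega) (Or.inr rfl)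
      refine ((h0.mul h0).div h1).congr fun K _ R hR => ?_
      have n0 := hR.ne_zero' (show β ≤ r + 1 by omega) (m (β + 1))
      have n1 := hR.ne_zero' (show β ≤ r + 1 by omega) (m (β + 1) + 1)
      have n2 := hR.ne_zero' (show β ≤ r + 1 by omega) (m (β + 1) + 1 + 1)
      rw [h, lambdaRatio, lambdaRatio]
      field_simp
    · exact (isSeedMonomial_var (by omega) (by omega)).mul isSeedMonomial_one

theorem isSeedMonomial_evenWeight (hm : IsMotzkinPath r m) {α : ℕ} (h1 : 1 ≤ α) (h2 : α ≤ r) :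
    IsSeedMonomial.{u} r m fun _ _ R => evenWeight m R α := by
  have p0 := isSeedMonomial_var.{u} (r := r) (m := m) (α := α) (by omega) (Or.inl rfl)
  have p1 := isSeedMonomial_var.{u} (r := r) (m := m) (α := α) (by omega) (Or.inr rfl)
  refine (((isSeedMonomial_evenWeight_upper hm h1 h2).mul
    (isSeedMonomial_evenWeight_lower hm h1 h2)).div (p1.mul p0)).congr fun K _ R hR => ?_
  simp only [evenWeight, muRatio, Nat.add_sub_cancel]
  rw [div_div_div_eq]
  ring

/-- The weights of the edges are Laurent monomials in the seed. -/
theorem isSeedMonomial_gammaWeight (hr : 1 ≤ r) (hm : IsMotzkinPath r m) {u v : GammaVertex}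
    (h : IsGammaEdge r m u v) : IsSeedMonomial.{u} r m fun _ _ R => gammaWeight r m R u v := by
  by_cases h1 : IsSkeletonEdge r m u v
  · obtain ⟨β, hβ, hβ', he⟩ := h1
    have h1 : IsSkeletonEdge r m u v := ⟨β, hβ, hβ', he⟩
    have key : IsSeedMonomial.{u} r m fun _ _ R => skeletonWeight m R β := by
      rcases skeletonEdge_cases hβ hβ' with ⟨α, a1, a2, rfl⟩ | ⟨α, a1, a2, rfl⟩
      · exact (isSeedMonomial_evenWeight hm a1 a2).congr fun K _ R _ => skeletonWeight_even R m α
      · exact (isSeedMonomial_oddWeight a2).congr fun K _ R _ => skeletonWeight_odd R m a1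
    refine key.congr fun K _ R _ => ?_
    rw [gammaWeight_of_isSkeletonEdge h1, skeletonEdgeWeight_eq R hr hβ hβ' he]
  · by_cases h2 : IsSkeletonEdge r m v u
    · refine isSeedMonomial_one.congr fun K _ R _ => ?_
      unfold gammaWeight
      rw [if_neg h1, if_pos h2]
    · have h3 : IsExtraEdge r m u v := (h.resolve_left h1).resolve_left h2
      obtain ⟨β, γ, a1, a2, a3, a4, rfl, rfl⟩ := h3
      have key : IsSeedMonomial.{u} r m fun _ _ R => runWeight m R γ β :=
        (IsSeedMonomial.prod _ fun i hi => isSeedMonomial_evenWeight hm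
          (by have := Finset.mem_Ico.1 hi; omega) (by have := Finset.mem_Ico.1 hi; omega)).div
        (IsSeedMonomial.prod _ fun i hi => isSeedMonomial_oddWeight
          (by have := Finset.mem_Ico.1 hi; omega))
      refine key.congr fun K _ R _ => ?_
      unfold gammaWeight
      rw [if_neg h1, if_neg h2]
      simp only
      rw [if_pos ⟨β, γ, a1, a2, a3, a4, rfl, rfl⟩, extraEdgeWeight_eq hr a1 a2.le a3 a4]

end Monomials

/-! ## Chips

Raising and lowering the height of one entry of a seed corresponds to multiplication by elementary
matrices, and the `Q`-system says that these multiplications are compatible. -/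

section Chips

variable {K : Type u} [Field K] {ι : Type*} [Fintype ι] [DecidableEq ι]

/-- The diagonal of a lower chip. -/
def chipDiagonal (p q : ι) (t : K) (i : ι) : K := if i = p then t else if i = q then t⁻¹ else 1

/-- The lower chip: it is `[[t, 0], [1, t⁻¹]]` in the rows and columns `p` and `q`. -/
def lowerChip (p q : ι) (t : K) : Matrix ι ι K :=
  Matrix.diagonal (chipDiagonal p q t) * Matrix.transvection q p t

theorem lowerChip_eq {p q : ι} (hpq : p ≠ q) {t : K} (ht : t ≠ 0) :
    lowerChip p q t = Matrix.diagonal (chipDiagonal p q t) + Matrix.single q p 1 := by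
  rw [lowerChip, Matrix.transvection, mul_add, mul_one]
  congr 1
  ext i j
  rw [Matrix.diagonal_mul, Matrix.single_apply, Matrix.single_apply]
  split_ifs with h
  · rw [← h.1, chipDiagonal, if_neg hpq.symm, if_pos rfl, inv_mul_cancel₀ ht]
  · simp

/-- The off-diagonal units multiply to zero, so only the diagonal of the chip acts, and it rescales
the parameter of the transvection. -/
theorem lowerChip_mul_transvection_of_ne {p q x y : ι} (hpq : p ≠ q) (hx : x ≠ p) (hy : y ≠ q)
    {t c c' : K} (ht : t ≠ 0) (h : c * chipDiagonal p q t x = c' * chipDiagonal p q t y) :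
    lowerChip p q t * Matrix.transvection x y c = Matrix.transvection x y c' * lowerChip p q t := by
  rw [lowerChip_eq hpq ht, Matrix.transvection, Matrix.transvection, mul_add, add_mul (1 : Matrix ι ι K),
    mul_one, one_mul]
  congr 1
  rw [add_mul, mul_add, Matrix.single_mul_single_of_ne _ _ _ _ hx.symm,
    Matrix.single_mul_single_of_ne _ _ _ _ hy, add_zero, add_zero]
  ext i j
  rw [Matrix.diagonal_mul, Matrix.mul_diagonal, Matrix.single_apply, Matrix.single_apply]
  split_ifs with g
  · rw [← g.1, ← g.2, mul_comm, h]
  · simp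

/-- An identity of two-by-two matrices. The two conditions compare the diagonal entries; the entry
above the diagonal then agrees too, all factors having determinant `1`. -/
theorem lowerChip_mul_transvection_self {p q : ι} (hpq : p ≠ q) {t t' c c' : K} (ht : t ≠ 0)
    (ht' : t' ≠ 0) (h1 : t = t' + c) (h2 : c' + t⁻¹ = t'⁻¹) :
    lowerChip p q t * Matrix.transvection p q c' =
      Matrix.transvection p q c * lowerChip p q t' := by
  have h3 : t * c' = c * t'⁻¹ := by
    have : c' = t'⁻¹ - t⁻¹ := by rw [← h2]; ring
    rw [this, mul_sub, mul_inv_cancel₀ ht, h1]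
    field_simp
    ring
  rw [lowerChip_eq hpq ht, lowerChip_eq hpq ht']
  ext i j
  by_cases hj : j = q
  · subst hj
    rw [Matrix.mul_transvection_apply_same]
    by_cases hi : i = p
    · subst hi
      rw [Matrix.transvection_mul_apply_same]
      simp [chipDiagonal, hpq, hpq.symm]
      rw [mul_comm, h3]
    · rw [Matrix.transvection_mul_apply_of_ne _ _ _ _ hi]
      by_cases hi' : i = j
      · subst hi'
        simp [chipDiagonal, hpq, hpq.symm]
        rw [← h2, add_comm]
      · simp [hpq, hi, hi', Ne.symm hi']
  · rw [Matrix.mul_transvection_apply_of_ne _ _ _ _ hj]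
    by_cases hi : i = p
    · subst hi
      rw [Matrix.transvection_mul_apply_same]
      by_cases hj' : j = i
      · subst hj'
        simp [chipDiagonal, hpq.symm]
        exact h1
      · simp [hpq.symm, Ne.symm hj, Ne.symm hj']
    · rw [Matrix.transvection_mul_apply_of_ne _ _ _ _ hi]
      simp [Matrix.diagonal_apply, chipDiagonal, hi]
      by_cases hij : i = j
      · subst hij
        simp [hj]
      · simp [hij]

end Chips

/-! ### Commutation of raising and lowering chips -/

section Flatness

variable {r : ℕ} {K : Type u} [Field K] {R : ℕ → ℤ → K}

/-- Row `a` of a matrix of size `r + 1`. -/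
def chipIndex (r a : ℕ) : Fin (r + 1) := Fin.ofNat (r + 1) a

theorem chipIndex_val {a : ℕ} (ha : a ≤ r) : (chipIndex r a : ℕ) = a := by
  simp only [chipIndex, Fin.val_ofNat]
  exact Nat.mod_eq_of_lt (by omega)

theorem chipIndex_inj {a b : ℕ} (ha : a ≤ r) (hb : b ≤ r) :
    chipIndex r a = chipIndex r b ↔ a = b := by
  rw [Fin.ext_iff, chipIndex_val ha, chipIndex_val hb]

/-- The chip which raises the entry `a` of the state `s`. -/
def raiseChip (r : ℕ) (R : ℕ → ℤ → K) (s : ℕ → ℤ) (a : ℕ) :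
    Matrix (Fin (r + 1)) (Fin (r + 1)) K :=
  lowerChip (chipIndex r (a - 1)) (chipIndex r a) (lambdaRatio R a (s a))

/-- The parameter of the chip which lowers the entry `a` of the state `s`. -/
def dropWeight (R : ℕ → ℤ → K) (s : ℕ → ℤ) (a : ℕ) : K :=
  R (a + 1) (s (a + 1)) * R (a - 1) (s (a - 1)) / (R a (s a) * R a (s a - 1))

/-- The chip which lowers the entry `a` of the state `s`. -/
def dropChip (r : ℕ) (R : ℕ → ℤ → K) (s : ℕ → ℤ) (a : ℕ) :
    Matrix (Fin (r + 1)) (Fin (r + 1)) K :=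
  Matrix.transvection (chipIndex r (a - 1)) (chipIndex r a) (dropWeight R s a)

theorem chipIndex_pred_ne {a : ℕ} (h1 : 1 ≤ a) (h2 : a ≤ r) :
    chipIndex r (a - 1) ≠ chipIndex r a := by
  rw [Ne, chipIndex_inj (by omega) h2]
  omega

/-- Raising `b` changes the drop parameter of `a` only if `a` and `b` are neighbours, and then by
the factor `lambdaRatio R b (s b)` which the diagonal of the chip compensates. -/
theorem raiseChip_mul_dropChip_of_ne (hR : IsQSystemSolution r R) (s : ℕ → ℤ) {a b : ℕ}
    (ha : 1 ≤ a) (ha' : a ≤ r) (hb : 1 ≤ b) (hb' : b ≤ r) (hab : a ≠ b) :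
    raiseChip r R s b * dropChip r R (Function.update s b (s b + 1)) a =
      dropChip r R s a * raiseChip r R s b := by
  have n0 := hR.ne_zero' (show b ≤ r + 1 by omega) (s b)
  have n1 := hR.ne_zero' (show b ≤ r + 1 by omega) (s b + 1)
  refine lowerChip_mul_transvection_of_ne (chipIndex_pred_ne hb hb') ?_ ?_
    (hR.lambdaRatio_ne_zero (by omega) _) ?_
  · rw [Ne, chipIndex_inj (by omega) (by omega)]; omega
  · rw [Ne, chipIndex_inj (by omega) (by omega)]; omega
  · simp only [chipDiagonal, chipIndex_inj (show a - 1 ≤ r by omega) (show b - 1 ≤ r by omega),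
      chipIndex_inj (show a - 1 ≤ r by omega) hb', chipIndex_inj ha' hb',
      chipIndex_inj ha' (show b - 1 ≤ r by omega)]
    rw [if_neg (by omega), if_neg hab]
    by_cases h1 : a - 1 = b
    · have e1 : Function.update s b (s b + 1) (a - 1) = s b + 1 := by rw [h1]; simp
      have e2 : s (a - 1) = s b := by rw [h1]
      rw [if_pos h1, if_neg (by omega), dropWeight, dropWeight, e1,
        Function.update_of_ne hab, Function.update_of_ne (by omega), lambdaRatio, e2, h1]
      field_simp
    · rw [if_neg h1]
      by_cases h2 : a = b - 1
      · have h2' : a + 1 = b := by omega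
        have e1 : Function.update s b (s b + 1) (a + 1) = s b + 1 := by rw [h2']; simp
        have e2 : s (a + 1) = s b := by rw [h2']
        rw [if_pos h2, dropWeight, dropWeight, e1,
          Function.update_of_ne hab, Function.update_of_ne h1, lambdaRatio, e2, h2']
        field_simp
      · rw [if_neg h2, dropWeight, dropWeight,
          Function.update_of_ne hab, Function.update_of_ne h1, Function.update_of_ne (by omega)]

/-- Both conditions of `lowerChip_mul_transvection_self` become the `Q`-system relation at `s a`
once the neighbours sit at that height. The hypotheses compare values of `R`, not heights, so that
they also cover the constant rows `0` and `r + 1`. -/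
theorem raiseChip_mul_dropChip_self (hR : IsQSystemSolution r R) (s : ℕ → ℤ) {a : ℕ}
    (ha : 1 ≤ a) (ha' : a ≤ r) (h1 : R (a + 1) (s (a + 1)) = R (a + 1) (s a))
    (h2 : R (a - 1) (s (a - 1)) = R (a - 1) (s a)) :
    raiseChip r R s a * dropChip r R (Function.update s a (s a + 1)) a =
      dropChip r R s a * raiseChip r R (Function.update s a (s a - 1)) a := by
  have n0 := hR.ne_zero' (show a ≤ r + 1 by omega) (s a)
  have n1 := hR.ne_zero' (show a ≤ r + 1 by omega) (s a + 1)
  have n2 := hR.ne_zero' (show a ≤ r + 1 by omega) (s a - 1)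
  have hq := hR.rel a (s a) ha ha'
  refine lowerChip_mul_transvection_self (chipIndex_pred_ne ha ha')
    (hR.lambdaRatio_ne_zero (by omega) _) (hR.lambdaRatio_ne_zero (by omega) _) ?_ ?_
  · rw [lambdaRatio, lambdaRatio, dropWeight, Function.update_self, h1, h2, sub_add_cancel]
    field_simp
    linear_combination hq
  · rw [lambdaRatio, lambdaRatio, dropWeight, Function.update_self,
      Function.update_self, Function.update_of_ne (by omega), Function.update_of_ne (by omega), h1, h2,
      sub_add_cancel,
      add_sub_cancel_right]
    field_simp
    linear_combination -hq

/-- The entries in `T` are raised by one. -/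
def raiseState (s : ℕ → ℤ) (T : List ℕ) (b : ℕ) : ℤ := if b ∈ T then s b + 1 else s b

/-- The product of the chips which raise the entries of a list. -/
def raiseProd (r : ℕ) (R : ℕ → ℤ → K) (s : ℕ → ℤ) (T : List ℕ) :
    Matrix (Fin (r + 1)) (Fin (r + 1)) K :=
  (T.map (raiseChip r R s)).prod

/-- The product of the chips which successively lower the entries of a list. -/
def dropProd (r : ℕ) (R : ℕ → ℤ → K) : (ℕ → ℤ) → List ℕ → Matrix (Fin (r + 1)) (Fin (r + 1)) K
  | _, [] => 1
  | s, a :: T => dropChip r R s a * dropProd r R (Function.update s a (s a - 1)) T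

theorem raiseProd_congr {s s' : ℕ → ℤ} {T : List ℕ} (h : ∀ a ∈ T, s a = s' a) :
    raiseProd r R s T = raiseProd r R s' T := by
  unfold raiseProd
  congr 1
  refine List.map_congr_left fun a ha => ?_
  rw [raiseChip, raiseChip, h a ha]

theorem raiseProd_mul_dropChip_of_notMem (hR : IsQSystemSolution r R) {T : List ℕ}
    (hT : ∀ b ∈ T, 1 ≤ b ∧ b ≤ r) (hnd : T.Nodup) {a : ℕ} (ha : 1 ≤ a) (ha' : a ≤ r) (haT : a ∉ T)
    (s : ℕ → ℤ) :
    raiseProd r R s T * dropChip r R (raiseState s T) a = dropChip r R s a * raiseProd r R s T := by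
  induction T generalizing s with
  | nil =>
    have : raiseState s [] = s := by funext b; simp [raiseState]
    simp [raiseProd, this]
  | cons b T ih =>
    rw [List.nodup_cons] at hnd
    simp only [List.mem_cons, not_or] at haT
    have e1 : raiseState s (b :: T) = raiseState (Function.update s b (s b + 1)) T := by
      funext c
      by_cases hc : c = b
      · subst hc; simp [raiseState, hnd.1]
      · simp [raiseState, hc]
    have e2 : raiseProd r R s T = raiseProd r R (Function.update s b (s b + 1)) T :=
      raiseProd_congr fun c hc => by
        rw [Function.update_of_ne]
        rintro rfl
        exact hnd.1 hc
    have e3 : raiseProd r R s (b :: T) = raiseChip r R s b * raiseProd r R s T := by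
      simp [raiseProd]
    have hb := hT b (by simp)
    rw [e3, e1, e2, mul_assoc, ih (fun c hc => hT c (by simp [hc])) hnd.2 haT.2, ← mul_assoc,
      ← mul_assoc, raiseChip_mul_dropChip_of_ne hR s ha ha' hb.1 hb.2 haT.1]

/-- The lowering chip passes freely through the raisings in `T₂`, is exchanged at `a` by the
`Q`-system when the entries of `T₁` have been raised, and then passes through `T₁`. -/
theorem raiseProd_mul_dropChip (hR : IsQSystemSolution r R) {T₁ T₂ : List ℕ} {a : ℕ}
    (hT : ∀ b ∈ T₁ ++ a :: T₂, 1 ≤ b ∧ b ≤ r) (hnd : (T₁ ++ a :: T₂).Nodup) (s : ℕ → ℤ)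
    (h1 : R (a + 1) (raiseState s T₁ (a + 1)) = R (a + 1) (s a))
    (h2 : R (a - 1) (raiseState s T₁ (a - 1)) = R (a - 1) (s a)) :
    raiseProd r R s (T₁ ++ a :: T₂) * dropChip r R (raiseState s (T₁ ++ a :: T₂)) a =
      dropChip r R s a * raiseProd r R (Function.update s a (s a - 1)) (T₁ ++ a :: T₂) := by
  obtain ⟨n1, n2, n3⟩ := List.nodup_append.1 hnd
  rw [List.nodup_cons] at n2
  have ha1 : a ∉ T₁ := fun h => n3 a h a (by simp) rfl
  have hd : ∀ b ∈ T₂, b ∉ T₁ := fun b hb h => n3 b h b (by simp [hb]) rfl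
  obtain ⟨ha, ha'⟩ := hT a (by simp)
  have es : raiseState s T₁ a = s a := by simp [raiseState, ha1]
  have split : ∀ s' : ℕ → ℤ, raiseProd r R s' (T₁ ++ a :: T₂) =
      raiseProd r R s' T₁ * (raiseChip r R s' a * raiseProd r R s' T₂) := by
    intro s'
    simp [raiseProd]
  obtain ⟨s₂, hs₂⟩ : ∃ s₂, s₂ = Function.update (raiseState s T₁) a (raiseState s T₁ a + 1) :=
    ⟨_, rfl⟩
  have e1 : raiseState s (T₁ ++ a :: T₂) = raiseState s₂ T₂ := by
    subst hs₂
    funext c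
    by_cases hc : c = a
    · subst hc; simp [raiseState, n2.1, ha1]
    · by_cases hc2 : c ∈ T₂
      · simp [raiseState, hc, hc2, hd c hc2]
      · simp [raiseState, hc, hc2]
  have e2 : raiseProd r R s T₂ = raiseProd r R s₂ T₂ := raiseProd_congr fun c hc => by
    have : c ≠ a := by rintro rfl; exact n2.1 hc
    subst hs₂
    simp [raiseState, this, hd c hc]
  have e3 : raiseChip r R s a = raiseChip r R (raiseState s T₁) a := by
    rw [raiseChip, raiseChip, es]
  have e4 : raiseProd r R (Function.update s a (s a - 1)) T₁ = raiseProd r R s T₁ :=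
    raiseProd_congr fun c hc => by
      rw [Function.update_of_ne]
      rintro rfl
      exact ha1 hc
  have e5 : raiseProd r R (Function.update s a (s a - 1)) T₂ = raiseProd r R s₂ T₂ := by
    rw [← e2]
    refine raiseProd_congr fun c hc => ?_
    rw [Function.update_of_ne]
    rintro rfl
    exact n2.1 hc
  have e6 : raiseChip r R (Function.update s a (s a - 1)) a =
      raiseChip r R (Function.update (raiseState s T₁) a (raiseState s T₁ a - 1)) a := by
    rw [raiseChip, raiseChip, Function.update_self, Function.update_self, es]
  rw [split, split, e1, e2, e3, e4, e5, e6, mul_assoc, mul_assoc,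
    raiseProd_mul_dropChip_of_notMem hR (fun b hb => hT b (by simp [hb])) n2.2 ha ha' n2.1,
    ← mul_assoc (raiseChip r R (raiseState s T₁) a), hs₂,
    raiseChip_mul_dropChip_self hR _ ha ha' (by rw [h1, es]) (by rw [h2, es]), ← mul_assoc,
    ← mul_assoc, raiseProd_mul_dropChip_of_notMem hR (fun b hb => hT b (by simp [hb])) n1 ha ha' ha1]
  simp only [mul_assoc]

/-- The entries in `T` are lowered by one. -/
def dropState (s : ℕ → ℤ) (T : List ℕ) (b : ℕ) : ℤ := if b ∈ T then s b - 1 else s b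

/-- The hypothesis `hs` describes the moment of the exchange at `a`: the entries before `a` in `V`
are already lowered, those before `a` in `T` are raised, and the neighbours of `a` must then be at
the height of `a`. -/
theorem raiseProd_mul_dropProd (hR : IsQSystemSolution r R) {T V : List ℕ}
    (hT : ∀ b ∈ T, 1 ≤ b ∧ b ≤ r) (hnd : T.Nodup) (hV : V.Nodup) (hVT : ∀ a ∈ V, a ∈ T) (s : ℕ → ℤ)
    (hs : ∀ V₁ a V₂ T₁ T₂, V = V₁ ++ a :: V₂ → T = T₁ ++ a :: T₂ →
      R (a + 1) (raiseState (dropState s V₁) T₁ (a + 1)) = R (a + 1) (s a) ∧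
      R (a - 1) (raiseState (dropState s V₁) T₁ (a - 1)) = R (a - 1) (s a)) :
    raiseProd r R s T * dropProd r R (raiseState s T) V =
      dropProd r R s V * raiseProd r R (dropState s V) T := by
  induction V generalizing s with
  | nil =>
    have : dropState s [] = s := by funext b; simp [dropState]
    simp [dropProd, this]
  | cons a V ih =>
    rw [List.nodup_cons] at hV
    have e0 : ∀ b V', (a ∉ V') → dropState (Function.update s a (s a - 1)) V' b =
        dropState s (a :: V') b := by
      intro b V' h'
      by_cases hb : b = a
      · subst hb; simp [dropState, h']
      · simp [dropState, hb]
    obtain ⟨T₁, T₂, rfl⟩ := List.append_of_mem (hVT a (by simp))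
    have h0 := hs [] a V T₁ T₂ rfl rfl
    have en : dropState s [] = s := by funext b; simp [dropState]
    rw [en] at h0
    have e1 : Function.update (raiseState s (T₁ ++ a :: T₂)) a
        (raiseState s (T₁ ++ a :: T₂) a - 1) =
        raiseState (Function.update s a (s a - 1)) (T₁ ++ a :: T₂) := by
      funext b
      by_cases hb : b = a
      · subst hb; simp [raiseState]
      · simp [raiseState, hb]
    have e2 : dropState (Function.update s a (s a - 1)) V = dropState s (a :: V) :=
      funext fun b => e0 b V hV.1
    rw [dropProd, dropProd, ← mul_assoc, raiseProd_mul_dropChip hR hT hnd s h0.1 h0.2, mul_assoc,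
      e1, ih hV.2 (fun b hb => hVT b (by simp [hb])), e2, mul_assoc]
    intro V₁ b V₂ T₁' T₂' hVe hTe
    have hba : b ≠ a := by
      rintro rfl
      exact hV.1 (by rw [hVe]; simp)
    have haV : a ∉ V₁ := fun h => hV.1 (by rw [hVe]; simp [h])
    have := hs (a :: V₁) b V₂ T₁' T₂' (by rw [hVe]; rfl) hTe
    rw [Function.update_of_ne hba, show dropState (Function.update s a (s a - 1)) V₁ =
      dropState s (a :: V₁) from funext fun b => e0 b V₁ haV]
    exact this

end Flatness

/-! ## The monodromy matrix of a seed -/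

section Towers

variable {M : Type*} [Monoid M]

/-- The product `A t * A (t + 1) * ⋯ * A (t + n - 1)`. -/
def ascendingProd (A : ℤ → M) : ℤ → ℕ → M
  | _, 0 => 1
  | t, n + 1 => A t * ascendingProd A (t + 1) n

/-- The product `B n * ⋯ * B 2 * B 1`. -/
def descendingProd (B : ℤ → M) : ℕ → M
  | 0 => 1
  | n + 1 => B (n + 1 : ℕ) * descendingProd B n

theorem mul_ascendingProd {A B : ℤ → M} (h : ∀ t, A t * B (t + 1) = B t * A (t - 1)) (t : ℤ)
    (n : ℕ) : B (t + 1) * ascendingProd A t n = ascendingProd A (t + 1) n * B (t + 1 + n) := by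
  induction n generalizing t with
  | zero => simp [ascendingProd]
  | succ n ih =>
    have := h (t + 1)
    rw [add_sub_cancel_right] at this
    rw [ascendingProd, ascendingProd, ← mul_assoc, ← this, mul_assoc, ih, mul_assoc]
    congr 3
    push_cast
    ring

/-- Flatness sorts the power: all raisings move to the left, all lowerings to the right, and each
factor is evaluated at its own time. -/
theorem monodromy_pow {A B : ℤ → M} (h : ∀ t, A t * B (t + 1) = B t * A (t - 1)) (n : ℕ) :
    (A 0 * B 1) ^ n = ascendingProd A 0 n * descendingProd B n := by
  induction n with
  | zero => simp [ascendingProd, descendingProd]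
  | succ n ih =>
    have := mul_ascendingProd h 0 n
    rw [zero_add] at this
    rw [pow_succ', ih, ascendingProd, descendingProd, mul_assoc, ← mul_assoc (B 1), this, zero_add]
    push_cast
    simp only [mul_assoc, add_comm]

end Towers

/-! ### Orders of raising and lowering -/

section Sorting

/-- A list of `1, …, r` without repetition, sorted by a linear order. -/
theorem exists_sorted_list (r : ℕ) (rel : ℕ → ℕ → Prop) (htot : ∀ a b, rel a b ∨ rel b a)
    (htrans : ∀ a b c, rel a b → rel b c → rel a c) :
    ∃ T : List ℕ, T.Nodup ∧ (∀ a, a ∈ T ↔ 1 ≤ a ∧ a ≤ r) ∧ T.Pairwise rel := by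
  classical
  have : Std.Total rel := ⟨htot⟩
  have : IsTrans ℕ rel := ⟨htrans⟩
  refine ⟨(List.range' 1 r).insertionSort rel, ?_, ?_, List.pairwise_insertionSort _ _⟩
  · exact (List.perm_insertionSort rel _).nodup_iff.2 List.nodup_range'
  · intro a
    rw [List.mem_insertionSort, List.mem_range'_1]
    omega

theorem mem_prefix_iff {rel : ℕ → ℕ → Prop} (hanti : ∀ a b, rel a b → rel b a → a = b)
    {T₁ T₂ : List ℕ} {a b : ℕ} (h : (T₁ ++ a :: T₂).Pairwise rel) (hb : b ∈ T₁ ++ a :: T₂)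
    (hab : b ≠ a) : b ∈ T₁ ↔ rel b a := by
  rw [List.pairwise_append] at h
  obtain ⟨h1, h2, h3⟩ := h
  rw [List.pairwise_cons] at h2
  refine ⟨fun h => h3 b h a (by simp), fun h => ?_⟩
  rcases List.mem_append.1 hb with hb | hb
  · exact hb
  · rcases List.mem_cons.1 hb with rfl | hb
    · exact absurd rfl hab
    · exact absurd (hanti _ _ h (h2.1 b hb)) hab

end Sorting

/-! ### Transport of a seed in time and its leading minors -/

section Monodromy

variable {r : ℕ} {m : ℕ → ℤ} {K : Type u} [Field K] {R : ℕ → ℤ → K}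

/-- Raising in the order `T` and dropping in the order `V` are compatible for the path `m`. -/
structure IsCompatible (r : ℕ) (m : ℕ → ℤ) (T V : List ℕ) : Prop where
  nodup_left : T.Nodup
  mem_left : ∀ a, a ∈ T ↔ 1 ≤ a ∧ a ≤ r
  nodup_right : V.Nodup
  mem_right : ∀ a, a ∈ V ↔ 1 ≤ a ∧ a ≤ r
  neighbour : ∀ V₁ a V₂ T₁ T₂, V = V₁ ++ a :: V₂ → T = T₁ ++ a :: T₂ → ∀ b, 1 ≤ b → b ≤ r →
    (b = a + 1 ∨ a = b + 1) → raiseState (dropState m V₁) T₁ b = m a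

/-- Raise the lowest entries first and lower the highest entries first, breaking ties by the index
in the same direction. A neighbour one below has then been raised, one above has been lowered, and
one at equal height has undergone both changes or neither. This is where the Motzkin condition is
needed. -/
theorem IsMotzkinPath.exists_isCompatible (hm : IsMotzkinPath r m) : ∃ T V, IsCompatible r m T V := by
  obtain ⟨T, t1, t2, t3⟩ := exists_sorted_list r (fun a b => m a < m b ∨ (m a = m b ∧ a ≤ b))
    (fun a b => by omega) (fun a b c => by omega)
  obtain ⟨V, v1, v2, v3⟩ := exists_sorted_list r (fun a b => m b < m a ∨ (m a = m b ∧ a ≤ b))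
    (fun a b => by omega) (fun a b c => by omega)
  refine ⟨T, V, t1, t2, v1, v2, ?_⟩
  rintro V₁ a V₂ T₁ T₂ rfl rfl b hb hb' hab
  obtain ⟨ha, ha'⟩ := (t2 a).1 (by simp)
  have hT := mem_prefix_iff (fun a b => by omega) t3 ((t2 b).2 ⟨hb, hb'⟩) (by omega)
  have hV := mem_prefix_iff (fun a b => by omega) v3 ((v2 b).2 ⟨hb, hb'⟩) (by omega)
  have hstep : |m a - m b| ≤ 1 := by
    rcases hab with rfl | rfl
    · exact hm a ha (by omega)
    · rw [abs_sub_comm]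
      exact hm b hb (by omega)
  rw [abs_le] at hstep
  simp only [raiseState, dropState, hT, hV]
  split_ifs <;> omega

/-- The path `m` moved by `t`. -/
def shiftState (m : ℕ → ℤ) (t : ℤ) (b : ℕ) : ℤ := m b + t

theorem dropProd_congr (hR : IsQSystemSolution r R) {V : List ℕ} (hV : ∀ a ∈ V, 1 ≤ a ∧ a ≤ r)
    {s s' : ℕ → ℤ} (h : ∀ b, 1 ≤ b → b ≤ r → s b = s' b) :
    dropProd r R s V = dropProd r R s' V := by
  have hval : ∀ b, b ≤ r + 1 → ∀ s s' : ℕ → ℤ, (∀ b, 1 ≤ b → b ≤ r → s b = s' b) →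
      R b (s b) = R b (s' b) := by
    intro b hb s s' h
    by_cases h0 : b = 0
    · subst h0; rw [hR.bottom, hR.bottom]
    · by_cases h1 : b = r + 1
      · subst h1; rw [hR.top, hR.top]
      · rw [h b (by omega) (by omega)]
  induction V generalizing s s' with
  | nil => rfl
  | cons a V ih =>
    obtain ⟨ha, ha'⟩ := hV a (by simp)
    rw [dropProd, dropProd, dropChip, dropChip, dropWeight, dropWeight,
      hval _ (by omega) s s' h, hval (a - 1) (by omega) s s' h, h a ha ha']
    congr 1
    refine ih (fun b hb => hV b (by simp [hb])) fun b hb hb' => ?_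
    by_cases hba : b = a
    · subst hba; simp
    · rw [Function.update_of_ne hba, Function.update_of_ne hba, h b hb hb']

/-- The zero curvature condition for the whole path at time `t`; at the boundary rows the height is
irrelevant since `R` is `1` there. -/
theorem IsCompatible.flat {T V : List ℕ} (hc : IsCompatible r m T V) (hR : IsQSystemSolution r R)
    (t : ℤ) :
    raiseProd r R (shiftState m t) T * dropProd r R (shiftState m (t + 1)) V =
      dropProd r R (shiftState m t) V * raiseProd r R (shiftState m (t - 1)) T := by
  have hV : ∀ a ∈ V, 1 ≤ a ∧ a ≤ r := fun a ha => (hc.mem_right a).1 ha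
  have hT : ∀ a ∈ T, 1 ≤ a ∧ a ≤ r := fun a ha => (hc.mem_left a).1 ha
  rw [dropProd_congr hR hV (s := shiftState m (t + 1)) (s' := raiseState (shiftState m t) T),
    raiseProd_mul_dropProd hR hT hc.nodup_left hc.nodup_right
      (fun a ha => (hc.mem_left a).2 (hV a ha))]
  · congr 1
    refine raiseProd_congr fun a ha => ?_
    rw [dropState, if_pos ((hc.mem_right a).2 (hT a ha)), shiftState, shiftState]
    ring
  · intro V₁ a V₂ T₁ T₂ hVe hTe
    obtain ⟨ha, ha'⟩ := hV a (by rw [hVe]; simp)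
    have key : ∀ b, 1 ≤ b → b ≤ r → (b = a + 1 ∨ a = b + 1) →
        raiseState (dropState (shiftState m t) V₁) T₁ b = shiftState m t a := by
      intro b hb hb' hab
      have := hc.neighbour V₁ a V₂ T₁ T₂ hVe hTe b hb hb' hab
      unfold raiseState dropState at *
      unfold shiftState
      split_ifs at * <;> omega
    constructor
    · by_cases h : a = r
      · subst h; rw [hR.top, hR.top]
      · rw [key (a + 1) (by omega) (by omega) (Or.inl rfl)]
    · by_cases h : a = 1
      · subst h; rw [Nat.sub_self, hR.bottom, hR.bottom]
      · rw [key (a - 1) (by omega) (by omega) (by omega)]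
  · intro b hb hb'
    rw [raiseState, if_pos ((hc.mem_left b).2 ⟨hb, hb'⟩), shiftState, shiftState]
    ring

/-- The leading principal minor of size `a`. -/
def leadingMinor {a : ℕ} (ha : a ≤ r + 1) (X : Matrix (Fin (r + 1)) (Fin (r + 1)) K) : K :=
  (X.submatrix (Fin.castLE ha) (Fin.castLE ha)).det

theorem leadingMinor_one {a : ℕ} (ha : a ≤ r + 1) :
    leadingMinor ha (1 : Matrix (Fin (r + 1)) (Fin (r + 1)) K) = 1 := by
  rw [leadingMinor, Matrix.submatrix_one _ (Fin.castLE_injective ha), Matrix.det_one]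

theorem leadingMinor_diagonal_mul {a : ℕ} (ha : a ≤ r + 1) (d : Fin (r + 1) → K)
    (X : Matrix (Fin (r + 1)) (Fin (r + 1)) K) :
    leadingMinor ha (Matrix.diagonal d * X) =
      (∏ i : Fin a, d (Fin.castLE ha i)) * leadingMinor ha X := by
  have : (Matrix.diagonal d * X).submatrix (Fin.castLE ha) (Fin.castLE ha) =
      Matrix.diagonal (fun i => d (Fin.castLE ha i)) *
        X.submatrix (Fin.castLE ha) (Fin.castLE ha) := by
    ext i j
    rw [Matrix.submatrix_apply, Matrix.diagonal_mul, Matrix.diagonal_mul, Matrix.submatrix_apply]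
  rw [leadingMinor, this, Matrix.det_mul, Matrix.det_diagonal, leadingMinor]

theorem leadingMinor_transvection_mul {a : ℕ} (ha : a ≤ r + 1) {p q : Fin (r + 1)} (hpq : p < q)
    (c : K) (X : Matrix (Fin (r + 1)) (Fin (r + 1)) K) :
    leadingMinor ha (Matrix.transvection q p c * X) = leadingMinor ha X := by
  unfold leadingMinor
  by_cases hq : (q : ℕ) < a
  · have hp : (p : ℕ) < a := lt_trans hpq hq
    have e : (Matrix.transvection q p c * X).submatrix (Fin.castLE ha) (Fin.castLE ha) =
        Matrix.transvection ⟨q, hq⟩ ⟨p, hp⟩ c *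
          X.submatrix (Fin.castLE ha) (Fin.castLE ha) := by
      ext i j
      rw [Matrix.submatrix_apply]
      by_cases hi : i = ⟨q, hq⟩
      · subst hi
        rw [Matrix.transvection_mul_apply_same]
        exact Matrix.transvection_mul_apply_same _ _ _ _ _
      · rw [Matrix.transvection_mul_apply_of_ne _ _ _ _ hi,
          Matrix.transvection_mul_apply_of_ne _ _ _ _ fun h => hi (by rw [Fin.ext_iff] at *; exact h),
          Matrix.submatrix_apply]
    rw [e, Matrix.det_mul, Matrix.det_transvection_of_ne, one_mul]
    rw [Ne, Fin.mk.injEq]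
    exact fun h => hpq.ne' (Fin.ext h)
  · congr 1
    ext i j
    rw [Matrix.submatrix_apply, Matrix.transvection_mul_apply_of_ne, Matrix.submatrix_apply]
    rintro rfl
    exact hq i.2

theorem leadingMinor_transpose {a : ℕ} (ha : a ≤ r + 1)
    (X : Matrix (Fin (r + 1)) (Fin (r + 1)) K) :
    leadingMinor ha X.transpose = leadingMinor ha X := by
  rw [leadingMinor, ← Matrix.transpose_submatrix, Matrix.det_transpose, leadingMinor]

theorem leadingMinor_mul_transvection {a : ℕ} (ha : a ≤ r + 1) {p q : Fin (r + 1)} (hpq : p < q)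
    (c : K) (X : Matrix (Fin (r + 1)) (Fin (r + 1)) K) :
    leadingMinor ha (X * Matrix.transvection p q c) = leadingMinor ha X := by
  have e : (X * Matrix.transvection p q c).transpose = Matrix.transvection q p c * X.transpose := by
    rw [Matrix.transpose_mul]
    congr 1
    rw [Matrix.transvection, Matrix.transvection, Matrix.transpose_add, Matrix.transpose_one,
      Matrix.transpose_single]
  rw [← leadingMinor_transpose, e, leadingMinor_transvection_mul ha hpq, leadingMinor_transpose]

theorem prod_ite_val_eq {a : ℕ} (x : ℕ) (t : K) :
    ∏ i : Fin a, (if (i : ℕ) = x then t else 1) = if x < a then t else 1 := by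
  by_cases h : x < a
  · rw [if_pos h, Fintype.prod_eq_single (⟨x, h⟩ : Fin a)]
    · simp
    · intro i hi
      rw [if_neg fun h' => hi (Fin.ext h')]
  · rw [if_neg h]
    exact Finset.prod_eq_one fun i _ => if_neg (by have := i.2; omega)

/-- The unitriangular factor does not change the minor. The diagonal has `t` and its inverse in the
adjacent places `b - 1` and `b`, counted from `0`, so the minor of size `a` sees exactly one of them
only if `a = b`. -/
theorem leadingMinor_raiseChip_mul (hR : IsQSystemSolution r R) {a b : ℕ} (ha : a ≤ r + 1)
    (hb : 1 ≤ b) (hb' : b ≤ r) (s : ℕ → ℤ) (X : Matrix (Fin (r + 1)) (Fin (r + 1)) K) :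
    leadingMinor ha (raiseChip r R s b * X) =
      (if a = b then lambdaRatio R b (s b) else 1) * leadingMinor ha X := by
  have hlt : chipIndex r (b - 1) < chipIndex r b := by
    rw [Fin.lt_def, chipIndex_val (by omega), chipIndex_val hb']
    omega
  have ht := hR.lambdaRatio_ne_zero (show b ≤ r + 1 by omega) (s b)
  rw [raiseChip, lowerChip, mul_assoc, leadingMinor_diagonal_mul,
    leadingMinor_transvection_mul ha hlt]
  congr 1
  have e : ∀ i : Fin a, chipDiagonal (chipIndex r (b - 1)) (chipIndex r b)
      (lambdaRatio R b (s b)) (Fin.castLE ha i) =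
      (if (i : ℕ) = b - 1 then lambdaRatio R b (s b) else 1) *
        (if (i : ℕ) = b then (lambdaRatio R b (s b))⁻¹ else 1) := by
    intro i
    rw [chipDiagonal]
    simp only [Fin.ext_iff, chipIndex_val (show b - 1 ≤ r by omega), chipIndex_val hb',
      Fin.val_castLE]
    split_ifs <;> first | omega | simp
  rw [Finset.prod_congr rfl fun i _ => e i, Finset.prod_mul_distrib, prod_ite_val_eq,
    prod_ite_val_eq]
  rcases lt_trichotomy a b with h | h | h
  · rw [if_neg (by omega), if_neg (by omega), if_neg (by omega), one_mul]
  · rw [if_pos (by omega), if_neg (by omega), if_pos h, mul_one]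
  · rw [if_pos (by omega), if_pos (by omega), if_neg (by omega), mul_inv_cancel₀ ht]

theorem leadingMinor_raiseProd_mul (hR : IsQSystemSolution r R) {a : ℕ} (ha : a ≤ r + 1)
    {T : List ℕ} (hT : ∀ b ∈ T, 1 ≤ b ∧ b ≤ r) (hnd : T.Nodup) (s : ℕ → ℤ)
    (X : Matrix (Fin (r + 1)) (Fin (r + 1)) K) :
    leadingMinor ha (raiseProd r R s T * X) =
      (if a ∈ T then lambdaRatio R a (s a) else 1) * leadingMinor ha X := by
  induction T with
  | nil => simp [raiseProd]
  | cons b T ih =>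
    rw [List.nodup_cons] at hnd
    obtain ⟨hb, hb'⟩ := hT b (by simp)
    have e : raiseProd r R s (b :: T) = raiseChip r R s b * raiseProd r R s T := by
      simp [raiseProd]
    rw [e, mul_assoc, leadingMinor_raiseChip_mul hR ha hb hb',
      ih (fun c hc => hT c (by simp [hc])) hnd.2, ← mul_assoc]
    congr 1
    by_cases h : a = b
    · subst h
      simp [hnd.1]
    · simp [h]

theorem leadingMinor_mul_dropProd {a : ℕ} (ha : a ≤ r + 1) {V : List ℕ}
    (hV : ∀ b ∈ V, 1 ≤ b ∧ b ≤ r) (s : ℕ → ℤ) (X : Matrix (Fin (r + 1)) (Fin (r + 1)) K) :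
    leadingMinor ha (X * dropProd r R s V) = leadingMinor ha X := by
  induction V generalizing s X with
  | nil => simp [dropProd]
  | cons b V ih =>
    obtain ⟨hb, hb'⟩ := hV b (by simp)
    have hlt : chipIndex r (b - 1) < chipIndex r b := by
      rw [Fin.lt_def, chipIndex_val (by omega), chipIndex_val hb']
      omega
    rw [dropProd, ← mul_assoc, ih (fun c hc => hV c (by simp [hc])), dropChip,
      leadingMinor_mul_transvection ha hlt]

/-- The monodromy matrix. -/
def monodromy (r : ℕ) (m : ℕ → ℤ) (R : ℕ → ℤ → K) (T V : List ℕ) :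
    Matrix (Fin (r + 1)) (Fin (r + 1)) K :=
  raiseProd r R (shiftState m 0) T * dropProd r R (shiftState m 1) V

/-- In the sorted power each raising product multiplies the minor by a quotient of consecutive
variables of row `a`, and these telescope. The lowering products are upper unitriangular and do not
affect it. -/
theorem IsCompatible.eq_leadingMinor {T V : List ℕ} (hc : IsCompatible r m T V)
    (hR : IsQSystemSolution r R) {a : ℕ} (ha : 1 ≤ a) (ha' : a ≤ r) (n : ℕ) :
    R a (m a + n) =
      R a (m a) * leadingMinor (show a ≤ r + 1 by omega) (monodromy r m R T V ^ n) := by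
  have hV : ∀ a ∈ V, 1 ≤ a ∧ a ≤ r := fun a ha => (hc.mem_right a).1 ha
  have hT : ∀ a ∈ T, 1 ≤ a ∧ a ≤ r := fun a ha => (hc.mem_left a).1 ha
  have h1 := monodromy_pow (A := fun t => raiseProd r R (shiftState m t) T)
    (B := fun t => dropProd r R (shiftState m t) V) (fun t => hc.flat hR t) n
  rw [monodromy, h1]
  have h2 : ∀ (t : ℤ) (n : ℕ) X, leadingMinor (show a ≤ r + 1 by omega)
      (ascendingProd (fun t => raiseProd r R (shiftState m t) T) t n * X) =
      R a (m a + t + n) / R a (m a + t) * leadingMinor (show a ≤ r + 1 by omega) X := by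
    intro t n
    induction n generalizing t with
    | zero =>
      intro X
      rw [ascendingProd, one_mul, Nat.cast_zero, add_zero, div_self (hR.ne_zero' (by omega) _),
        one_mul]
    | succ n ih =>
      intro X
      have n0 := hR.ne_zero' (show a ≤ r + 1 by omega) (m a + t)
      have n1 := hR.ne_zero' (show a ≤ r + 1 by omega) (m a + t + 1)
      rw [ascendingProd, mul_assoc, leadingMinor_raiseProd_mul hR _ hT hc.nodup_left,
        if_pos ((hc.mem_left a).2 ⟨ha, ha'⟩), ih, lambdaRatio, shiftState, ← add_assoc,
        show m a + t + ((n + 1 : ℕ) : ℤ) = m a + t + 1 + n by push_cast; ring]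
      field_simp
  have h3 : leadingMinor (show a ≤ r + 1 by omega)
      (descendingProd (fun t => dropProd r R (shiftState m t) V) n) = 1 := by
    clear h1
    have : ∀ X, leadingMinor (show a ≤ r + 1 by omega)
        (X * descendingProd (fun t => dropProd r R (shiftState m t) V) n) =
        leadingMinor (show a ≤ r + 1 by omega) X := by
      induction n with
      | zero => intro X; rw [descendingProd, mul_one]
      | succ n ih =>
        intro X
        rw [descendingProd, ← mul_assoc, ih,
          leadingMinor_mul_dropProd _ hV]
    rw [← one_mul (descendingProd _ n), this, leadingMinor_one]
  rw [h2, h3, mul_one, add_zero, mul_div_cancel₀ _ (hR.ne_zero' (by omega) _)]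

end Monodromy

/-! ## Positive Laurent polynomials in the seed -/

section Positivity

variable {r : ℕ} {m : ℕ → ℤ}

/-- The function `f` of the solutions is a sum of Laurent monomials in the seed. -/
def IsSeedPositive (r : ℕ) (m : ℕ → ℤ) (f : (K : Type u) → [Field K] → (ℕ → ℤ → K) → K) : Prop :=
  ∃ l : List (Fin r × Fin 2 → ℤ), ∀ (K : Type u) [Field K] (R : ℕ → ℤ → K),
    IsQSystemSolution r R →
      f K R = (l.map fun e => laurentMonomial e (motzkinSeed r m R)).sum

variable {f g : (K : Type u) → [Field K] → (ℕ → ℤ → K) → K}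

theorem IsSeedPositive.congr (hf : IsSeedPositive r m f)
    (h : ∀ (K : Type u) [Field K] (R : ℕ → ℤ → K), IsQSystemSolution r R → g K R = f K R) :
    IsSeedPositive r m g := by
  obtain ⟨e, he⟩ := hf
  exact ⟨e, fun K _ R hR => (h K R hR).trans (he K R hR)⟩

theorem IsSeedMonomial.isSeedPositive (hf : IsSeedMonomial r m f) : IsSeedPositive r m f := by
  obtain ⟨e, he⟩ := hf
  exact ⟨[e], fun K _ R hR => by simp [he K R hR]⟩

theorem isSeedPositive_zero : IsSeedPositive.{u} r m fun _ _ _ => 0 :=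
  ⟨[], fun K _ R hR => by simp⟩

theorem IsSeedPositive.add (hf : IsSeedPositive r m f) (hg : IsSeedPositive r m g) :
    IsSeedPositive r m fun K _ R => f K R + g K R := by
  obtain ⟨l, hl⟩ := hf
  obtain ⟨l', hl'⟩ := hg
  exact ⟨l ++ l', fun K _ R hR => by simp [hl K R hR, hl' K R hR]⟩

theorem IsSeedMonomial.mul_isSeedPositive (hf : IsSeedMonomial r m f) (hg : IsSeedPositive r m g) :
    IsSeedPositive r m fun K _ R => f K R * g K R := by
  obtain ⟨e, he⟩ := hf
  obtain ⟨l, hl⟩ := hg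
  refine ⟨l.map (e + ·), fun K _ R hR => ?_⟩
  simp only [he K R hR, hl K R hR, List.map_map, ← List.sum_map_mul_left]
  congr 1
  refine List.map_congr_left fun e' _ => ?_
  rw [Function.comp_apply, laurentMonomial_add (motzkinSeed_ne_zero hR m)]

theorem evalLaurent_add {K : Type u} [Field K] {ι : Type} [Fintype ι] (P Q : (ι → ℤ) →₀ ℕ)
    (x : ι → K) : evalLaurent (P + Q) x = evalLaurent P x + evalLaurent Q x := by
  classical
  unfold evalLaurent
  rw [Finsupp.sum_add_index']
  · simp
  · intro e c c'
    push_cast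
    ring

theorem IsSeedPositive.exists_evalLaurent (hf : IsSeedPositive r m f) :
    ∃ P : (Fin r × Fin 2 → ℤ) →₀ ℕ, ∀ (K : Type u) [Field K] (R : ℕ → ℤ → K),
      IsQSystemSolution r R → f K R = evalLaurent P (motzkinSeed r m R) := by
  classical
  obtain ⟨l, hl⟩ := hf
  refine ⟨(l.map fun e => Finsupp.single e 1).sum, fun K _ R hR => ?_⟩
  rw [hl K R hR]
  clear hl
  induction l with
  | nil => simp [evalLaurent]
  | cons e l ih =>
    rw [List.map_cons, List.sum_cons, List.map_cons, List.sum_cons, evalLaurent_add, ih]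
    congr 1
    simp [evalLaurent]

end Positivity

/-! ### Reversal of time -/

section Reversal

variable {r : ℕ} {m : ℕ → ℤ}

/-- Reversal of the time. -/
def reverseTime {K : Type u} (R : ℕ → ℤ → K) (a : ℕ) (n : ℤ) : K := R a (-n)

/-- The path which gives the same seed after reversal of the time. -/
def reversePath (m : ℕ → ℤ) (a : ℕ) : ℤ := -m a - 1

theorem IsQSystemSolution.reverseTime {K : Type u} [Field K] {R : ℕ → ℤ → K}
    (hR : IsQSystemSolution r R) : IsQSystemSolution r (reverseTime R) where
  bottom n := hR.bottom _
  top n := hR.top _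
  rel α n h1 h2 := by
    have := hR.rel α (-n) h1 h2
    simp only [_root_.reverseTime]
    rw [show -(n + 1) = -n - 1 by ring, show -(n - 1) = -n + 1 by ring, mul_comm]
    exact this
  ne_zero α n h1 h2 := hR.ne_zero α _ h1 h2

theorem IsMotzkinPath.reversePath (hm : IsMotzkinPath r m) : IsMotzkinPath r (reversePath m) := by
  intro α h1 h2
  have := hm α h1 h2
  rw [abs_le] at *
  unfold _root_.reversePath
  omega

/-- The heights `m a`, `m a + 1` become `-m a`, `-m a - 1`: the seed is the same, with the two
variables of each row interchanged. -/
theorem motzkinSeed_reverse {K : Type u} [Field K] (R : ℕ → ℤ → K) (j : Fin r × Fin 2) :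
    motzkinSeed r (reversePath m) (reverseTime R) j = motzkinSeed r m R (j.1, j.2.rev) := by
  obtain ⟨i, ε⟩ := j
  simp only [motzkinSeed, reverseTime, reversePath]
  congr 1
  rw [Fin.val_rev]
  omega

theorem IsSeedPositive.reverse {f : (K : Type u) → [Field K] → (ℕ → ℤ → K) → K}
    (hf : IsSeedPositive r (reversePath m) f) :
    IsSeedPositive r m fun K _ R => f K (reverseTime R) := by
  obtain ⟨l, hl⟩ := hf
  refine ⟨l.map fun e j => e (j.1, j.2.rev), fun K _ R hR => ?_⟩
  simp only [hl K _ hR.reverseTime, List.map_map]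
  congr 1
  refine List.map_congr_left fun e _ => ?_
  simp only [laurentMonomial, Function.comp_apply, motzkinSeed_reverse]
  have hinv : Function.Involutive fun j : Fin r × Fin 2 => (j.1, j.2.rev) := by
    intro j
    simp
  refine Fintype.prod_equiv hinv.toPerm _ _ fun j => ?_
  simp

end Reversal

/-! ### Matrices whose minors are positive Laurent polynomials -/

section TotalPositivity

variable {r N : ℕ} {m : ℕ → ℤ}
  {X E E' : (K : Type u) → [Field K] → (ℕ → ℤ → K) → Matrix (Fin N) (Fin N) K}
  {c : (K : Type u) → [Field K] → (ℕ → ℤ → K) → K}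

/-- All minors of the matrix are positive Laurent polynomials in the seed. -/
def IsTotallyPositive (r : ℕ) (m : ℕ → ℤ)
    (X : (K : Type u) → [Field K] → (ℕ → ℤ → K) → Matrix (Fin N) (Fin N) K) : Prop :=
  ∀ (k : ℕ) (f g : Fin k → Fin N), StrictMono f → StrictMono g →
    IsSeedPositive r m fun K _ R => ((X K R).submatrix f g).det

/-- Multiplication by the matrix from the right preserves total positivity. -/
def IsPositiveFactor (r : ℕ) (m : ℕ → ℤ)
    (E : (K : Type u) → [Field K] → (ℕ → ℤ → K) → Matrix (Fin N) (Fin N) K) : Prop :=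
  ∀ X : (K : Type u) → [Field K] → (ℕ → ℤ → K) → Matrix (Fin N) (Fin N) K,
    IsTotallyPositive r m X → IsTotallyPositive r m fun K _ R => X K R * E K R

/-- With increasing rows and columns, a minor of the identity is `1` if both sets agree and has a
zero row otherwise. -/
theorem isTotallyPositive_one :
    IsTotallyPositive.{u} r m fun K _ _ => (1 : Matrix (Fin N) (Fin N) K) := by
  intro k f g hf hg
  by_cases h : ∀ i, f i ∈ Set.range g
  · have hr : Set.range f = Set.range g := by
      refine Set.eq_of_subset_of_ncard_le (Set.range_subset_iff.2 h) ?_ (Set.finite_range g)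
      rw [← Set.image_univ, ← Set.image_univ, Set.ncard_image_of_injective _ hf.injective,
        Set.ncard_image_of_injective _ hg.injective]
    obtain rfl : f = g := (hf.range_inj hg).1 hr
    refine isSeedMonomial_one.isSeedPositive.congr fun K _ R _ => ?_
    rw [Matrix.submatrix_one _ hf.injective, Matrix.det_one]
  · push Not at h
    obtain ⟨i, hi⟩ := h
    refine isSeedPositive_zero.congr fun K _ R _ => ?_
    refine Matrix.det_eq_zero_of_row_eq_zero i fun j => ?_
    rw [Matrix.submatrix_apply]
    refine Matrix.one_apply_ne ?_
    exact fun h => hi ⟨j, h.symm⟩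

theorem IsPositiveFactor.mul (h : IsPositiveFactor r m E) (h' : IsPositiveFactor r m E') :
    IsPositiveFactor r m fun K _ R => E K R * E' K R := by
  intro X hX k f g hf hg
  refine (h' _ (h X hX) k f g hf hg).congr fun K _ R _ => ?_
  beta_reduce
  rw [mul_assoc]

theorem isPositiveFactor_one :
    IsPositiveFactor.{u} r m fun K _ _ => (1 : Matrix (Fin N) (Fin N) K) := by
  intro X hX k f g hf hg
  refine (hX k f g hf hg).congr fun K _ R _ => ?_
  beta_reduce
  rw [mul_one]

theorem IsPositiveFactor.pow (h : IsPositiveFactor r m E) (n : ℕ) :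
    IsPositiveFactor r m fun K _ R => E K R ^ n := by
  induction n with
  | zero => simpa only [pow_zero] using isPositiveFactor_one
  | succ n ih => simpa only [pow_succ] using ih.mul h

theorem isPositiveFactor_diagonal
    {d : (K : Type u) → [Field K] → (ℕ → ℤ → K) → Fin N → K}
    (hd : ∀ i, IsSeedMonomial r m fun K _ R => d K R i) :
    IsPositiveFactor r m fun K _ R => Matrix.diagonal (d K R) := by
  intro X hX k f g hf hg
  refine ((IsSeedMonomial.prod Finset.univ fun i _ => hd (g i)).mul_isSeedPositive
    (hX k f g hf hg)).congr fun K _ R _ => ?_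
  have : (X K R * Matrix.diagonal (d K R)).submatrix f g =
      (X K R).submatrix f g * Matrix.diagonal fun i => d K R (g i) := by
    ext i j
    rw [Matrix.submatrix_apply, Matrix.mul_diagonal, Matrix.mul_diagonal, Matrix.submatrix_apply]
  rw [this, Matrix.det_mul, Matrix.det_diagonal, mul_comm]

theorem strictMono_update {k : ℕ} {g : Fin k → Fin N} (hg : StrictMono g) {j : Fin k} {p : Fin N}
    (hp : (p : ℕ) + 1 = g j ∨ (g j : ℕ) + 1 = p) (hpg : ∀ i, g i ≠ p) :
    StrictMono (Function.update g j p) := by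
  intro i i' hii
  have h1 := Fin.lt_def.1 (hg hii)
  have h2 : (g i : ℕ) ≠ p := fun h => hpg i (Fin.ext h)
  have h3 : (g i' : ℕ) ≠ p := fun h => hpg i' (Fin.ext h)
  rw [Fin.lt_def]
  by_cases hi : i = j
  · subst hi
    rw [Function.update_self, Function.update_of_ne hii.ne']
    omega
  · rw [Function.update_of_ne hi]
    by_cases hi' : i' = j
    · subst hi'
      rw [Function.update_self]
      omega
    · rw [Function.update_of_ne hi']
      exact h1

/-- The minor becomes itself plus the parameter times the minor with column `q` replaced by `p`. If
`p` already occurs, that minor is zero. If not, the columns stay increasing because `p` and `q` are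
adjacent, so there is no sign. -/
theorem isPositiveFactor_transvection {p q : Fin N} (hpq : (p : ℕ) + 1 = q ∨ (q : ℕ) + 1 = p)
    (hc : IsSeedMonomial r m c) :
    IsPositiveFactor r m fun K _ R => Matrix.transvection p q (c K R) := by
  intro X hX k f g hf hg
  by_cases hq : ∃ j, g j = q
  · obtain ⟨j, rfl⟩ := hq
    have key : ∀ (K : Type u) [Field K] (R : ℕ → ℤ → K),
        ((X K R * Matrix.transvection p (g j) (c K R)).submatrix f g).det =
          ((X K R).submatrix f g).det +
            c K R * ((X K R).submatrix f (Function.update g j p)).det := by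
      intro K _ R
      have e : (X K R * Matrix.transvection p (g j) (c K R)).submatrix f g =
          ((X K R).submatrix f g).updateCol j
            ((fun i => X K R (f i) (g j)) + c K R • fun i => X K R (f i) p) := by
        ext i i'
        rw [Matrix.submatrix_apply]
        by_cases hi : i' = j
        · subst hi
          rw [Matrix.mul_transvection_apply_same, Matrix.updateCol_self]
          rfl
        · rw [Matrix.mul_transvection_apply_of_ne _ _ _ _ fun h => hi (hg.injective h),
            Matrix.updateCol_ne hi, Matrix.submatrix_apply]
      have e1 : ((X K R).submatrix f g).updateCol j (fun i => X K R (f i) (g j)) =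
          (X K R).submatrix f g := Matrix.updateCol_eq_self _ _
      have e2 : ((X K R).submatrix f g).updateCol j (fun i => X K R (f i) p) =
          (X K R).submatrix f (Function.update g j p) := by
        ext i i'
        by_cases hi : i' = j
        · subst hi
          rw [Matrix.updateCol_self, Matrix.submatrix_apply, Function.update_self]
        · rw [Matrix.updateCol_ne hi, Matrix.submatrix_apply, Matrix.submatrix_apply,
            Function.update_of_ne hi]
      rw [e, Matrix.det_updateCol_add, Matrix.det_updateCol_smul, e1, e2]
    by_cases hp : ∃ i, g i = p
    · obtain ⟨i, rfl⟩ := hp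
      refine (hX k f g hf hg).congr fun K _ R _ => ?_
      have hij : i ≠ j := by
        rintro rfl
        omega
      have hz : ((X K R).submatrix f (Function.update g j (g i))).det = 0 := by
        refine Matrix.det_zero_of_column_eq hij fun i' => ?_
        rw [Matrix.submatrix_apply, Matrix.submatrix_apply, Function.update_self,
          Function.update_of_ne hij]
      rw [key, hz, mul_zero, add_zero]
    · push Not at hp
      exact ((hX k f g hf hg).add (hc.mul_isSeedPositive
        (hX k f _ hf (strictMono_update hg hpq hp)))).congr fun K _ R _ => key K R
  · push Not at hq
    refine (hX k f g hf hg).congr fun K _ R _ => ?_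
    beta_reduce
    congr 1
    ext i j
    rw [Matrix.submatrix_apply, Matrix.mul_transvection_apply_of_ne _ _ _ _ (hq j),
      Matrix.submatrix_apply]

end TotalPositivity

/-! ### Positivity of the monodromy -/

section Monodromy

variable {r : ℕ} {m : ℕ → ℤ}

theorem isPositiveFactor_raiseChip {b : ℕ} (hb : 1 ≤ b) (hb' : b ≤ r) {s : ℕ → ℤ}
    (hs : s b = m b) : IsPositiveFactor.{u} r m fun _ _ R => raiseChip r R s b := by
  have ht : IsSeedMonomial.{u} r m fun _ _ R => lambdaRatio R b (s b) := by
    rw [hs]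
    exact isSeedMonomial_lambdaRatio (by omega)
  refine IsPositiveFactor.mul (isPositiveFactor_diagonal fun i => ?_)
    (isPositiveFactor_transvection ?_ ht)
  · simp only [chipDiagonal]
    split_ifs
    · exact ht
    · exact (isSeedMonomial_one.div ht).congr fun K _ R _ => (one_div _).symm
    · exact isSeedMonomial_one
  · rw [chipIndex_val hb', chipIndex_val (by omega)]
    omega

/-- While the entries are being lowered from `m + 1` to `m`, all heights are those of the seed. The
entry `b` is still at `m b + 1`, so the four variables in the parameter belong to the seed. -/
theorem isPositiveFactor_dropChip {b : ℕ} (hb : 1 ≤ b) (hb' : b ≤ r) {s : ℕ → ℤ}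
    (hs : ∀ a, s a = m a ∨ s a = m a + 1) (hsb : s b = m b + 1) :
    IsPositiveFactor.{u} r m fun _ _ R => dropChip r R s b := by
  refine isPositiveFactor_transvection ?_ ?_
  · rw [chipIndex_val hb', chipIndex_val (by omega)]
    omega
  · exact ((isSeedMonomial_var (by omega) (hs _)).mul (isSeedMonomial_var (by omega) (hs _))).div
      ((isSeedMonomial_var (by omega) (hs _)).mul (isSeedMonomial_var (by omega) (by omega)))

theorem isPositiveFactor_raiseProd {T : List ℕ} (hT : ∀ b ∈ T, 1 ≤ b ∧ b ≤ r) {s : ℕ → ℤ}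
    (hs : ∀ a, s a = m a) : IsPositiveFactor.{u} r m fun _ _ R => raiseProd r R s T := by
  induction T with
  | nil => exact isPositiveFactor_one
  | cons b T ih =>
    obtain ⟨hb, hb'⟩ := hT b (by simp)
    have := (isPositiveFactor_raiseChip.{u} hb hb' (hs b)).mul (ih fun c hc => hT c (by simp [hc]))
    simpa only [raiseProd, List.map_cons, List.prod_cons] using this

theorem isPositiveFactor_dropProd {V : List ℕ} (hV : ∀ b ∈ V, 1 ≤ b ∧ b ≤ r) (hnd : V.Nodup)
    {s : ℕ → ℤ} (hs : ∀ a, s a = m a ∨ s a = m a + 1) (hsV : ∀ a ∈ V, s a = m a + 1) :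
    IsPositiveFactor.{u} r m fun _ _ R => dropProd r R s V := by
  induction V generalizing s with
  | nil => exact isPositiveFactor_one
  | cons b V ih =>
    rw [List.nodup_cons] at hnd
    obtain ⟨hb, hb'⟩ := hV b (by simp)
    have hsb := hsV b (by simp)
    refine (isPositiveFactor_dropChip.{u} hb hb' hs hsb).mul
      (ih (fun c hc => hV c (by simp [hc])) hnd.2 (fun a => ?_) fun a ha => ?_)
    · by_cases h : a = b
      · subst h
        rw [Function.update_self]
        omega
      · rw [Function.update_of_ne h]
        exact hs a
    · rw [Function.update_of_ne]
      · exact hsV a (by simp [ha])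
      · rintro rfl
        exact hnd.1 ha

/-- Positivity forward in time. -/
theorem IsMotzkinPath.isSeedPositive_of_nonneg (hm : IsMotzkinPath r m) {a : ℕ} (ha : 1 ≤ a)
    (ha' : a ≤ r) (n : ℕ) : IsSeedPositive.{u} r m fun _ _ R => R a (m a + n) := by
  obtain ⟨T, V, hc⟩ := hm.exists_isCompatible
  have hM : IsPositiveFactor.{u} r m fun _ _ R => monodromy r m R T V :=
    (isPositiveFactor_raiseProd (fun b hb => (hc.mem_left b).1 hb)
      (fun a => by simp [shiftState])).mul
    (isPositiveFactor_dropProd (fun b hb => (hc.mem_right b).1 hb) hc.nodup_right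
      (fun a => Or.inr rfl) (fun a _ => rfl))
  have hP := (hM.pow n) _ isTotallyPositive_one a (Fin.castLE (show a ≤ r + 1 by omega))
    (Fin.castLE (show a ≤ r + 1 by omega)) (Fin.strictMono_castLE _) (Fin.strictMono_castLE _)
  refine ((isSeedMonomial_var (α := a) (by omega) (Or.inl rfl)).mul_isSeedPositive hP).congr
    fun K _ R hR => ?_
  beta_reduce
  rw [one_mul]
  exact hc.eq_leadingMinor hR ha ha' n

/-- Times before `m a` are times after the seed of the reversed path. -/
theorem IsMotzkinPath.isSeedPositive (hm : IsMotzkinPath r m) {a : ℕ} (ha : 1 ≤ a)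
    (ha' : a ≤ r) (n : ℤ) : IsSeedPositive.{u} r m fun _ _ R => R a n := by
  rcases le_or_gt (m a) n with h | h
  · obtain ⟨k, rfl⟩ : ∃ k : ℕ, n = m a + k := ⟨(n - m a).toNat, by omega⟩
    exact hm.isSeedPositive_of_nonneg ha ha' k
  · obtain ⟨k, hk⟩ : ∃ k : ℕ, n = -(_root_.reversePath m a + k) :=
      ⟨(m a - n + 1).toNat, by unfold _root_.reversePath; omega⟩
    refine (hm.reversePath.isSeedPositive_of_nonneg ha ha' k).reverse.congr fun K _ R _ => ?_
    rw [hk]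
    rfl

end Monodromy

/-! ### The theorem -/

theorem mainTheorem3 (r : ℕ) :
    -- the path formula, for seeds in the fundamental domain
    (∀ m : ℕ → ℤ, IsFundamentalMotzkinPath r m →
      -- the weights are functions (Laurent monomials) of the seed
      (∀ u v : GammaVertex, IsGammaEdge r m u v →
        ∃ e : Fin r × Fin 2 → ℤ, ∀ (K : Type u) [Field K] (R : ℕ → ℤ → K),
          IsQSystemSolution r R →
            gammaWeight r m R u v = laurentMonomial e (motzkinSeed r m R)) ∧
      ∀ α n : ℕ, 1 ≤ α → α ≤ r → α ≤ n + 1 →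
        (stronglyNonIntersectingFamilies r m α n).Finite ∧
        ∀ (K : Type u) [Field K] (R : ℕ → ℤ → K), IsQSystemSolution r R →
          R α ((n : ℤ) + m 1) =
            R 1 (m 1) ^ α * stronglyNonIntersectingPartition r m R α n) ∧
    -- positivity, for every variable and every Motzkin seed
    (∀ m : ℕ → ℤ, IsMotzkinPath r m → ∀ (α : ℕ) (n : ℤ), 1 ≤ α → α ≤ r →
      ∃ P : (Fin r × Fin 2 → ℤ) →₀ ℕ, ∀ (K : Type u) [Field K] (R : ℕ → ℤ → K),
        IsQSystemSolution r R → R α n = evalLaurent P (motzkinSeed r m R)) := by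
  refine ⟨fun m hm => ⟨fun u v huv => ?_, fun α n h1 h2 h3 => ⟨?_, fun K _ R hR => ?_⟩⟩,
    fun m hm α n h1 h2 => (hm.isSeedPositive h1 h2 n).exists_evalLaurent⟩
  · obtain ⟨β, h1, h2, -⟩ := hm.2.2
    exact isSeedMonomial_gammaWeight (h1.trans h2) hm.1 huv
  · exact stronglyNonIntersectingFamilies_finite (h1.trans h2) h3 h1
  · exact eq_stronglyNonIntersectingPartition hm.1 hR h1 h2 h3
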